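/- **Setting.** Let $n,p\ge 1$ and $q$ be integers with $\gcd(p,q)=1$. The twisted grid with parameters $(n,p,q)$ is the torus obtained from the planar $n\times pn$ grid by identifying the left and right sides and gluing top to bottom by $(s,n)\sim(s-qn \bmod pn,\,0)$. Its horizontal lines give circles $\alpha_1,\dots,\alpha_n$, its vertical lines give circles $\beta_1,\dots,\beta_n$, and $|\alpha_i\cap\beta_j|=p$. A grid diagram $G$ for a link (in particular, for a knot) in $L(p,q)$ places markings $\mathbb X_1,\dots,\mathbb X_n$ and $\mathbb O_1,\dots,\mathbb O_n$ in the squares, so that each row and each column contains exactly one $\mathbb X$ and one $\mathbb O$, and no square contains two markings. A generator $x\in S(G)=\mathfrak S_n\times(\mathbb Z/p)^n$, $x=(\sigma_x,a^x)$, is a choice of one point on each $\alpha$ and each $\beta$ circle; the point on $\alpha_l$ is the $a^x_l$-th intersection point of $\alpha_l$ and $\beta_{\sigma_x(l)}$, counted from the left in the planar grid. For $x,y\in S(G)$, $\mathrm{Rect}(x,y)$ is the set of rectangles embedded in the torus, with horizontal sides on two different $\alpha$ circles and vertical sides on $\beta$ circles, whose lower left and upper right corners are points of $x$, whose lower right and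 upper left corners are points of $y$, where $x$ and $y$ agree in all other points. (Embedded means that no square of the torus is covered twice.) A rectangle is empty if its interior contains no point of $x$. The polygon $r_1*r_2$, for $r_1\in\mathrm{Rect}(x,y)$ and $r_2\in\mathrm{Rect}(y,z)$, is the sum of $r_1$ and $r_2$ as a chain of squares, regarded as connecting $x$ to $z$. A *sign assignment* is a function $\mathcal S:\mathrm{Rect}(G)=\bigcup_{x,y}\mathrm{Rect}(x,y)\to\{\pm1\}$ such that 1. if $r_1*r_2=r_3*r_4$ are two different decompositions of the same polygon connecting $x$ to $z$, then $\mathcal S(r_1)\mathcal S(r_2)=-\mathcal S(r_3)\mathcal S(r_4)$; 2. if $r_1*r_2$ is a horizontal annulus, then $\mathcal S(r_1)\mathcal S(r_2)=1$; 3. if $r_1*r_2$ is a vertical annulus, then $\mathcal S(r_1)\mathcal S(r_2)=-1$. The *Spin central extension* $\widetilde{\mathfrak S}_n$ has generators $z$ and $\tilde\tau_{i,j}$ $(i\ne j)$ and relations $z^2=1$, $z\tilde\tau_{i,j}=\tilde\tau_{i,j}z$, $\tilde\tau_{i,j}^2=z$, $\tilde\tau_{i,j}=z\tilde\tau_{j,i}$,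 $\tilde\tau_{i,j}\tilde\tau_{k,l}=z\tilde\tau_{k,l}\tilde\tau_{i,j}$ for distinct $i,j,k,l$, and $\tilde\tau_{i,j}\tilde\tau_{j,k}\tilde\tau_{i,j}=\tilde\tau_{j,k}\tilde\tau_{i,j}\tilde\tau_{j,k}=\tilde\tau_{i,k}$ for distinct $i,j,k$. Its projection $\pi:\widetilde{\mathfrak S}_n\to\mathfrak S_n$ sends $z\mapsto1$ and $\tilde\tau_{i,j}\mapsto(i\,j)$. A *section* is a map $\rho$ with $\pi\circ\rho=\mathrm{id}$, extended to $S(G)\to\widetilde{\mathfrak S}_n\times(\mathbb Z/p)^n$ by the identity on $(\mathbb Z/p)^n$. For $r\in\mathrm{Rect}(x,y)$ whose bottom edge goes from $\beta_i$ (the point of $x$) to $\beta_j$ (the point of $y$), put $\varphi(r)=(\tilde\tau_{i,j},a^y-a^x)$. With products of permutations read as compositions of functions, put $\mathcal S_\rho(r)=1$ if $\varphi(r)\rho(x)=\rho(y)$ and $\mathcal S_\rho(r)=-1$ if $\varphi(r)\rho(x)=z\rho(y)$. For a sign function $\mathcal S$, define $$\partial_{\mathcal S}(x)=\sum_{y\in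 S(G)}\ \sum_{r}\mathcal S(r)\prod_{i=1}^nV_i^{O_i(r)}\,y,$$ where $r$ runs over the empty rectangles in $\mathrm{Rect}(x,y)$ that contain no $\mathbb X$, and $O_i(r)$ counts the occurrences of $\mathbb O_i$ in $r$. This is an endomorphism of the free module $GC^-(G)$ on $S(G)$ over $\mathbb Z[V_1,\dots,V_n]$, and of the free module $\widehat{GC}(G)$ on $S(G)$ over $\mathbb Z[V_1,\dots,V_n]/(V_e)$, where $\mathbb O_e$ is any fixed marking. Both modules are trigraded as follows. Let $\widetilde{\ \cdot\ }$ send a set of points $(c_i,b_i)$ of the planar grid to the set of the points $(c_i+nqk \bmod np,\ b_i+nk)$, $0\le k<p$, and let $\mathcal I(A,B)$ be the number of pairs $(a,b)\in A\times B$ with $a_1<b_1$ and $a_2<b_2$; the markings have half-integral coordinates. Then $$M(x)=\tfrac1p\big[\mathcal I(\tilde x,\tilde x)-\mathcal I(\tilde x,\widetilde{\mathbb O})-\mathcal I(\widetilde{\mathbb O},\tilde x)+\mathcal I(\widetilde{\mathbb O},\widetilde{\mathbb O})\big]+d(p,q,q-1)+1,$$ $$A(x)=\tfrac1{2p}\big[\mathcal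 I(\widetilde{\mathbb O},\widetilde{\mathbb O})-\mathcal I(\widetilde{\mathbb X},\widetilde{\mathbb X})+2\mathcal I(\widetilde{\mathbb X},\tilde x)-2\mathcal I(\widetilde{\mathbb O},\tilde x)\big]+\tfrac{1-n}2,$$ $$S(x)=q-1+\sum_i(a^x_i-a^{\mathbb O}_i)\in\mathbb Z/p,$$ where $a^{\mathbb O}$ are the $p$-coordinates of the generator formed by the lower left corners of the squares containing the $\mathbb O$'s. In $d(p,q,q-1)$ the entries $q$ and $q-1$ are reduced mod $p$, and $d$ is given by $d(1,0,0)=0$ and $d(p,q,i)=\frac{pq-(2i+1-p-q)^2}{4pq}+d(q,\,p\bmod q,\,i\bmod q)$. Multiplication by any $V_i$ changes $(M,A,S)$ by $(-2,-1,0)$. **Theorem.** * Every twisted grid with coprime parameters $p,q$ has a sign assignment. Explicitly, sections $\rho$ of $\widetilde{\mathfrak S}_n$ exist, and for every section $\rho$ the function $\mathcal S_\rho$ is well defined (for each rectangle exactly one of its two defining cases occurs) and is a sign assignment. * For every sign assignment $\mathcal S$ and every grid diagram $G$, $\partial_{\mathcal S}^2=0$ on $GC^-(G)$ and on $\widehat{GC}(G)$.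 * If $\mathcal S$ and $\mathcal S'$ are two sign assignments, there is a gauge map $v:S(G)\to\{\pm1\}\cong\mathbb Z/2$ such that $\mathcal S'(r)=v(x)\mathcal S(r)v(y)$ for all $r\in\mathrm{Rect}(x,y)$. For every grid diagram $G$, the linear map $x\mapsto v(x)x$ is then an isomorphism of trigraded complexes $(GC^-(G),\partial_{\mathcal S})\to(GC^-(G),\partial_{\mathcal S'})$, and likewise for $\widehat{GC}(G)$. In particular the homologies $\ker\partial/\operatorname{im}\partial$ of $\partial_{\mathcal S}$ and $\partial_{\mathcal S'}$ are isomorphic as trigraded modules over the ground ring, in both flavors. -/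

import Mathlib

open scoped BigOperators

namespace TwistedGrid

noncomputable section

/-! ## The twisted torus, generators and rectangles

The torus is the quotient of the plane by the lattice spanned by `(n * p, 0)` and `(q * n, n)`:
the top edge of the planar `n × p n` grid is glued to the bottom edge by `(s, n) ∼ (s - q n, 0)`.
Horizontal circles are the lines at integer height modulo `n`; the vertical circle `β_j` consists
of the vertical lines at integer abscissa congruent to `j` modulo `n`. -/

/-- The integer points `(s, t)` and `(s', t')` of the plane project to the same point of the
twisted torus.  Applied to lower left corners, it also says that two unit squares of the plane
project to the same square of the grid. -/
def SamePoint (n p : ℕ) (q : ℤ) (s t s' t' : ℤ) : Prop :=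
  ∃ k : ℤ, t' = t + n * k ∧ s' ≡ s + n * q * k [ZMOD (n * p : ℤ)]

/-- Generators, `S(G) = 𝔖_n × (ℤ/p)^n`: the component of `x = (σ, a)` on the horizontal circle
`α_l` is the `a l`-th intersection point of `α_l` and `β_{σ l}`. -/
abbrev Generator (n p : ℕ) : Type := Equiv.Perm (Fin n) × (Fin n → ZMod p)

variable {n p : ℕ} {q : ℤ}

/-- Abscissa, in the planar `n × p n` grid, of the component of `x` on `α_l`. -/
def Generator.col (x : Generator n p) (l : Fin n) : ℤ := ((x.1 l : ℕ) : ℤ) + n * (x.2 l).val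

/-- `(s, t)` projects to a component of `x`. -/
def Generator.OnLift (q : ℤ) (x : Generator n p) (s t : ℤ) : Prop :=
  ∃ l : Fin n, SamePoint n p q (x.col l) ((l : ℕ) : ℤ) s t

/-- An oriented rectangle from `x` to `y`, embedded in the torus: its lower left corner (on the
circle `α_bot`) and upper right corner (on `α_top`) are components of `x`, its lower right and
upper left corners are components of `y`, and all the other components of `x` and `y` agree.
It is recorded by the circles carrying its horizontal edges, its width and its height; its
standard lift has lower left corner `(x.col bot, bot)`. -/
@[ext]
structure Rect (q : ℤ) (x y : Generator n p) where
  bot : Fin n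
  top : Fin n
  width : ℕ
  height : ℕ
  bot_ne_top : bot ≠ top
  width_pos : 0 < width
  width_lt : width < n * p
  height_pos : 0 < height
  height_lt : height < n * p
  upper_right : SamePoint n p q (x.col top) ((top : ℕ) : ℤ)
    (x.col bot + width) (((bot : ℕ) : ℤ) + height)
  lower_right : SamePoint n p q (y.col bot) ((bot : ℕ) : ℤ)
    (x.col bot + width) ((bot : ℕ) : ℤ)
  upper_left : SamePoint n p q (y.col top) ((top : ℕ) : ℤ)
    (x.col bot) (((bot : ℕ) : ℤ) + height)
  agree : ∀ l : Fin n, l ≠ bot → l ≠ top → x.1 l = y.1 l ∧ x.2 l = y.2 l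
  embedded : ∀ i j i' j' : ℕ, i < width → j < height → i' < width → j' < height →
    SamePoint n p q (x.col bot + i) (((bot : ℕ) : ℤ) + j)
      (x.col bot + i') (((bot : ℕ) : ℤ) + j') → i = i' ∧ j = j'

namespace Rect

variable {x y z : Generator n p}

instance : Finite (Rect q x y) := by
  let f : Rect q x y → (Fin n × Fin n) × (Fin (n * p) × Fin (n * p)) := fun r =>
    ((r.bot, r.top), (⟨r.width, r.width_lt⟩, ⟨r.height, r.height_lt⟩))
  refine Finite.of_injective f ?_
  intro r s h
  simp only [f, Prod.mk.injEq, Fin.mk.injEq] at h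
  obtain ⟨⟨h1, h2⟩, h3, h4⟩ := h
  exact Rect.ext h1 h2 h3 h4

instance : Fintype (Rect q x y) := Fintype.ofFinite _

open Classical in
/-- The number of times that the square of the torus with lower left corner `(c, l)` appears
in the rectangle. -/
def mult (r : Rect q x y) (c l : ℤ) : ℕ :=
  ((Finset.range r.width ×ˢ Finset.range r.height).filter fun ij =>
    SamePoint n p q c l (x.col r.bot + ij.1) (((r.bot : ℕ) : ℤ) + ij.2)).card

/-- The interior of the rectangle contains no component of `x`. -/
def IsEmpty (r : Rect q x y) : Prop :=
  ∀ i j : ℕ, 0 < i → i < r.width → 0 < j → j < r.height →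
    ¬ x.OnLift q (x.col r.bot + i) (((r.bot : ℕ) : ℤ) + j)

/-- The two components of `x` and `y` on the bottom edge lie on different vertical circles. -/
theorem perm_bot_ne (r : Rect q x y) : x.1 r.bot ≠ y.1 r.bot := by
  have hn : (n : ℤ) ∣ (n * p : ℤ) := Dvd.intro _ rfl
  obtain ⟨k, hk, h1⟩ := r.upper_right
  obtain ⟨k', hk', h2⟩ := r.lower_right
  have h1' := h1.of_dvd hn
  have h2' := h2.of_dvd hn
  have key : ((x.1 r.top : ℕ) : ℤ) ≡ ((y.1 r.bot : ℕ) : ℤ) [ZMOD (n : ℤ)] := by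
    have h3 := h1'.symm.trans h2'
    have e1 : x.col r.top + n * q * k ≡ ((x.1 r.top : ℕ) : ℤ) [ZMOD (n : ℤ)] := by
      refine Int.modEq_iff_dvd.2 ⟨-((x.2 r.top).val + q * k), ?_⟩
      simp only [Generator.col]; ring
    have e2 : y.col r.bot + n * q * k' ≡ ((y.1 r.bot : ℕ) : ℤ) [ZMOD (n : ℤ)] := by
      refine Int.modEq_iff_dvd.2 ⟨-((y.2 r.bot).val + q * k'), ?_⟩
      simp only [Generator.col]; ring
    exact (e1.symm.trans h3).trans e2
  have key2 : x.1 r.top = y.1 r.bot := by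
    have h := Int.natCast_modEq_iff.1 key
    exact Fin.ext (Nat.ModEq.eq_of_lt_of_lt h (x.1 r.top).2 (y.1 r.bot).2)
  intro h
  exact r.bot_ne_top (x.1.injective (h.trans key2.symm))

end Rect

/-! ## Polygons and sign assignments -/

/-- A concatenation `r₁ * r₂` of a rectangle from `x` to some `y` with a rectangle from `y`
to `z`. -/
structure Concat (q : ℤ) (x z : Generator n p) where
  mid : Generator n p
  fst : Rect q x mid
  snd : Rect q mid z

/-- The underlying polygon of a concatenation: the number of times that it covers each square of
the torus. -/
def Concat.domain {x z : Generator n p} (P : Concat q x z) (c l : ℤ) : ℕ :=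
  P.fst.mult c l + P.snd.mult c l

/-- `r₁ * r₂` is a horizontal annulus: `r₂` has the same height as `r₁`, its left edge is the right
edge of `r₁`, and together they go once around the torus horizontally. -/
def Concat.IsHorizontalAnnulus {x : Generator n p} (P : Concat q x x) : Prop :=
  P.fst.height = P.snd.height ∧ P.fst.width + P.snd.width = n * p ∧
    SamePoint n p q (P.mid.col P.snd.bot) ((P.snd.bot : ℕ) : ℤ)
      (x.col P.fst.bot + P.fst.width) ((P.fst.bot : ℕ) : ℤ)

/-- `r₁ * r₂` is a vertical annulus: `r₂` has the same width as `r₁`, its bottom edge is the top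
edge of `r₁`, and together they go once around the torus along the vertical circles (which have
length `n * p`). -/
def Concat.IsVerticalAnnulus {x : Generator n p} (P : Concat q x x) : Prop :=
  P.fst.width = P.snd.width ∧ P.fst.height + P.snd.height = n * p ∧
    SamePoint n p q (P.mid.col P.snd.bot) ((P.snd.bot : ℕ) : ℤ)
      (x.col P.fst.bot) (((P.fst.bot : ℕ) : ℤ) + P.fst.height)

/-- Functions `Rect(G) → {±1}`. -/
abbrev SignFunction (n p : ℕ) (q : ℤ) : Type :=
  ∀ x y : Generator n p, Rect q x y → ℤˣ

/-- `S(r₁) S(r₂)`. -/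
def SignFunction.onConcat (S : SignFunction n p q) {x z : Generator n p} (P : Concat q x z) : ℤˣ :=
  S x P.mid P.fst * S P.mid z P.snd

/-- Sign assignments on the twisted grid with parameters `(n, p, q)`. -/
structure IsSignAssignment (S : SignFunction n p q) : Prop where
  polygon : ∀ (x z : Generator n p) (P Q : Concat q x z), P ≠ Q → P.domain = Q.domain →
    S.onConcat P = - S.onConcat Q
  horizontal : ∀ (x : Generator n p) (P : Concat q x x), P.IsHorizontalAnnulus → S.onConcat P = 1
  vertical : ∀ (x : Generator n p) (P : Concat q x x), P.IsVerticalAnnulus → S.onConcat P = -1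

/-- The action `S^v (r) = v(x) S(r) v(y)` of a gauge map `v : S(G) → ℤ/2 = {±1}`. -/
def SignFunction.gauge (v : Generator n p → ℤˣ) (S : SignFunction n p q) : SignFunction n p q :=
  fun x y r => v x * S x y r * v y

/-! ## The Spin central extension of the symmetric group -/

/-- The generators `z` and `τ̃_{i,j}`, `i ≠ j`. -/
inductive SpinGen (n : ℕ) : Type
  | z : SpinGen n
  | tau (i j : Fin n) (h : i ≠ j) : SpinGen n

/-- The free group element of the generator `z`. -/
def freeZ (n : ℕ) : FreeGroup (SpinGen n) := FreeGroup.of SpinGen.z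

/-- The free group element of the generator `τ̃_{i,j}`. -/
def freeTau (i j : Fin n) (h : i ≠ j) : FreeGroup (SpinGen n) := FreeGroup.of (SpinGen.tau i j h)

/-- The relators; a relation `a = b` is written as `a * b⁻¹`. -/
inductive SpinRel (n : ℕ) : FreeGroup (SpinGen n) → Prop
  | z_sq : SpinRel n (freeZ n ^ 2)
  | z_comm (i j : Fin n) (h : i ≠ j) :
      SpinRel n ((freeZ n * freeTau i j h) * (freeTau i j h * freeZ n)⁻¹)
  | tau_sq (i j : Fin n) (h : i ≠ j) : SpinRel n (freeTau i j h ^ 2 * (freeZ n)⁻¹)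
  | tau_symm (i j : Fin n) (h : i ≠ j) :
      SpinRel n (freeTau i j h * (freeZ n * freeTau j i h.symm)⁻¹)
  | disjoint (i j k l : Fin n) (hij : i ≠ j) (hkl : k ≠ l) (hik : i ≠ k) (hil : i ≠ l)
      (hjk : j ≠ k) (hjl : j ≠ l) :
      SpinRel n ((freeTau i j hij * freeTau k l hkl) *
        (freeZ n * freeTau k l hkl * freeTau i j hij)⁻¹)
  | braid (i j k : Fin n) (hij : i ≠ j) (hjk : j ≠ k) (hik : i ≠ k) :
      SpinRel n ((freeTau i j hij * freeTau j k hjk * freeTau i j hij) *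
        (freeTau j k hjk * freeTau i j hij * freeTau j k hjk)⁻¹)
  | triangle (i j k : Fin n) (hij : i ≠ j) (hjk : j ≠ k) (hik : i ≠ k) :
      SpinRel n ((freeTau i j hij * freeTau j k hjk * freeTau i j hij) * (freeTau i k hik)⁻¹)

/-- The Spin central extension of `𝔖_n`. -/
abbrev SpinExt (n : ℕ) : Type := PresentedGroup {r | SpinRel n r}

/-- The element `z` of the extension. -/
def spinZ (n : ℕ) : SpinExt n := PresentedGroup.of SpinGen.z

/-- The generalized transposition `τ̃_{i,j}`. -/
def spinTau (i j : Fin n) (h : i ≠ j) : SpinExt n := PresentedGroup.of (SpinGen.tau i j h)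

/-- `z ↦ 1` and `τ̃_{i,j} ↦ (i j)` on generators. -/
def spinGenMap (n : ℕ) : SpinGen n → Equiv.Perm (Fin n)
  | SpinGen.z => 1
  | SpinGen.tau i j _ => Equiv.swap i j

theorem spinGenMap_rel : ∀ r ∈ {r | SpinRel n r}, FreeGroup.lift (spinGenMap n) r = 1 := by
  intro r hr
  have tri : ∀ i j k : Fin n, i ≠ j → j ≠ k → i ≠ k →
      Equiv.swap i j * Equiv.swap j k * Equiv.swap i j = Equiv.swap i k := by
    intro i j k hij hjk hik
    rw [Equiv.swap_comm i j, Equiv.swap_comm j k, Equiv.swap_comm i k]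
    exact Equiv.swap_mul_swap_mul_swap hjk.symm hik.symm |>.trans (Equiv.swap_comm _ _)
  cases hr with
  | z_sq => simp [freeZ, spinGenMap]
  | z_comm i j h => simp [freeZ, freeTau, spinGenMap]
  | tau_sq i j h => simp [freeZ, freeTau, spinGenMap, pow_two]
  | tau_symm i j h => simp [freeZ, freeTau, spinGenMap, Equiv.swap_comm j i]
  | disjoint i j k l hij hkl hik hil hjk hjl =>
    have hd : Equiv.Perm.Disjoint (Equiv.swap i j) (Equiv.swap k l) := by
      intro a
      by_cases h1 : a = i
      · subst h1; right; exact Equiv.swap_apply_of_ne_of_ne hik hil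
      · by_cases h2 : a = j
        · subst h2; right; exact Equiv.swap_apply_of_ne_of_ne hjk hjl
        · left; exact Equiv.swap_apply_of_ne_of_ne h1 h2
    rw [map_mul, map_inv, mul_inv_eq_one]
    simpa [freeZ, freeTau, spinGenMap] using hd.commute.eq
  | braid i j k hij hjk hik =>
    have h1 := tri i j k hij hjk hik
    have h2 := tri k j i hjk.symm hij.symm hik.symm
    rw [Equiv.swap_comm k j, Equiv.swap_comm j i, Equiv.swap_comm k i] at h2
    rw [map_mul, map_inv, mul_inv_eq_one]
    simp only [freeTau, map_mul, FreeGroup.lift_apply_of, spinGenMap]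
    rw [h1, h2]
  | triangle i j k hij hjk hik =>
    rw [map_mul, map_inv, mul_inv_eq_one]
    simp only [freeTau, map_mul, FreeGroup.lift_apply_of, spinGenMap]
    exact tri i j k hij hjk hik

/-- The projection `π` of the extension onto `𝔖_n`. -/
def spinProj (n : ℕ) : SpinExt n →* Equiv.Perm (Fin n) := PresentedGroup.toGroup spinGenMap_rel

/-- `ρ` is a section of the Spin central extension (only a map, not a homomorphism). -/
def IsSection (ρ : Equiv.Perm (Fin n) → SpinExt n) : Prop := ∀ σ, spinProj n (ρ σ) = σ

/-- The group `𝔖̃_n × (ℤ/p)^n`; the second factor carries the addition. -/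
abbrev SpinProd (n p : ℕ) : Type := SpinExt n × Multiplicative (Fin n → ZMod p)

/-- The product of a section with the identity of `(ℤ/p)^n`. -/
def extendSection (ρ : Equiv.Perm (Fin n) → SpinExt n) (x : Generator n p) : SpinProd n p :=
  (ρ x.1, Multiplicative.ofAdd x.2)

/-- `z` in `𝔖̃_n × (ℤ/p)^n`. -/
def prodZ (n p : ℕ) : SpinProd n p := (spinZ n, 1)

/-- `φ(r) = (τ̃_{i,j}, difference of the p-coordinates)`, where the components of `x` and `y` on the
bottom edge of `r` lie on `β_i` and `β_j` respectively. -/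
def Rect.phi {x y : Generator n p} (r : Rect q x y) : SpinProd n p :=
  (spinTau (x.1 r.bot) (y.1 r.bot) r.perm_bot_ne, Multiplicative.ofAdd (y.2 - x.2))

open Classical in
/-- The sign function `S_ρ`: it is `1` if `φ(r)` takes `ρ(x)` to `ρ(y)`, and `-1` if it takes
`ρ(x)` to `z ρ(y)`.  The transposition `(i j)` acts on the labels of the vertical circles, i.e. on
the values of the permutation of `x`; since products in `Equiv.Perm` are compositions of
functions, `φ(r)` therefore multiplies `ρ(x)` from the left. -/
def signOfSection (q : ℤ) (ρ : Equiv.Perm (Fin n) → SpinExt n) : SignFunction n p q :=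
  fun x y r => if r.phi * extendSection ρ x = extendSection ρ y then 1 else -1

/-! ## Grid diagrams and gradings -/

/-- The markings of a twisted grid diagram of parameters `(n, p, q)`.  The `𝕏` and `𝕆` markings lie
in the squares whose lower left corners are the components of `X` and of `O`, so that every
row and every column contains exactly one marking of each kind.  The `𝕆` marking in row `i` is
called `𝕆_i`. -/
structure Markings (n p : ℕ) where
  X : Generator n p
  O : Generator n p
  ne : ∀ l : Fin n, X.col l ≠ O.col l

/-- The lift `C_{p,q}` to the `p n × p n` square of the points of `x` shifted by `(ε, ε)`. -/
def liftPoints (q : ℤ) (ε : ℚ) (x : Generator n p) : Finset (ℚ × ℚ) :=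
  (Finset.univ ×ˢ Finset.range p).image fun lk : Fin n × ℕ =>
    ((((x.col lk.1 + n * q * lk.2) % (n * p : ℤ) : ℤ) : ℚ) + ε,
      ((lk.1 : ℕ) : ℚ) + n * lk.2 + ε)

/-- The number of pairs `(a, b)` in `A × B` with `a₁ < b₁` and `a₂ < b₂`. -/
def pairCount (A B : Finset (ℚ × ℚ)) : ℚ :=
  (((A ×ˢ B).filter fun ab => ab.1.1 < ab.2.1 ∧ ab.1.2 < ab.2.2).card : ℚ)

/-- The correction term `d(p, q, i)` of the lens space, for `0 ≤ q < p` coprime (or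
`(p, q) = (1, 0)`) and `0 ≤ i < p`. -/
def correctionTerm (p q i : ℕ) : ℚ :=
  if h : q = 0 then 0
  else ((p : ℚ) * q - (2 * i + 1 - p - q) ^ 2) / (4 * p * q) + correctionTerm q (p % q) (i % q)
termination_by q
decreasing_by exact Nat.mod_lt _ (Nat.pos_of_ne_zero h)

namespace Markings

variable (G : Markings n p) (q)

/-- The lift of a generator. -/
def liftGen (x : Generator n p) : Finset (ℚ × ℚ) := liftPoints q 0 x

/-- The lift of the `𝕆` markings, which have half-integral coordinates. -/
def liftO : Finset (ℚ × ℚ) := liftPoints q (1 / 2) G.O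

/-- The lift of the `𝕏` markings, which have half-integral coordinates. -/
def liftX : Finset (ℚ × ℚ) := liftPoints q (1 / 2) G.X

/-- The Maslov degree of a generator. -/
def maslov (x : Generator n p) : ℚ :=
  (1 / p) * (pairCount (liftGen q x) (liftGen q x) - pairCount (liftGen q x) (G.liftO q)
      - pairCount (G.liftO q) (liftGen q x) + pairCount (G.liftO q) (G.liftO q))
    + correctionTerm p (q % p).toNat ((q - 1) % p).toNat + 1

/-- The Alexander degree of a generator. -/
def alexander (x : Generator n p) : ℚ :=
  (1 / (2 * p)) * (pairCount (G.liftO q) (G.liftO q) - pairCount (G.liftX q) (G.liftX q)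
      + 2 * pairCount (G.liftX q) (liftGen q x) - 2 * pairCount (G.liftO q) (liftGen q x))
    + (1 - n) / 2

/-- The `Spin^c` degree of a generator. -/
def spinc (x : Generator n p) : ZMod p := (q : ZMod p) - 1 + ∑ i, (x.2 i - G.O.2 i)

/-! ## The complexes -/

/-- The number `O_i(r)` of times that `𝕆_i` appears in a rectangle. -/
def countO {q : ℤ} {x y : Generator n p} (r : Rect q x y) (i : Fin n) : ℕ :=
  r.mult (G.O.col i) ((i : ℕ) : ℤ)

/-- The rectangle contains no `𝕏` marking. -/
def AvoidsX {q : ℤ} {x y : Generator n p} (r : Rect q x y) : Prop :=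
  ∀ i : Fin n, r.mult (G.X.col i) ((i : ℕ) : ℤ) = 0

section Complex

/- Both flavors of the complex are the free module on the finite set of generators, written as the
module of functions on it, over a ring `A` with distinguished elements `V i`; the basis element
`x` is `Pi.single x 1`. -/
variable {A : Type} [CommRing A] (V : Fin n → A) {q} (S : SignFunction n p q) [NeZero p]

open Classical in
/-- The signed differential `∂_S`: a sum over empty rectangles that avoid `𝕏`. -/
def differential : (Generator n p → A) →ₗ[A] (Generator n p → A) :=
  Fintype.linearCombination A fun x : Generator n p =>
    ∑ y : Generator n p, ∑ r : Rect q x y,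
      if r.IsEmpty ∧ G.AvoidsX r then
        Pi.single y ((((S x y r : ℤˣ) : ℤ) : A) * ∏ i, V i ^ G.countO r i)
      else 0

variable (q)

/-- The piece of the complex in (Maslov, Alexander, `Spin^c`) degree `(m, a, s)`: multiplication
by any `V i` lowers `M` by `2`, lowers `A` by `1` and preserves the `Spin^c` degree. -/
def gradedPiece (m a : ℚ) (s : ZMod p) : AddSubgroup (Generator n p → A) :=
  AddSubgroup.closure {c | ∃ (x : Generator n p) (k : Fin n → ℕ),
    c = Pi.single x (∏ i, V i ^ k i) ∧
    G.maslov q x - 2 * ∑ i, (k i : ℚ) = m ∧ G.alexander q x - ∑ i, (k i : ℚ) = a ∧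
    G.spinc q x = s}

variable {q}

/-- The cycles of `∂_S`. -/
def cycles : Submodule A (Generator n p → A) := LinearMap.ker (G.differential V S)

/-- The boundaries of `∂_S` that are cycles (all of them, as `∂_S` squares to zero). -/
def boundaries : Submodule A (G.cycles V S) :=
  (LinearMap.range (G.differential V S)).submoduleOf (G.cycles V S)

/-- The grid homology `ker ∂_S / im ∂_S`. -/
abbrev Homology : Type := G.cycles V S ⧸ G.boundaries V S

/-- The classes of the cycles of degree `(m, a, s)`. -/
def homologyPiece (m a : ℚ) (s : ZMod p) : AddSubgroup (G.Homology V S) :=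
  ((G.gradedPiece q V m a s).comap (G.cycles V S).subtype.toAddMonoidHom).map
    (G.boundaries V S).mkQ.toAddMonoidHom

/-- The linear map `x ↦ v(x) x` defined by a gauge map. -/
def gaugeMap (A : Type) [CommRing A] (v : Generator n p → ℤˣ) :
    (Generator n p → A) →ₗ[A] (Generator n p → A) :=
  Fintype.linearCombination A fun x : Generator n p =>
    Pi.single x (((v x : ℤˣ) : ℤ) : A)

/-- The linear map `f` is an isomorphism of trigraded complexes from `∂_S` to `∂_{S'}`. -/
def IsTrigradedIso (S' : SignFunction n p q)
    (f : (Generator n p → A) →ₗ[A] (Generator n p → A)) : Prop :=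
  Function.Bijective f ∧ f ∘ₗ G.differential V S = G.differential V S' ∘ₗ f ∧
    ∀ (m a : ℚ) (s : ZMod p),
      (G.gradedPiece q V m a s).map f.toAddMonoidHom = G.gradedPiece q V m a s

/-- The homologies of `∂_S` and `∂_{S'}` are isomorphic as trigraded modules. -/
def HomologyIso (S' : SignFunction n p q) : Prop :=
  ∃ f : G.Homology V S ≃ₗ[A] G.Homology V S', ∀ (m a : ℚ) (s : ZMod p),
    (G.homologyPiece V S m a s).map f.toLinearMap.toAddMonoidHom = G.homologyPiece V S' m a s

end Complex

end Markings

/-- `R = ℤ[V_1, …, V_n]`, the ground ring of the minus complex. -/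
abbrev MinusRing (n : ℕ) : Type := MvPolynomial (Fin n) ℤ

/-- The variables of `R`. -/
def minusV (n : ℕ) : Fin n → MinusRing n := fun i => MvPolynomial.X i

/-- `R / (V_e)`, the ground ring of the hat complex; `𝕆_e` is the marking that is called first. -/
abbrev HatRing (e : Fin n) : Type :=
  MvPolynomial (Fin n) ℤ ⧸ Ideal.span {(MvPolynomial.X e : MvPolynomial (Fin n) ℤ)}

/-- The images of the variables in `R / (V_e)`. -/
def hatV (e : Fin n) : Fin n → HatRing e := fun i => Ideal.Quotient.mk _ (MvPolynomial.X i)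

end

end TwistedGrid

/-!
The torus is the plane modulo a lattice, and a generator is a set of points of the plane that is
invariant under this lattice (`GridLattice.IsGen`).  A rectangle is a box in the plane whose corners
lie alternately in two such sets (`GridLattice.IsBox`), and two polygons are equal if all periodic
functions have the same sum over them.  In this form the combinatorics of rectangles is symmetric
under reflections in the diagonal and in the vertical axis.

**Existence.**  The relations of the Spin extension imply that the kernel of its projection is
`{1, z}` (`spinProj_ker`), and `τ̃_{i,j} ↦ e_i - e_j` is a representation in a Clifford algebra, so
that `z ≠ 1`.  Hence `S_ρ` is well defined, and the product of the two generalized transpositions of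
`r₁ * r₂` is `S_ρ(r₁) S_ρ(r₂)`, seen in `{1, z}`, times a factor depending on the ends only
(`tau_mul_tau`).  In the Clifford algebra such a product determines the scalar product of the two
roots.  If it does not vanish, it determines the decomposition of a polygon, given the row and column
totals of the polygon (`Concat.eq_of_rootDot_eq`); if it vanishes, the only other decomposition is
the one in the opposite order, and the two generalized transpositions anticommute.  So different
decompositions have opposite signs, and the annuli reduce to `τ̃_{i,j} τ̃_{j,i} = 1` and
`τ̃_{i,j}² = z`.

**The differential.**  A polygon of two empty rectangles with different ends has a second
decomposition into empty rectangles (`GridLattice.hasAlternative`): rectangles with four different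
horizontal circles are exchanged, an L-shape is cut along the other ray from its reflex corner, and
there is one more shape, an annulus with a reflex corner on each boundary component, in which the
other two cuts wind around the annulus (`GridLattice.exists_spiral`).  No polygon has three
decompositions, as their signs would be pairwise opposite.  If the ends agree, the polygon covers a
row or a column and contains an `𝕏`.  So the terms of `∂²` cancel in pairs.

**Uniqueness.**  The product `c` of two sign assignments is flat (`IsFlat`).  Transport along the
rectangles of height less than `n`, with the signs `c`, defines for any two horizontal circles a
permutation of `S(G) × {±1}`.  These permutations satisfy the relations of the affine transpositions
(`AffineFamily`, `affineFamily_lowPerm`): every element of the group that they generate is a product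
of a permutation of the circles and of powers of commuting translations.  The `p`-th powers of the
translations are trivial, because of the vertical annuli (`lowPerm_mul_pow`).  As the translations
change the `p`-coordinates by multiples of `q`, which is invertible modulo `p`, a transport that
returns to its starting generator is the identity (`eq_one_of_apply_fst_eq`).  So there is no
holonomy; since the transport around a tall rectangle is a word in low ones (`lowPerm_word_box`),
`c(r) = v(x) v(y)` for all rectangles.  The map `x ↦ v(x) x` is then an involution that intertwines
the differentials and preserves the degrees.
-/

namespace TwistedGrid

noncomputable section

/-! ### Groups generated by transpositions -/

section Transpositions

variable {ι M : Type*} [Group M]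

/-- The relations satisfied by the transpositions `(i j)` of a set; the convention `t i i = 1` is
used. -/
structure TranspositionFamily (t : ι → ι → M) : Prop where
  refl : ∀ i, t i i = 1
  symm : ∀ i j, t i j = t j i
  mul_self : ∀ i j, t i j * t i j = 1
  comm : ∀ i j k l, i ≠ k → i ≠ l → j ≠ k → j ≠ l → t i j * t k l = t k l * t i j
  triangle : ∀ i j k, i ≠ j → j ≠ k → i ≠ k → t i j * t j k * t i j = t i k

variable {t : ι → ι → M}

theorem TranspositionFamily.mul_eq (ht : TranspositionFamily t) {i j k : ι} (hij : i ≠ j)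
    (hjk : j ≠ k) (hik : i ≠ k) : t i j * t j k = t i k * t i j := by
  rw [← ht.triangle i j k hij hjk hik, mul_assoc _ (t i j) (t i j), ht.mul_self, mul_one]

/-- The subgroup generated by the transpositions supported in `s`. -/
def transpositionClosure (t : ι → ι → M) (s : Finset ι) : Subgroup M :=
  Subgroup.closure {g | ∃ i ∈ s, ∃ j ∈ s, g = t i j}

/-- Coset decomposition along the orbit of a new point `a`: this is where the relations are used. -/
theorem TranspositionFamily.exists_eq_mul [DecidableEq ι] (ht : TranspositionFamily t) {a : ι} {s : Finset ι}
    (ha : a ∉ s) {g : M} (hg : g ∈ transpositionClosure t (insert a s)) :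
    ∃ b ∈ insert a s, ∃ k ∈ transpositionClosure t s, g = t a b * k := by
  have gen : ∀ i j, i ∈ insert a s → j ∈ insert a s → ∀ y : M,
      (∃ b ∈ insert a s, ∃ k ∈ transpositionClosure t s, y = t a b * k) →
      ∃ b ∈ insert a s, ∃ k ∈ transpositionClosure t s, t i j * y = t a b * k := by
    have mem : ∀ i ∈ s, ∀ j ∈ s, t i j ∈ transpositionClosure t s := fun i hi j hj =>
      Subgroup.subset_closure ⟨i, hi, j, hj, rfl⟩
    have withA : ∀ j ∈ s, ∀ y : M,
      (∃ b ∈ insert a s, ∃ k ∈ transpositionClosure t s, y = t a b * k) →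
      ∃ b ∈ insert a s, ∃ k ∈ transpositionClosure t s, t a j * y = t a b * k := by
      rintro j hj y ⟨b, hb, k, hk, rfl⟩
      rcases Finset.mem_insert.1 hb with rfl | hb
      · exact ⟨j, Finset.mem_insert_of_mem hj, k, hk, by rw [ht.refl, one_mul]⟩
      · have haj : a ≠ j := fun h => ha (h ▸ hj)
        have hab : a ≠ b := fun h => ha (h ▸ hb)
        by_cases hbj : b = j
        · subst hbj
          exact ⟨a, Finset.mem_insert_self _ _, k, hk, by
            rw [← mul_assoc, ht.mul_self, ht.refl]⟩
        · refine ⟨b, Finset.mem_insert_of_mem hb, t b j * k, mul_mem (mem b hb j hj) hk, ?_⟩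
          rw [← mul_assoc, ← mul_assoc, ht.mul_eq hab hbj haj]
    intro i j hi hj y hy
    rcases Finset.mem_insert.1 hi with rfl | hi
    · rcases Finset.mem_insert.1 hj with rfl | hj
      · simpa [ht.refl] using hy
      · exact withA j hj y hy
    · rcases Finset.mem_insert.1 hj with hja | hj
      · rw [hja, ht.symm]; exact withA i hi y hy
      · obtain ⟨b, hb, k, hk, rfl⟩ := hy
        have hai : a ≠ i := fun h => ha (h ▸ hi)
        have haj : a ≠ j := fun h => ha (h ▸ hj)
        have hk' := mul_mem (mem i hi j hj) hk
        by_cases hij : i = j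
        · subst hij
          exact ⟨b, hb, k, hk, by rw [ht.refl, one_mul]⟩
        rcases Finset.mem_insert.1 hb with rfl | hb
        · exact ⟨b, Finset.mem_insert_self _ _, _, hk', by rw [ht.refl, one_mul, one_mul]⟩
        by_cases hbi : b = i
        · subst hbi
          refine ⟨j, Finset.mem_insert_of_mem hj, _, hk', ?_⟩
          rw [← mul_assoc, ← mul_assoc, ht.symm b j, ht.symm a b, ht.symm a j,
            ht.mul_eq (Ne.symm hij) hai.symm haj.symm]
        by_cases hbj : b = j
        · subst hbj
          refine ⟨i, Finset.mem_insert_of_mem hi, _, hk', ?_⟩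
          rw [← mul_assoc, ← mul_assoc, ht.symm a b, ht.symm a i,
            ht.mul_eq hij haj.symm hai.symm]
        · refine ⟨b, Finset.mem_insert_of_mem hb, _, hk', ?_⟩
          rw [← mul_assoc, ← mul_assoc,
            ht.comm i j a b hai.symm (Ne.symm hbi) haj.symm (Ne.symm hbj)]
  -- the set of these products contains `1` and is stable under multiplication by the generators
  have inv : ∀ i j, (t i j)⁻¹ = t i j := fun i j => inv_eq_of_mul_eq_one_left (ht.mul_self i j)
  refine Subgroup.closure_induction_left (p := fun g _ => ∃ b ∈ insert a s,
    ∃ k ∈ transpositionClosure t s, g = t a b * k) ?_ ?_ ?_ hg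
  · exact ⟨a, Finset.mem_insert_self _ _, 1, one_mem _, by rw [ht.refl, one_mul]⟩
  · rintro _ ⟨i, hi, j, hj, rfl⟩ y _ hy
    exact gen i j hi hj y hy
  · rintro _ ⟨i, hi, j, hj, rfl⟩ y _ hy
    rw [inv]
    exact gen i j hi hj y hy

/-- The relations of a `TranspositionFamily` present the symmetric group: by induction on `s`, an
element that acts trivially has trivial coset representatives. -/
theorem TranspositionFamily.eq_one [DecidableEq ι] (ht : TranspositionFamily t) (f : M →* Equiv.Perm ι)
    (hf : ∀ i j, f (t i j) = Equiv.swap i j) (s : Finset ι) {g : M}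
    (hg : g ∈ transpositionClosure t s) (h : f g = 1) : g = 1 := by
  induction s using Finset.induction_on generalizing g with
  | empty => simpa [transpositionClosure] using hg
  | insert a s ha ih =>
    obtain ⟨b, hb, k, hk, rfl⟩ := ht.exists_eq_mul ha hg
    have fix : f k a = a := by
      have : ∀ k ∈ transpositionClosure t s, f k a = a := by
        intro k hk
        have hle : transpositionClosure t s ≤
            (MulAction.stabilizer (Equiv.Perm ι) a).comap f := by
          refine (Subgroup.closure_le _).2 ?_
          rintro _ ⟨i, hi, j, hj, rfl⟩
          have hai : a ≠ i := fun h => ha (h ▸ hi)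
          have haj : a ≠ j := fun h => ha (h ▸ hj)
          simp [hf, Equiv.swap_apply_of_ne_of_ne hai haj]
        simpa using hle hk
      exact this k hk
    have hba : b = a := by
      have := congrArg (fun σ : Equiv.Perm ι => σ a) h
      simpa [hf, fix] using this
    subst hba
    rw [ht.refl, one_mul] at h ⊢
    exact ih hk h

end Transpositions

/-! ### The Spin central extension -/

section Spin

variable {n : ℕ}

theorem spinRel_eq {a b : FreeGroup (SpinGen n)} (h : SpinRel n (a * b⁻¹)) :
    (PresentedGroup.mk {r | SpinRel n r} a : SpinExt n) = PresentedGroup.mk _ b := by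
  have := PresentedGroup.one_of_mem (rels := {r | SpinRel n r}) h
  rwa [map_mul, map_inv, mul_inv_eq_one] at this

theorem spinZ_mul_self : spinZ n * spinZ n = 1 := by
  have := PresentedGroup.one_of_mem (rels := {r | SpinRel n r}) (SpinRel.z_sq (n := n))
  rwa [map_pow, pow_two] at this

theorem spinZ_mul_tau (i j : Fin n) (h : i ≠ j) :
    spinZ n * spinTau i j h = spinTau i j h * spinZ n :=
  spinRel_eq (SpinRel.z_comm i j h)

theorem spinTau_mul_self (i j : Fin n) (h : i ≠ j) : spinTau i j h * spinTau i j h = spinZ n := by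
  have := spinRel_eq (SpinRel.tau_sq i j h)
  rwa [map_pow, pow_two] at this

theorem spinTau_symm (i j : Fin n) (h : i ≠ j) :
    spinTau i j h = spinZ n * spinTau j i h.symm := spinRel_eq (SpinRel.tau_symm i j h)

theorem spinTau_disjoint (i j k l : Fin n) (hij : i ≠ j) (hkl : k ≠ l) (hik : i ≠ k) (hil : i ≠ l)
    (hjk : j ≠ k) (hjl : j ≠ l) :
    spinTau i j hij * spinTau k l hkl = spinZ n * spinTau k l hkl * spinTau i j hij :=
  spinRel_eq (SpinRel.disjoint i j k l hij hkl hik hil hjk hjl)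

theorem spinTau_triangle (i j k : Fin n) (hij : i ≠ j) (hjk : j ≠ k) (hik : i ≠ k) :
    spinTau i j hij * spinTau j k hjk * spinTau i j hij = spinTau i k hik :=
  spinRel_eq (SpinRel.triangle i j k hij hjk hik)

theorem spinProj_z : spinProj n (spinZ n) = 1 := PresentedGroup.toGroup.of _

theorem spinProj_tau (i j : Fin n) (h : i ≠ j) :
    spinProj n (spinTau i j h) = Equiv.swap i j := PresentedGroup.toGroup.of _

theorem spinExt_closure :
    Subgroup.closure ({spinZ n} ∪ {g | ∃ i j h, g = spinTau i j h}) = ⊤ := by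
  rw [eq_top_iff, ← PresentedGroup.closure_range_of {r | SpinRel n r}]
  refine Subgroup.closure_mono ?_
  rintro _ ⟨x, rfl⟩
  cases x with
  | z => exact Or.inl rfl
  | tau i j h => exact Or.inr ⟨i, j, h, rfl⟩

theorem spinZ_comm (g : SpinExt n) : spinZ n * g = g * spinZ n := by
  have hg : g ∈ Subgroup.closure ({spinZ n} ∪ {g | ∃ i j h, g = spinTau i j h}) := by
    rw [spinExt_closure]; trivial
  have hle : Subgroup.closure ({spinZ n} ∪ {g | ∃ i j h, g = spinTau i j h}) ≤
      Subgroup.centralizer {spinZ n} := by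
    refine (Subgroup.closure_le _).2 ?_
    rintro _ (rfl | ⟨i, j, h, rfl⟩)
    · simp [Subgroup.mem_centralizer_iff]
    · simpa [Subgroup.mem_centralizer_iff] using spinZ_mul_tau i j h
  simpa [Subgroup.mem_centralizer_iff] using hle hg

theorem spinZ_zpowers_normal : (Subgroup.zpowers (spinZ n)).Normal := by
  refine ⟨fun a ha g => ?_⟩
  obtain ⟨k, rfl⟩ := Subgroup.mem_zpowers_iff.1 ha
  have : Commute g (spinZ n ^ k) := Commute.zpow_right (spinZ_comm g).symm k
  rw [this.eq, mul_assoc, mul_inv_cancel, mul_one]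
  exact ha

theorem mem_zpowers_spinZ {g : SpinExt n} (h : g ∈ Subgroup.zpowers (spinZ n)) :
    g = 1 ∨ g = spinZ n := by
  obtain ⟨k, rfl⟩ := Subgroup.mem_zpowers_iff.1 h
  have h2 : spinZ n ^ (2 : ℤ) = 1 := by rw [zpow_two, spinZ_mul_self]
  rcases Int.even_or_odd' k with ⟨m, rfl | rfl⟩
  · left; rw [zpow_mul, h2, one_zpow]
  · right; rw [zpow_add, zpow_mul, h2, one_zpow, one_mul, zpow_one]

/-- The kernel of the projection of the Spin extension consists of `1` and `z`. -/
theorem spinProj_ker {g : SpinExt n} (hg : spinProj n g = 1) : g = 1 ∨ g = spinZ n := by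
  have := spinZ_zpowers_normal (n := n)
  let Z := Subgroup.zpowers (spinZ n)
  let t : Fin n → Fin n → SpinExt n ⧸ Z := fun i j =>
    if h : i ≠ j then QuotientGroup.mk (spinTau i j h) else 1
  have hz : (QuotientGroup.mk (spinZ n) : SpinExt n ⧸ Z) = 1 :=
    (QuotientGroup.eq_one_iff _).2 (Subgroup.mem_zpowers _)
  have tne : ∀ i j (h : i ≠ j), t i j = QuotientGroup.mk (spinTau i j h) := fun i j h => dif_pos h
  have trefl : ∀ i, t i i = 1 := fun i => dif_neg (by simp)
  have ht : TranspositionFamily t := by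
    refine ⟨trefl, ?_, ?_, ?_, ?_⟩
    · intro i j
      by_cases h : i = j
      · rw [h]
      · rw [tne i j h, tne j i (Ne.symm h), spinTau_symm i j h, QuotientGroup.mk_mul, hz, one_mul]
    · intro i j
      by_cases h : i = j
      · rw [h, trefl, one_mul]
      · rw [tne i j h, ← QuotientGroup.mk_mul, spinTau_mul_self, hz]
    · intro i j k l hik hil hjk hjl
      by_cases h : i = j
      · rw [h, trefl, one_mul, mul_one]
      by_cases h' : k = l
      · rw [h', trefl, one_mul, mul_one]
      rw [tne i j h, tne k l h', ← QuotientGroup.mk_mul,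
        spinTau_disjoint i j k l h h' hik hil hjk hjl, QuotientGroup.mk_mul, QuotientGroup.mk_mul,
        hz, one_mul]
    · intro i j k hij hjk hik
      rw [tne i j hij, tne j k hjk, tne i k hik, ← QuotientGroup.mk_mul, ← QuotientGroup.mk_mul,
        spinTau_triangle]
  let f : SpinExt n ⧸ Z →* Equiv.Perm (Fin n) := QuotientGroup.lift Z (spinProj n) (by
    intro x hx
    rcases mem_zpowers_spinZ hx with rfl | rfl
    · exact map_one _
    · exact spinProj_z)
  have hf : ∀ i j, f (t i j) = Equiv.swap i j := by
    intro i j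
    by_cases h : i = j
    · rw [h, trefl, map_one, Equiv.swap_self]; rfl
    · rw [tne i j h]; exact spinProj_tau i j h
  have hmem : (QuotientGroup.mk g : SpinExt n ⧸ Z) ∈ transpositionClosure t Finset.univ := by
    have hg : g ∈ Subgroup.closure ({spinZ n} ∪ {g | ∃ i j h, g = spinTau i j h}) := by
      rw [spinExt_closure]; trivial
    have hle : Subgroup.closure ({spinZ n} ∪ {g | ∃ i j h, g = spinTau i j h}) ≤
        (transpositionClosure t Finset.univ).comap (QuotientGroup.mk' Z) := by
      refine (Subgroup.closure_le _).2 ?_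
      rintro _ (rfl | ⟨i, j, h, rfl⟩)
      · change (QuotientGroup.mk (spinZ n) : SpinExt n ⧸ Z) ∈ transpositionClosure t Finset.univ
        rw [hz]; exact one_mem _
      · exact Subgroup.subset_closure ⟨i, Finset.mem_univ _, j, Finset.mem_univ _,
          (tne i j h).symm⟩
    exact hle hg
  exact mem_zpowers_spinZ ((QuotientGroup.eq_one_iff _).1 (ht.eq_one f hf _ hmem hg))

theorem spinProj_surjective : Function.Surjective (spinProj n) := by
  rw [← MonoidHom.range_eq_top, eq_top_iff, ← Equiv.Perm.closure_isSwap, Subgroup.closure_le]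
  rintro _ ⟨i, j, h, rfl⟩
  exact ⟨spinTau i j h, spinProj_tau i j h⟩

/-- The quadratic form whose Clifford algebra contains the Spin extension; it takes the value `-1`
on the roots `e_i - e_j`. -/
def rootForm (n : ℕ) : QuadraticForm ℝ (Fin n → ℝ) :=
  QuadraticMap.weightedSumSquares ℝ (fun _ => (-1 / 2 : ℝ))

/-- The root `e_i - e_j`. -/
def rootVec (i j : Fin n) : Fin n → ℝ := Pi.single i 1 - Pi.single j 1

/-- Kronecker delta. -/
def delta {ι : Type*} [DecidableEq ι] (i j : ι) : ℤ := if i = j then 1 else 0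

/-- The inner product of the roots `e_i - e_j` and `e_k - e_l`. -/
def rootDot {ι : Type*} [DecidableEq ι] (i j k l : ι) : ℤ :=
  delta i k + delta j l - delta i l - delta j k

theorem rootForm_polar (i j k l : Fin n) :
    QuadraticMap.polar (rootForm n) (rootVec i j) (rootVec k l) = -(rootDot i j k l : ℝ) := by
  have h : ∀ u v : Fin n → ℝ, QuadraticMap.polar (rootForm n) u v = -∑ a, u a * v a := by
    intro u v
    simp only [QuadraticMap.polar, rootForm, QuadraticMap.weightedSumSquares_apply, Pi.add_apply,
      smul_eq_mul]
    rw [← Finset.sum_sub_distrib, ← Finset.sum_sub_distrib, ← Finset.sum_neg_distrib]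
    exact Finset.sum_congr rfl fun a _ => by ring
  rw [h]
  simp only [rootVec, Pi.sub_apply, sub_mul, mul_sub, Finset.sum_sub_distrib, Pi.single_apply,
    ite_mul, one_mul, zero_mul, Finset.sum_ite_eq', Finset.mem_univ, if_true, rootDot, delta]
  push_cast
  ring

theorem rootForm_rootVec {i j : Fin n} (h : i ≠ j) : rootForm n (rootVec i j) = -1 := by
  have := rootForm_polar i j i j
  rw [QuadraticMap.polar_self] at this
  simp [rootDot, delta, h, h.symm] at this
  linarith

/-- Images of the generators of the Spin extension in the unit group of the Clifford algebra. -/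
def cliffordGen (n : ℕ) : SpinGen n → (CliffordAlgebra (rootForm n))ˣ
  | SpinGen.z => -1
  | SpinGen.tau i j h =>
    { val := CliffordAlgebra.ι _ (rootVec i j)
      inv := -CliffordAlgebra.ι _ (rootVec i j)
      val_inv := by rw [mul_neg, CliffordAlgebra.ι_sq_scalar, rootForm_rootVec h]; simp
      inv_val := by rw [neg_mul, CliffordAlgebra.ι_sq_scalar, rootForm_rootVec h]; simp }

theorem clifford_mul_add_swap (i j k l : Fin n) :
    CliffordAlgebra.ι (rootForm n) (rootVec i j) * CliffordAlgebra.ι _ (rootVec k l) +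
      CliffordAlgebra.ι _ (rootVec k l) * CliffordAlgebra.ι _ (rootVec i j) =
      algebraMap ℝ _ (-(rootDot i j k l : ℝ)) := by
  rw [CliffordAlgebra.ι_mul_ι_add_swap, rootForm_polar]

theorem clifford_sq {i j : Fin n} (h : i ≠ j) :
    CliffordAlgebra.ι (rootForm n) (rootVec i j) * CliffordAlgebra.ι _ (rootVec i j) = -1 := by
  rw [CliffordAlgebra.ι_sq_scalar, rootForm_rootVec h]; simp

theorem clifford_triangle {i j k : Fin n} (hij : i ≠ j) (hjk : j ≠ k) (hik : i ≠ k) :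
    CliffordAlgebra.ι (rootForm n) (rootVec i j) * CliffordAlgebra.ι _ (rootVec j k) *
      CliffordAlgebra.ι _ (rootVec i j) = CliffordAlgebra.ι _ (rootVec i k) := by
  have h1 := clifford_mul_add_swap i j j k
  have h2 : (rootDot i j j k) = -1 := by simp [rootDot, delta, hij, hjk, hik]
  rw [h2] at h1
  have h3 := eq_sub_of_add_eq h1
  rw [h3, sub_mul, mul_assoc, clifford_sq hij]
  have : rootVec i k = rootVec i j + rootVec j k := by simp [rootVec]
  rw [this, map_add]
  simp

theorem cliffordGen_rel : ∀ r ∈ {r | SpinRel n r}, FreeGroup.lift (cliffordGen n) r = 1 := by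
  intro r hr
  cases hr with
  | z_sq => simp [freeZ, cliffordGen]
  | z_comm i j h =>
    rw [map_mul, map_inv, mul_inv_eq_one]
    simp [freeZ, freeTau, cliffordGen]
  | tau_sq i j h =>
    rw [map_mul, map_inv, mul_inv_eq_one, pow_two]
    ext
    simp [freeZ, freeTau, cliffordGen, clifford_sq h]
  | tau_symm i j h =>
    rw [map_mul, map_inv, mul_inv_eq_one]
    ext
    have : rootVec i j = - rootVec j i := by simp [rootVec]
    simp [freeZ, freeTau, cliffordGen, this]
  | disjoint i j k l hij hkl hik hil hjk hjl =>
    rw [map_mul, map_inv, mul_inv_eq_one]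
    ext
    have h1 := clifford_mul_add_swap i j k l
    have h2 : (rootDot i j k l) = 0 := by simp [rootDot, delta, hik, hjk, hil, hjl]
    rw [h2] at h1
    simp only [Int.cast_zero, neg_zero, map_zero] at h1
    simp [freeZ, freeTau, cliffordGen, eq_neg_of_add_eq_zero_left h1]
  | braid i j k hij hjk hik =>
    rw [map_mul, map_inv, mul_inv_eq_one]
    ext
    have h1 := clifford_triangle hij hjk hik
    have h2 := clifford_triangle hjk.symm hij.symm hik.symm
    have e1 : rootVec k j = - rootVec j k := by simp [rootVec]
    have e2 : rootVec j i = - rootVec i j := by simp [rootVec]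
    have e3 : rootVec k i = - rootVec i k := by simp [rootVec]
    rw [e1, e2, e3] at h2
    simp only [map_neg, neg_mul, mul_neg, neg_neg, neg_inj] at h2
    simp [freeTau, cliffordGen, h1, h2]
  | triangle i j k hij hjk hik =>
    rw [map_mul, map_inv, mul_inv_eq_one]
    ext
    simp [freeTau, cliffordGen, clifford_triangle hij hjk hik]

/-- The representation of the Spin extension in the Clifford algebra. -/
def spinClifford (n : ℕ) : SpinExt n →* (CliffordAlgebra (rootForm n))ˣ :=
  PresentedGroup.toGroup cliffordGen_rel

theorem spinClifford_z : spinClifford n (spinZ n) = -1 := PresentedGroup.toGroup.of _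

theorem spinClifford_tau (i j : Fin n) (h : i ≠ j) :
    (spinClifford n (spinTau i j h) : CliffordAlgebra (rootForm n)) =
      CliffordAlgebra.ι _ (rootVec i j) :=
  congrArg Units.val
    (PresentedGroup.toGroup.of (x := SpinGen.tau i j h) cliffordGen_rel)

theorem clifford_algebraMap_injective :
    Function.Injective (algebraMap ℝ (CliffordAlgebra (rootForm n))) :=
  FaithfulSMul.algebraMap_injective _ _

theorem spinZ_ne_one : spinZ n ≠ 1 := by
  intro h
  have h1 := congrArg (fun g => (spinClifford n g : CliffordAlgebra (rootForm n))) h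
  simp only [spinClifford_z, map_one, Units.val_neg, Units.val_one] at h1
  have h2 : algebraMap ℝ (CliffordAlgebra (rootForm n)) (-1) = algebraMap ℝ _ 1 := by
    simpa using h1
  have := clifford_algebraMap_injective h2
  norm_num at this

/-- The central subgroup `{1, z}` of the Spin extension, indexed by signs. -/
def spinSign (ε : ℤˣ) : SpinExt n := if ε = 1 then 1 else spinZ n

theorem spinSign_one : spinSign (1 : ℤˣ) = (1 : SpinExt n) := if_pos rfl

theorem spinSign_neg_one : spinSign (-1 : ℤˣ) = spinZ n := if_neg (by decide)

theorem spinSign_mul (ε δ : ℤˣ) : (spinSign (ε * δ) : SpinExt n) = spinSign ε * spinSign δ := by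
  rcases Int.units_eq_one_or ε with rfl | rfl <;> rcases Int.units_eq_one_or δ with rfl | rfl <;>
    simp [spinSign_one, spinSign_neg_one, spinZ_mul_self]

theorem spinSign_comm (ε : ℤˣ) (g : SpinExt n) : spinSign ε * g = g * spinSign ε := by
  rcases Int.units_eq_one_or ε with rfl | rfl
  · simp [spinSign_one]
  · rw [spinSign_neg_one, spinZ_comm]

theorem spinSign_injective : Function.Injective (spinSign : ℤˣ → SpinExt n) := by
  intro ε δ h
  rcases Int.units_eq_one_or ε with rfl | rfl <;> rcases Int.units_eq_one_or δ with rfl | rfl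
  · rfl
  · rw [spinSign_one, spinSign_neg_one] at h; exact absurd h.symm spinZ_ne_one
  · rw [spinSign_one, spinSign_neg_one] at h; exact absurd h spinZ_ne_one
  · rfl

theorem exists_eq_spinSign_mul {g h : SpinExt n} (e : spinProj n g = spinProj n h) :
    ∃ ε : ℤˣ, g = spinSign ε * h := by
  have : spinProj n (g * h⁻¹) = 1 := by rw [map_mul, map_inv, e, mul_inv_cancel]
  rcases spinProj_ker this with h1 | h1
  · exact ⟨1, by rw [spinSign_one, one_mul]; exact mul_inv_eq_one.1 h1⟩
  · exact ⟨-1, by rw [spinSign_neg_one]; exact mul_inv_eq_iff_eq_mul.1 h1⟩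

theorem spinClifford_sign (ε : ℤˣ) :
    (spinClifford n (spinSign ε) : CliffordAlgebra (rootForm n)) =
      algebraMap ℝ _ ((ε : ℤ) : ℝ) := by
  rcases Int.units_eq_one_or ε with rfl | rfl
  · simp [spinSign_one]
  · simp [spinSign_neg_one, spinClifford_z]

/-- A sign between two products of generalized transpositions is a sign between the inner products
of the corresponding roots: anticommutators in the Clifford algebra are scalars. -/
theorem rootDot_eq_of_spinTau_mul_eq {i j k l i' j' k' l' : Fin n} (hij : i ≠ j) (hkl : k ≠ l)
    (hij' : i' ≠ j') (hkl' : k' ≠ l') {ε : ℤˣ}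
    (h : spinTau i j hij * spinTau k l hkl =
      spinSign ε * (spinTau i' j' hij' * spinTau k' l' hkl')) :
    rootDot i j k l = ε * rootDot i' j' k' l' := by
  have hinv : ∀ (a b : Fin n) (hab : a ≠ b), (spinTau a b hab)⁻¹ = spinZ n * spinTau a b hab := by
    intro a b hab
    refine inv_eq_of_mul_eq_one_left ?_
    rw [mul_assoc, spinTau_mul_self, spinZ_mul_self]
  have h' : spinTau k l hkl * spinTau i j hij =
      spinSign ε * (spinTau k' l' hkl' * spinTau i' j' hij') := by
    have e : (spinSign ε : SpinExt n)⁻¹ = spinSign ε := by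
      refine inv_eq_of_mul_eq_one_left ?_
      rw [← spinSign_mul, Int.units_mul_self, spinSign_one]
    have := congrArg (fun g => g⁻¹) h
    simp only [mul_inv_rev, hinv, e] at this
    have step : ∀ a b : SpinExt n, spinZ n * a * (spinZ n * b) = a * b := by
      intro a b
      rw [spinZ_comm a, mul_assoc, ← mul_assoc (spinZ n), spinZ_mul_self, one_mul]
    rw [step, step, ← spinSign_comm] at this
    exact this
  have c1 := congrArg (fun g => (spinClifford n g : CliffordAlgebra (rootForm n))) h
  have c2 := congrArg (fun g => (spinClifford n g : CliffordAlgebra (rootForm n))) h'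
  simp only [map_mul, Units.val_mul, spinClifford_tau, spinClifford_sign] at c1 c2
  have c3 := clifford_mul_add_swap i j k l
  rw [c1, c2, ← mul_add, clifford_mul_add_swap, ← map_mul] at c3
  have := clifford_algebraMap_injective c3
  have h4 : ((rootDot i j k l : ℤ) : ℝ) = ((ε * rootDot i' j' k' l' : ℤ) : ℝ) := by
    push_cast
    linarith
  exact_mod_cast h4

end Spin

/-! ### Rectangles of the plane modulo a lattice -/

/-- The properties of the lattice of periods of a twisted torus that the combinatorics of
rectangles uses.  They are invariant under the symmetries of the square grid. -/
structure GridLattice where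
  /-- The number of horizontal circles, and of vertical circles. -/
  n : ℕ
  /-- The length of each of these circles. -/
  N : ℕ
  /-- The pair `(u, v)` is a period. -/
  mem : ℤ → ℤ → Prop
  n_pos : 0 < n
  N_pos : 0 < N
  zero_mem : mem 0 0
  sub_mem : ∀ {u v u' v' : ℤ}, mem u v → mem u' v' → mem (u - u') (v - v')
  dvd_fst : ∀ {u v : ℤ}, mem u v → (n : ℤ) ∣ u
  dvd_snd : ∀ {u v : ℤ}, mem u v → (n : ℤ) ∣ v
  row : ∀ {u : ℤ}, mem u 0 ↔ (N : ℤ) ∣ u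
  col : ∀ {v : ℤ}, mem 0 v ↔ (N : ℤ) ∣ v

namespace GridLattice

variable (Λ : GridLattice)

/-- The lattice reflected in the diagonal. -/
def transpose : GridLattice where
  n := Λ.n
  N := Λ.N
  mem u v := Λ.mem v u
  n_pos := Λ.n_pos
  N_pos := Λ.N_pos
  zero_mem := Λ.zero_mem
  sub_mem h h' := Λ.sub_mem h h'
  dvd_fst h := Λ.dvd_snd h
  dvd_snd h := Λ.dvd_fst h
  row := Λ.col
  col := Λ.row

/-- The lattice reflected in the vertical axis. -/
def reflect : GridLattice where
  n := Λ.n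
  N := Λ.N
  mem u v := Λ.mem (-u) v
  n_pos := Λ.n_pos
  N_pos := Λ.N_pos
  zero_mem := by simpa using Λ.zero_mem
  sub_mem {u v u' v'} h h' := by
    have := Λ.sub_mem h h'
    rwa [show -u - -u' = -(u - u') by ring] at this
  dvd_fst h := (dvd_neg).1 (Λ.dvd_fst h)
  dvd_snd h := Λ.dvd_snd h
  row {u} := by rw [Λ.row, dvd_neg]
  col {v} := by rw [neg_zero, Λ.col]

variable {Λ}

theorem mem_of_eq {u v u' v' : ℤ} (h : Λ.mem u v) (hu : u = u') (hv : v = v') : Λ.mem u' v' := by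
  subst hu hv; exact h

theorem neg_mem {u v : ℤ} (h : Λ.mem u v) : Λ.mem (-u) (-v) :=
  mem_of_eq (Λ.sub_mem Λ.zero_mem h) (by ring) (by ring)

theorem add_mem {u v u' v' : ℤ} (h : Λ.mem u v) (h' : Λ.mem u' v') : Λ.mem (u + u') (v + v') :=
  mem_of_eq (Λ.sub_mem h (neg_mem h')) (by ring) (by ring)

theorem nsmul_mem {u v : ℤ} (h : Λ.mem u v) (k : ℕ) : Λ.mem (k * u) (k * v) := by
  induction k with
  | zero => simpa using Λ.zero_mem
  | succ k ih => exact mem_of_eq (add_mem ih h) (by push_cast; ring) (by push_cast; ring)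

theorem zsmul_mem {u v : ℤ} (h : Λ.mem u v) (k : ℤ) : Λ.mem (k * u) (k * v) := by
  obtain ⟨m, rfl | rfl⟩ := k.eq_nat_or_neg
  · exact nsmul_mem h m
  · exact mem_of_eq (neg_mem (nsmul_mem h m)) (by ring) (by ring)

variable (Λ)

/-- A `w × h` box of the plane embeds in the torus. -/
def Emb (w h : ℤ) : Prop :=
  ∀ u v : ℤ, Λ.mem u v → -w < u → u < w → -h < v → v < h → u = 0 ∧ v = 0

/-- The preimages in the plane of generators: one point on each horizontal and on each vertical
circle. -/
structure IsGen (X : ℤ → ℤ → Prop) : Prop where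
  trans : ∀ {s t u v : ℤ}, X s t → Λ.mem u v → X (s + u) (t + v)
  row : ∀ {s t s' t' : ℤ}, X s t → X s' t' → (Λ.n : ℤ) ∣ t' - t → Λ.mem (s' - s) (t' - t)
  col : ∀ {s t s' t' : ℤ}, X s t → X s' t' → (Λ.n : ℤ) ∣ s' - s → Λ.mem (s' - s) (t' - t)
  exRow : ∀ t : ℤ, ∃ s, X s t
  exCol : ∀ s : ℤ, ∃ t, X s t

/-- The box `[a, a'] × [b, b']` is a lift of a rectangle from `X` to `Y`. -/
structure IsBox (X Y : ℤ → ℤ → Prop) (a b a' b' : ℤ) : Prop where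
  hx : a < a'
  hy : b < b'
  ll : X a b
  ur : X a' b'
  lr : Y a' b
  ul : Y a b'
  emb : Λ.Emb (a' - a) (b' - b)
  ndvd : ¬ (Λ.n : ℤ) ∣ b' - b
  agree : ∀ s t : ℤ, ¬ (Λ.n : ℤ) ∣ t - b → ¬ (Λ.n : ℤ) ∣ t - b' → (X s t ↔ Y s t)

/-- Functions on the squares of the torus. -/
def Periodic (f : ℤ → ℤ → ℕ) : Prop := ∀ s t u v : ℤ, Λ.mem u v → f (s + u) (t + v) = f s t

/-- A box covers a square of the torus. -/
def Covers (a b a' b' s t : ℤ) : Prop :=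
  ∃ u v, Λ.mem u v ∧ a ≤ s + u ∧ s + u < a' ∧ b ≤ t + v ∧ t + v < b'

end GridLattice

/-- The interior of a box contains no point of `X`. -/
def EmptyBox (X : ℤ → ℤ → Prop) (a b a' b' : ℤ) : Prop :=
  ∀ s t : ℤ, X s t → a < s → s < a' → b < t → t < b' → False

/-- The sum of a function over the unit squares of a box. -/
def boxSum (f : ℤ → ℤ → ℕ) (a b a' b' : ℤ) : ℕ :=
  ∑ s ∈ Finset.Ico a a', ∑ t ∈ Finset.Ico b b', f s t

theorem boxSum_transpose (f : ℤ → ℤ → ℕ) (a b a' b' : ℤ) :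
    boxSum f a b a' b' = boxSum (fun s t => f t s) b a b' a' := Finset.sum_comm

theorem boxSum_reflect (f : ℤ → ℤ → ℕ) (a b a' b' : ℤ) :
    boxSum f a b a' b' = boxSum (fun s t => f (-1 - s) t) (-a') b (-a) b' := by
  unfold boxSum
  refine Finset.sum_nbij' (fun s => -1 - s) (fun s => -1 - s) ?_ ?_ ?_ ?_ ?_
  · intro s hs; simp only [Finset.mem_Ico] at hs ⊢; omega
  · intro s hs; simp only [Finset.mem_Ico] at hs ⊢; omega
  · intro s _; ring
  · intro s _; ring
  · intro s _; exact Finset.sum_congr rfl fun t _ => by congr 1; ring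

theorem boxSum_split_x (f : ℤ → ℤ → ℕ) {a c a' : ℤ} (b b' : ℤ) (h1 : a ≤ c) (h2 : c ≤ a') :
    boxSum f a b a' b' = boxSum f a b c b' + boxSum f c b a' b' := by
  unfold boxSum
  rw [← Finset.Ico_union_Ico_eq_Ico h1 h2,
    Finset.sum_union (Finset.Ico_disjoint_Ico_consecutive a c a')]

theorem boxSum_split_y (f : ℤ → ℤ → ℕ) {b d b' : ℤ} (a a' : ℤ) (h1 : b ≤ d) (h2 : d ≤ b') :
    boxSum f a b a' b' = boxSum f a b a' d + boxSum f a d a' b' := by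
  rw [boxSum_transpose f a b a' b', boxSum_split_x _ _ _ h1 h2, ← boxSum_transpose f a b a' d,
    ← boxSum_transpose f a d a' b']

theorem boxSum_eq_sum_product (f : ℤ → ℤ → ℕ) (a b a' b' : ℤ) :
    boxSum f a b a' b' = ∑ x ∈ Finset.Ico a a' ×ˢ Finset.Ico b b', f x.1 x.2 := by
  rw [Finset.sum_product]; rfl

theorem boxSum_translate {Λ : GridLattice} {f : ℤ → ℤ → ℕ} (hf : Λ.Periodic f) {u v : ℤ}
    (h : Λ.mem u v) (a b a' b' : ℤ) :
    boxSum f (a + u) (b + v) (a' + u) (b' + v) = boxSum f a b a' b' := by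
  unfold boxSum
  rw [← Finset.map_add_right_Ico a a' u, Finset.sum_map]
  refine Finset.sum_congr rfl fun s _ => ?_
  rw [← Finset.map_add_right_Ico b b' v, Finset.sum_map]
  exact Finset.sum_congr rfl fun t _ => hf s t u v h

namespace GridLattice

variable {Λ : GridLattice} {X Y Z : ℤ → ℤ → Prop} {a b a' b' c d c' d' : ℤ}

theorem Periodic.transpose {f : ℤ → ℤ → ℕ} (hf : Λ.Periodic f) :
    Λ.transpose.Periodic fun s t => f t s := fun s t u v h => hf t s v u h

theorem Periodic.reflect {f : ℤ → ℤ → ℕ} (hf : Λ.Periodic f) :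
    Λ.reflect.Periodic fun s t => f (-1 - s) t := fun s t u v h => by
  have := hf (-1 - s) t (-u) v h
  rwa [show -1 - s + -u = -1 - (s + u) by ring] at this

theorem Emb.mono {w h w' h' : ℤ} (H : Λ.Emb w h) (hw : w' ≤ w) (hh : h' ≤ h) : Λ.Emb w' h' :=
  fun u v m h1 h2 h3 h4 => H u v m (by omega) (by omega) (by omega) (by omega)

theorem Emb.transpose {w h : ℤ} (H : Λ.Emb w h) : Λ.transpose.Emb h w :=
  fun u v m h1 h2 h3 h4 => (H v u m h3 h4 h1 h2).symm

theorem Emb.reflect {w h : ℤ} (H : Λ.Emb w h) : Λ.reflect.Emb w h := by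
  intro u v m h1 h2 h3 h4
  have := H (-u) v m (by omega) (by omega) h3 h4
  omega

namespace IsGen

theorem transpose (hX : Λ.IsGen X) : Λ.transpose.IsGen fun s t => X t s where
  trans h m := hX.trans h m
  row h h' m := hX.col h h' m
  col h h' m := hX.row h h' m
  exRow := hX.exCol
  exCol := hX.exRow

theorem reflect (hX : Λ.IsGen X) : Λ.reflect.IsGen fun s t => X (-s) t where
  trans {s t u v} h m := by
    have := hX.trans h m
    rwa [show -s + -u = -(s + u) by ring] at this
  row {s t s' t'} h h' m := mem_of_eq (Λ := Λ) (hX.row h h' m) (by ring) rfl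
  col {s t s' t'} h h' m := by
    refine mem_of_eq (Λ := Λ) (hX.col h h' ?_) (by ring) rfl
    rw [show -s' - -s = -(s' - s) by ring, dvd_neg]; exact m
  exRow t := by
    obtain ⟨s, hs⟩ := hX.exRow t
    exact ⟨-s, by simpa using hs⟩
  exCol s := hX.exCol (-s)

theorem trans' (hX : Λ.IsGen X) {s t s' t' : ℤ} (h : X s t) (m : Λ.mem (s' - s) (t' - t)) :
    X s' t' := by
  have := hX.trans h m
  rwa [add_sub_cancel, add_sub_cancel] at this

/-- Generators that share a point on a horizontal circle agree on this circle. -/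
theorem iff_of_row (hX : Λ.IsGen X) (hY : Λ.IsGen Y) {s t t₀ s₀ : ℤ} (h : X s₀ t₀) (h' : Y s₀ t₀)
    (m : (Λ.n : ℤ) ∣ t - t₀) : X s t ↔ Y s t :=
  ⟨fun hs => hY.trans' h' (hX.row h hs m), fun hs => hX.trans' h (hY.row h' hs m)⟩

theorem ndvd_col (hX : Λ.IsGen X) {s t s' t' : ℤ} (h : X s t) (h' : X s' t')
    (m : ¬ (Λ.n : ℤ) ∣ t' - t) : ¬ (Λ.n : ℤ) ∣ s' - s :=
  fun hd => m (Λ.dvd_snd (hX.col h h' hd))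

theorem ndvd_row (hX : Λ.IsGen X) {s t s' t' : ℤ} (h : X s t) (h' : X s' t')
    (m : ¬ (Λ.n : ℤ) ∣ s' - s) : ¬ (Λ.n : ℤ) ∣ t' - t :=
  fun hd => m (Λ.dvd_fst (hX.row h h' hd))

/-- The generator obtained by exchanging the vertical circles of two points. -/
theorem exists_swap (hX : Λ.IsGen X) (h1 : X a b) (h2 : X a' b') (hd : ¬ (Λ.n : ℤ) ∣ b' - b) :
    ∃ Y, Λ.IsGen Y ∧ Y a' b ∧ Y a b' ∧
      ∀ s t : ℤ, ¬ (Λ.n : ℤ) ∣ t - b → ¬ (Λ.n : ℤ) ∣ t - b' → (X s t ↔ Y s t) := by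
  have hc := hX.ndvd_col h1 h2 hd
  let Y : ℤ → ℤ → Prop := fun s t => Λ.mem (s - a') (t - b) ∨ Λ.mem (s - a) (t - b') ∨
    (¬ (Λ.n : ℤ) ∣ t - b ∧ ¬ (Λ.n : ℤ) ∣ t - b' ∧ X s t)
  have key : ∀ {s t s' t' : ℤ}, Y s t → Y s' t' →
      (((Λ.n : ℤ) ∣ t' - t ∨ (Λ.n : ℤ) ∣ s' - s) → Λ.mem (s' - s) (t' - t)) := by
    have colb : ∀ {s t : ℤ}, ¬ (Λ.n : ℤ) ∣ t - b → X s t → ¬ (Λ.n : ℤ) ∣ s - a :=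
      fun h hx => hX.ndvd_col h1 hx h
    have colb' : ∀ {s t : ℤ}, ¬ (Λ.n : ℤ) ∣ t - b' → X s t → ¬ (Λ.n : ℤ) ∣ s - a' :=
      fun h hx => hX.ndvd_col h2 hx h
    rintro s t s' t' (h | h | ⟨hb, hb', h⟩) (k | k | ⟨kb, kb', k⟩) m
    · exact mem_of_eq (Λ.sub_mem k h) (by ring) (by ring)
    · have e1 := Λ.dvd_fst h; have e2 := Λ.dvd_snd h
      have e3 := Λ.dvd_fst k; have e4 := Λ.dvd_snd k
      exfalso
      rcases m with m | m
      · apply hd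
        rw [show b' - b = (t' - t) + (t - b) - (t' - b') by ring]
        exact dvd_sub (dvd_add m e2) e4
      · apply hc
        rw [show a' - a = -(s' - s) - (s - a') + (s' - a) by ring]
        exact dvd_add (dvd_sub ((dvd_neg).2 m) e1) e3
    · have e1 := Λ.dvd_fst h; have e2 := Λ.dvd_snd h
      exfalso
      rcases m with m | m
      · apply kb
        rw [show t' - b = (t' - t) + (t - b) by ring]
        exact dvd_add m e2
      · apply colb' kb' k
        rw [show s' - a' = (s' - s) + (s - a') by ring]
        exact dvd_add m e1
    · have e1 := Λ.dvd_fst h; have e2 := Λ.dvd_snd h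
      have e3 := Λ.dvd_fst k; have e4 := Λ.dvd_snd k
      exfalso
      rcases m with m | m
      · apply hd
        rw [show b' - b = -(t' - t) - (t - b') + (t' - b) by ring]
        exact dvd_add (dvd_sub ((dvd_neg).2 m) e2) e4
      · apply hc
        rw [show a' - a = (s' - s) + (s - a) - (s' - a') by ring]
        exact dvd_sub (dvd_add m e1) e3
    · exact mem_of_eq (Λ.sub_mem k h) (by ring) (by ring)
    · have e1 := Λ.dvd_fst h; have e2 := Λ.dvd_snd h
      exfalso
      rcases m with m | m
      · apply kb'
        rw [show t' - b' = (t' - t) + (t - b') by ring]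
        exact dvd_add m e2
      · apply colb kb k
        rw [show s' - a = (s' - s) + (s - a) by ring]
        exact dvd_add m e1
    · have e1 := Λ.dvd_fst k; have e2 := Λ.dvd_snd k
      exfalso
      rcases m with m | m
      · apply hb
        rw [show t - b = -(t' - t) + (t' - b) by ring]
        exact dvd_add ((dvd_neg).2 m) e2
      · apply colb' hb' h
        rw [show s - a' = -(s' - s) + (s' - a') by ring]
        exact dvd_add ((dvd_neg).2 m) e1
    · have e1 := Λ.dvd_fst k; have e2 := Λ.dvd_snd k
      exfalso
      rcases m with m | m
      · apply hb'
        rw [show t - b' = -(t' - t) + (t' - b') by ring]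
        exact dvd_add ((dvd_neg).2 m) e2
      · apply colb hb h
        rw [show s - a = -(s' - s) + (s' - a) by ring]
        exact dvd_add ((dvd_neg).2 m) e1
    · rcases m with m | m
      · exact hX.row h k m
      · exact hX.col h k m
  refine ⟨Y, ⟨?_, fun h k m => key h k (Or.inl m), fun h k m => key h k (Or.inr m), ?_, ?_⟩,
    Or.inl (by simpa using Λ.zero_mem), Or.inr (Or.inl (by simpa using Λ.zero_mem)), ?_⟩
  · rintro s t u v (h | h | ⟨hb, hb', h⟩) m
    · exact Or.inl (mem_of_eq (add_mem h m) (by ring) (by ring))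
    · exact Or.inr (Or.inl (mem_of_eq (add_mem h m) (by ring) (by ring)))
    · refine Or.inr (Or.inr ⟨?_, ?_, hX.trans h m⟩)
      · rwa [show t + v - b = t - b + v by ring, dvd_add_left (Λ.dvd_snd m)]
      · rwa [show t + v - b' = t - b' + v by ring, dvd_add_left (Λ.dvd_snd m)]
  · intro t
    by_cases h : (Λ.n : ℤ) ∣ t - b
    · obtain ⟨s, hs⟩ := hX.exRow (b' + (t - b))
      refine ⟨s, Or.inl ?_⟩
      exact mem_of_eq (hX.row h2 hs (by simpa using h)) rfl (by ring)
    by_cases h' : (Λ.n : ℤ) ∣ t - b'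
    · obtain ⟨s, hs⟩ := hX.exRow (b + (t - b'))
      refine ⟨s, Or.inr (Or.inl ?_)⟩
      exact mem_of_eq (hX.row h1 hs (by simpa using h')) rfl (by ring)
    · obtain ⟨s, hs⟩ := hX.exRow t
      exact ⟨s, Or.inr (Or.inr ⟨h, h', hs⟩)⟩
  · intro s
    by_cases h : (Λ.n : ℤ) ∣ s - a
    · obtain ⟨t, ht⟩ := hX.exCol s
      refine ⟨t + (b' - b), Or.inr (Or.inl ?_)⟩
      exact mem_of_eq (hX.col h1 ht h) rfl (by ring)
    by_cases h' : (Λ.n : ℤ) ∣ s - a'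
    · obtain ⟨t, ht⟩ := hX.exCol s
      refine ⟨t + (b - b'), Or.inl ?_⟩
      exact mem_of_eq (hX.col h2 ht h') rfl (by ring)
    · obtain ⟨t, ht⟩ := hX.exCol s
      exact ⟨t, Or.inr (Or.inr ⟨hX.ndvd_row h1 ht h, hX.ndvd_row h2 ht h', ht⟩)⟩
  · intro s t hb hb'
    refine ⟨fun h => Or.inr (Or.inr ⟨hb, hb', h⟩), ?_⟩
    rintro (h | h | h)
    · exact absurd (Λ.dvd_snd h) hb
    · exact absurd (Λ.dvd_snd h) hb'
    · exact h.2.2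

end IsGen

namespace IsBox

theorem ndvd_width (h : Λ.IsBox X Y a b a' b') (hX : Λ.IsGen X) : ¬ (Λ.n : ℤ) ∣ a' - a :=
  hX.ndvd_col h.ll h.ur h.ndvd

theorem transpose (h : Λ.IsBox X Y a b a' b') (hX : Λ.IsGen X) (hY : Λ.IsGen Y) :
    Λ.transpose.IsBox (fun s t => X t s) (fun s t => Y t s) b a b' a' where
  hx := h.hy
  hy := h.hx
  ll := h.ll
  ur := h.ur
  lr := h.ul
  ul := h.lr
  emb := h.emb.transpose
  ndvd := h.ndvd_width hX
  agree := by
    intro t s hs hs'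
    refine ⟨fun hx => ?_, fun hy => ?_⟩
    · exact (h.agree s t (hX.ndvd_row h.ll hx hs) (hX.ndvd_row h.ur hx hs')).1 hx
    · exact (h.agree s t (hY.ndvd_row h.lr hy hs') (hY.ndvd_row h.ul hy hs)).2 hy

theorem reflect (h : Λ.IsBox X Y a b a' b') :
    Λ.reflect.IsBox (fun s t => Y (-s) t) (fun s t => X (-s) t) (-a') b (-a) b' where
  hx := neg_lt_neg h.hx
  hy := h.hy
  ll := by simpa using h.lr
  ur := by simpa using h.ul
  lr := by simpa using h.ll
  ul := by simpa using h.ur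
  emb := by
    have := h.emb.reflect
    rwa [show a' - a = -a - -a' by ring] at this
  ndvd := h.ndvd
  agree s t hb hb' := (h.agree (-s) t hb hb').symm

theorem translate (h : Λ.IsBox X Y a b a' b') (hX : Λ.IsGen X) (hY : Λ.IsGen Y) {u v : ℤ}
    (m : Λ.mem u v) : Λ.IsBox X Y (a + u) (b + v) (a' + u) (b' + v) where
  hx := by linarith [h.hx]
  hy := by linarith [h.hy]
  ll := hX.trans h.ll m
  ur := hX.trans h.ur m
  lr := hY.trans h.lr m
  ul := hY.trans h.ul m
  emb := by simpa using h.emb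
  ndvd := by simpa using h.ndvd
  agree s t hb hb' := by
    refine h.agree s t ?_ ?_
    · rwa [show t - (b + v) = t - b - v by ring, dvd_sub_left (Λ.dvd_snd m)] at hb
    · rwa [show t - (b' + v) = t - b' - v by ring, dvd_sub_left (Λ.dvd_snd m)] at hb'

/-- The points of the initial generator in the interior of a rectangle are not its corners. -/
theorem ndvd_of_interior (h : Λ.IsBox X Y a b a' b') (hX : Λ.IsGen X) {s t : ℤ} (hs : X s t)
    (h1 : a < s) (h2 : s < a') (h3 : b < t) (h4 : t < b') :
    ¬ (Λ.n : ℤ) ∣ t - b ∧ ¬ (Λ.n : ℤ) ∣ t - b' := by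
  constructor
  · intro hd
    have := h.emb _ _ (hX.row h.ll hs hd) (by omega) (by omega) (by omega) (by omega)
    omega
  · intro hd
    have := h.emb _ _ (hX.row h.ur hs hd) (by omega) (by omega) (by omega) (by omega)
    omega

end IsBox

theorem dvd_trans_sub {k x y z : ℤ} (h1 : k ∣ x - y) (h2 : k ∣ y - z) : k ∣ x - z := by
  have := dvd_add h1 h2
  rwa [sub_add_sub_cancel] at this

theorem dvd_symm_sub {k x y : ℤ} (h1 : k ∣ x - y) : k ∣ y - x := (dvd_sub_comm).1 h1

/-! ### Two decompositions of a polygon -/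

/-- There is a second decomposition of the polygon of two boxes, the first one from `X` to `Y` and
the second one from `Y` to `Z`, into empty rectangles.  Equality of polygons is expressed by the
sums of all periodic functions; the last clause says that the two decompositions differ. -/
def HasAlternative (Λ : GridLattice) (X Y Z : ℤ → ℤ → Prop) (a b a' b' c d c' d' : ℤ) : Prop :=
  ∃ Y' e f e' f' g k g' k', Λ.IsGen Y' ∧ Λ.IsBox X Y' e f e' f' ∧ Λ.IsBox Y' Z g k g' k' ∧
    EmptyBox X e f e' f' ∧ EmptyBox Y' g k g' k' ∧
    (∀ φ, Λ.Periodic φ → boxSum φ a b a' b' + boxSum φ c d c' d' =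
      boxSum φ e f e' f' + boxSum φ g k g' k') ∧
    ((∀ s t, Y s t ↔ Y' s t) → (Λ.n : ℤ) ∣ f - b → (Λ.n : ℤ) ∣ k - d → False)

/-- Two boxes with four different horizontal circles can be exchanged. -/
theorem hasAlternative_of_disjoint (hX : Λ.IsGen X) (hY : Λ.IsGen Y) (hZ : Λ.IsGen Z)
    (h1 : Λ.IsBox X Y a b a' b') (h2 : Λ.IsBox Y Z c d c' d') (e1 : EmptyBox X a b a' b')
    (e2 : EmptyBox Y c d c' d') (n1 : ¬ (Λ.n : ℤ) ∣ d - b) (n2 : ¬ (Λ.n : ℤ) ∣ d - b')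
    (n3 : ¬ (Λ.n : ℤ) ∣ d' - b) (n4 : ¬ (Λ.n : ℤ) ∣ d' - b') :
    HasAlternative Λ X Y Z a b a' b' c d c' d' := by
  have xc : X c d := (h1.agree _ _ n1 n2).2 h2.ll
  have xc' : X c' d' := (h1.agree _ _ n3 n4).2 h2.ur
  obtain ⟨Y', hY', y1, y2, ag⟩ := hX.exists_swap xc xc' h2.ndvd
  have n1' := fun h => n1 (dvd_symm_sub h)
  have n2' := fun h => n2 (dvd_symm_sub h)
  have n3' := fun h => n3 (dvd_symm_sub h)
  have n4' := fun h => n4 (dvd_symm_sub h)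
  have b3 : Λ.IsBox X Y' c d c' d' := ⟨h2.hx, h2.hy, xc, xc', y1, y2, h2.emb, h2.ndvd, ag⟩
  have b4 : Λ.IsBox Y' Z a b a' b' := by
    refine ⟨h1.hx, h1.hy, (ag _ _ n1' n3').1 h1.ll, (ag _ _ n2' n4').1 h1.ur,
      (h2.agree _ _ n1' n3').1 h1.lr, (h2.agree _ _ n2' n4').1 h1.ul, h1.emb, h1.ndvd, ?_⟩
    intro s t hb hb'
    by_cases k1 : (Λ.n : ℤ) ∣ t - d
    · exact hY'.iff_of_row hZ y1 h2.lr k1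
    by_cases k2 : (Λ.n : ℤ) ∣ t - d'
    · exact hY'.iff_of_row hZ y2 h2.ul k2
    rw [← ag s t k1 k2, ← h2.agree s t k1 k2, h1.agree s t hb hb']
  refine ⟨Y', c, d, c', d', a, b, a', b', hY', b3, b4, ?_, ?_, fun φ _ => add_comm _ _, ?_⟩
  -- A point of `X` inside the second box `r₂` lies on a row of a corner of `r₁`; the neighbouring
  -- corners, which are points of `Y`, are not inside `r₂`, so that a corner of `r₂` is inside `r₁`.
  · intro s t hs p1 p2 p3 p4
    by_cases k1 : (Λ.n : ℤ) ∣ t - b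
    · have m := hX.row h1.ll hs k1
      have q1 := hY.trans h1.lr m
      have q2 := hY.trans h1.ul m
      have g1 : c' < a' + (s - a) := by
        by_contra hlt
        rcases lt_or_eq_of_le (not_lt.1 hlt) with hlt | heq
        · exact e2 _ _ q1 (by have := h1.hx; omega) hlt (by omega) (by omega)
        · rw [heq] at q1
          have := Λ.dvd_snd (hY.col q1 h2.ur (by simp))
          exact n3 (dvd_trans_sub (by simpa using this) k1)
      have g2 : d' < b' + (t - b) := by
        by_contra hlt
        rcases lt_or_eq_of_le (not_lt.1 hlt) with hlt | heq
        · exact e2 _ _ q2 (by omega) (by omega) (by have := h1.hy; omega) hlt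
        · have : (Λ.n : ℤ) ∣ d' - b' := by rw [← heq]; simpa using k1
          exact n4 this
      have q3 := hX.trans xc' (neg_mem m)
      exact e1 _ _ q3 (by omega) (by omega) (by omega) (by omega)
    by_cases k2 : (Λ.n : ℤ) ∣ t - b'
    · have m := hX.row h1.ur hs k2
      have q1 := hY.trans h1.lr m
      have q2 := hY.trans h1.ul m
      have g1 : a + (s - a') < c := by
        by_contra hlt
        rcases lt_or_eq_of_le (not_lt.1 hlt) with hlt | heq
        · exact e2 _ _ q2 hlt (by have := h1.hx; omega) (by omega) (by omega)
        · rw [← heq] at q2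
          have := Λ.dvd_snd (hY.col q2 h2.ll (by simp))
          exact n2 (dvd_trans_sub (by simpa using this) k2)
      have g2 : b + (t - b') < d := by
        by_contra hlt
        rcases lt_or_eq_of_le (not_lt.1 hlt) with hlt | heq
        · exact e2 _ _ q1 (by omega) (by omega) hlt (by have := h1.hy; omega)
        · have : (Λ.n : ℤ) ∣ d - b := by rw [heq]; simpa using k2
          exact n1 this
      have q3 := hX.trans xc (neg_mem m)
      exact e1 _ _ q3 (by omega) (by omega) (by omega) (by omega)
    exact e2 _ _ ((h1.agree s t k1 k2).1 hs) p1 p2 p3 p4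
  -- the same argument with the roles of the two boxes exchanged
  · intro s t hs p1 p2 p3 p4
    by_cases k1 : (Λ.n : ℤ) ∣ t - d
    · have m := hY'.row y1 hs k1
      have q1 := hX.trans xc m
      have q2 := hX.trans xc' m
      have g1 : c + (s - c') < a := by
        by_contra hlt
        rcases lt_or_eq_of_le (not_lt.1 hlt) with hlt | heq
        · exact e1 _ _ q1 hlt (by have := h2.hx; omega) (by omega) (by omega)
        · rw [← heq] at q1
          have := Λ.dvd_snd (hX.col q1 h1.ll (by simp))
          exact n1' (dvd_trans_sub (by simpa using this) k1)
      have g2 : b' < d' + (t - d) := by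
        by_contra hlt
        rcases lt_or_eq_of_le (not_lt.1 hlt) with hlt | heq
        · exact e1 _ _ q2 (by omega) (by omega) (by have := h2.hy; omega) hlt
        · have : (Λ.n : ℤ) ∣ b' - d' := by rw [← heq]; simpa using k1
          exact n4' this
      have q3 := hY.trans h1.ul (neg_mem m)
      exact e2 _ _ q3 (by omega) (by omega) (by omega) (by omega)
    by_cases k2 : (Λ.n : ℤ) ∣ t - d'
    · have m := hY'.row y2 hs k2
      have q1 := hX.trans xc m
      have q2 := hX.trans xc' m
      have g1 : a' < c' + (s - c) := by
        by_contra hlt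
        rcases lt_or_eq_of_le (not_lt.1 hlt) with hlt | heq
        · exact e1 _ _ q2 (by have := h2.hx; omega) hlt (by omega) (by omega)
        · rw [heq] at q2
          have := Λ.dvd_snd (hX.col q2 h1.ur (by simp))
          exact n4' (dvd_trans_sub (by simpa using this) k2)
      have g2 : d + (t - d') < b := by
        by_contra hlt
        rcases lt_or_eq_of_le (not_lt.1 hlt) with hlt | heq
        · exact e1 _ _ q1 (by omega) (by omega) hlt (by have := h2.hy; omega)
        · have : (Λ.n : ℤ) ∣ b - d := by rw [heq]; simpa using k2
          exact n1' this
      have q3 := hY.trans h1.lr (neg_mem m)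
      exact e2 _ _ q3 (by omega) (by omega) (by omega) (by omega)
    exact e1 _ _ ((ag s t k1 k2).2 hs) p1 p2 p3 p4
  · intro _ hd _
    exact n1 hd

/-- The box sums of the two decompositions of an L-shaped polygon agree. -/
theorem boxSum_corner (φ : ℤ → ℤ → ℕ) (h1 : a ≤ a') (h2 : a' ≤ c') (h3 : b ≤ d')
    (h4 : d' ≤ b') : boxSum φ a b a' b' + boxSum φ a' b c' d' =
      boxSum φ a b c' d' + boxSum φ a d' a' b' := by
  rw [boxSum_split_y φ a a' h3 h4, boxSum_split_x φ b d' h1 h2]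
  omega

/-- An L-shaped polygon, cut along the vertical ray from its reflex corner, can also be cut along
the horizontal ray.  Emptiness makes sure that the wider of the two new rectangles embeds. -/
theorem hasAlternative_of_corner (hX : Λ.IsGen X) (hY : Λ.IsGen Y) (hZ : Λ.IsGen Z)
    (h1 : Λ.IsBox X Y a b a' b') (h2 : Λ.IsBox Y Z a' b c' d') (e1 : EmptyBox X a b a' b')
    (e2 : EmptyBox Y a' b c' d') (hlt : d' < b') (nd : ¬ (Λ.n : ℤ) ∣ d' - b') :
    HasAlternative Λ X Y Z a b a' b' a' b c' d' := by
  have i1 := h1.hx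
  have i2 := h1.hy
  have i3 := h2.hx
  have i4 := h2.hy
  have nd' := fun h => nd (dvd_symm_sub h)
  have xc' : X c' d' := (h1.agree _ _ h2.ndvd nd).2 h2.ur
  obtain ⟨Y', hY', y1, y2, ag⟩ := hX.exists_swap h1.ll xc' h2.ndvd
  have nw := h1.ndvd_width hX
  have nw2 := h2.ndvd_width hY
  -- A translate of the wide box that overlaps it moves a corner of one of the given boxes into the
  -- interior of the other one.
  have emb3 : Λ.Emb (c' - a) (d' - b) := by
    have main : ∀ u v : ℤ, Λ.mem u v → 0 < u → u < c' - a → -(d' - b) < v → v < d' - b →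
        False := by
      intro u v m k1 k2 k3 k4
      have du := Λ.dvd_fst m
      have u1 : a' - a < u := by
        by_contra hle
        rcases lt_or_eq_of_le (not_lt.1 hle) with hl | he
        · have := h1.emb u v m (by omega) hl (by omega) (by omega); omega
        · exact nw (he ▸ du)
      have u2 : c' - a' < u := by
        by_contra hle
        rcases lt_or_eq_of_le (not_lt.1 hle) with hl | he
        · have := h2.emb u v m (by omega) hl (by omega) (by omega); omega
        · exact nw2 (he ▸ du)
      have q1 := hX.trans xc' (neg_mem m)
      have q2 := hY.trans h1.ul m
      by_cases hv : d' - v < b'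
      · exact e1 _ _ q1 (by omega) (by omega) (by omega) (by omega)
      · have hne : d' - v ≠ b' := by
          intro he
          apply nd
          rw [show d' - b' = v by omega]
          exact Λ.dvd_snd m
        exact e2 _ _ q2 (by omega) (by omega) (by omega) (by omega)
    intro u v m k1 k2 k3 k4
    rcases lt_trichotomy u 0 with hu | hu | hu
    · exact (main _ _ (neg_mem m) (by omega) (by omega) (by omega) (by omega)).elim
    · exact h1.emb u v m (by omega) (by omega) (by omega) (by omega)
    · exact (main _ _ m (by omega) (by omega) (by omega) (by omega)).elim
  have b3 : Λ.IsBox X Y' a b c' d' :=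
    ⟨by omega, h2.hy, h1.ll, xc', y1, y2, emb3, h2.ndvd, ag⟩
  have b4 : Λ.IsBox Y' Z a d' a' b' := by
    refine ⟨h1.hx, hlt, y2, (ag _ _ h1.ndvd nd').1 h1.ur, h2.ul,
      (h2.agree _ _ h1.ndvd nd').1 h1.ul, h1.emb.mono le_rfl (by omega), nd', ?_⟩
    intro s t hb hb'
    by_cases k1 : (Λ.n : ℤ) ∣ t - b
    · exact hY'.iff_of_row hZ y1 h2.lr k1
    rw [← ag s t k1 hb, h1.agree s t k1 hb', h2.agree s t k1 hb]
  refine ⟨Y', a, b, c', d', a, d', a', b', hY', b3, b4, ?_, ?_, fun φ _ => ?_, ?_⟩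
  · intro s t hs p1 p2 p3 p4
    obtain ⟨k1, -⟩ := b3.ndvd_of_interior hX hs p1 p2 p3 p4
    by_cases hsa : s < a'
    · exact e1 _ _ hs p1 hsa p3 (by omega)
    by_cases k2 : (Λ.n : ℤ) ∣ t - b'
    · have m := hX.row h1.ur hs k2
      have u1 : a' - a < s - a' := by
        by_contra hle
        rcases lt_or_eq_of_le (not_lt.1 hle) with hl | he
        · have := h1.emb _ _ m (by omega) hl (by omega) (by omega); omega
        · exact nw (he ▸ Λ.dvd_fst m)
      exact e2 _ _ (hY.trans h1.ul m) (by omega) (by omega) (by omega) (by omega)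
    · have hne : s ≠ a' := by
        rintro rfl
        exact k2 (Λ.dvd_snd (hX.col h1.ur hs (by simp)))
      exact e2 _ _ ((h1.agree s t k1 k2).1 hs) (by omega) p2 p3 p4
  · intro s t hs p1 p2 p3 p4
    obtain ⟨k2, -⟩ := b4.ndvd_of_interior hY' hs p1 p2 p3 p4
    by_cases k1 : (Λ.n : ℤ) ∣ t - b
    · have m := hY'.row y1 hs k1
      have u1 : a' - a < c' - s := by
        by_contra hle
        rcases lt_or_eq_of_le (not_lt.1 hle) with hl | he
        · have := h1.emb _ _ m (by omega) (by omega) (by omega) (by omega); omega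
        · exact nw (he ▸ (dvd_symm_sub (Λ.dvd_fst m)))
      have q1 := hX.trans xc' m
      have q2 := hY.trans h1.ul (neg_mem m)
      by_cases hv : d' + (t - b) < b'
      · exact e1 _ _ q1 (by omega) (by omega) (by omega) hv
      · have hne : d' + (t - b) ≠ b' := by
          intro he
          apply nd
          rw [show d' - b' = -(t - b) by omega]
          exact (dvd_neg).2 k1
        exact e2 _ _ q2 (by omega) (by omega) (by omega) (by omega)
    · exact e1 _ _ ((ag s t k1 k2).2 hs) p1 p2 (by omega) p4
  · exact boxSum_corner φ (by omega) (by omega) (by omega) (by omega)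
  · intro hyy _ _
    exact nw2 (Λ.dvd_fst (hY'.row ((hyy _ _).1 h1.lr) y1 (by simp)))

/-- The rectangles cut out by the horizontal rays of a staircase-shaped strip embed if those cut
out by the vertical rays do. -/
theorem Emb.spiral {w h W δ K r : ℤ} (e1 : Λ.Emb w h) (e2 : Λ.Emb (W - w) (h + δ))
    (m : Λ.mem W δ) (nw : ¬ (Λ.n : ℤ) ∣ w) (hw : 0 < w) (hwW : w < W) (hr : 0 < r) (hrδ : r ≤ δ)
    (hK : K * δ + r ≤ h + δ) : Λ.Emb (K * W + (W - w)) r := by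
  have hδ : 0 < δ := by omega
  have nw2 : ¬ (Λ.n : ℤ) ∣ W - w := fun hd => nw ((dvd_sub_right (Λ.dvd_fst m)).1 hd)
  have main : ∀ u v : ℤ, Λ.mem u v → 0 ≤ u → u < K * W + (W - w) → -r < v → v < r →
      u = 0 ∧ v = 0 := by
    intro u v muv k1 k2 k3 k4
    have hW : 0 < W := by omega
    -- subtract multiples of the period `(W, δ)`, to apply the two hypotheses to a narrow vector
    obtain ⟨j, x, rfl, hx0, hxW⟩ : ∃ j x, u = j * W + x ∧ 0 ≤ x ∧ x < W :=
      ⟨u / W, u % W, by rw [mul_comm]; exact (Int.mul_ediv_add_emod u W).symm,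
        Int.emod_nonneg _ (by omega), Int.emod_lt_of_pos _ hW⟩
    have hj0 : 0 ≤ j := by
      by_contra hneg
      have : j * W ≤ (-1) * W := mul_le_mul_of_nonneg_right (by omega) hW.le
      omega
    have mx : Λ.mem x (v - j * δ) := mem_of_eq (Λ.sub_mem muv (zsmul_mem m j)) (by ring) (by ring)
    have mx' : Λ.mem (x - W) (v - j * δ - δ) := Λ.sub_mem mx m
    have hxw : x ≠ w := fun h => nw (h ▸ Λ.dvd_fst mx)
    have hxw2 : x ≠ W - w := fun h => nw2 (h ▸ Λ.dvd_fst mx)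
    have hjδ : 0 ≤ j * δ := mul_nonneg hj0 hδ.le
    have fin : x = 0 → v - j * δ = 0 → j * W + x = 0 ∧ v = 0 := by
      intro hx hv
      have : j = 0 := by
        by_contra hj
        have : 1 * δ ≤ j * δ := mul_le_mul_of_nonneg_right (by omega) hδ.le
        omega
      subst this
      omega
    have bnd : ∀ i : ℤ, j ≤ i → j * δ ≤ i * δ := fun i hi => mul_le_mul_of_nonneg_right hi hδ.le
    have bndW : ∀ i : ℤ, i ≤ j → i * W ≤ j * W := fun i hi => mul_le_mul_of_nonneg_right hi hW.le
    by_cases c1 : x < W - w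
    · have hjK : j ≤ K := by
        by_contra hlt
        have := bndW (K + 1) (by omega)
        rw [add_mul] at this
        omega
      have := bnd K hjK
      obtain ⟨hx, hv⟩ := e2 _ _ mx (by omega) (by omega) (by omega) (by omega)
      exact fin hx hv
    · have hjK : j ≤ K - 1 := by
        by_contra hlt
        have := bndW K (by omega)
        omega
      have hb := bnd (K - 1) hjK
      rw [sub_mul] at hb
      by_cases c2 : x < w
      · obtain ⟨hx, hv⟩ := e1 _ _ mx (by omega) (by omega) (by omega) (by omega)
        exact fin hx hv
      · obtain ⟨hx, hv⟩ := e2 _ _ mx' (by omega) (by omega) (by omega) (by omega)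
        omega
  intro u v muv k1 k2 k3 k4
  rcases le_total 0 u with hu | hu
  · exact main u v muv hu k2 k3 k4
  · have := main (-u) (-v) (neg_mem muv) (by omega) (by omega) (by omega) (by omega)
    omega

/-- A staircase-shaped strip: vertical cuts refine to horizontal ones. -/
theorem strip_to_vertical {w h W δ k s t : ℤ} (hw : 0 < w) (hwW : w < W) (hδ : 0 < δ)
    (hk : 0 ≤ k) (h1 : k * δ < h)
    (hst : (w ≤ s ∧ s < (k + 1) * W ∧ h ≤ t ∧ t < (k + 1) * δ) ∨
      (w - W ≤ s ∧ s < (k + 1) * W ∧ k * δ ≤ t ∧ t < h)) :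
    ((0 ≤ s - s / W * W ∧ s - s / W * W < w) ∧ 0 ≤ t - s / W * δ ∧ t - s / W * δ < h) ∨
      ((w ≤ s - s / W * W ∧ s - s / W * W < W) ∧ 0 ≤ t - s / W * δ ∧
        t - s / W * δ < h + δ) := by
  have hW : 0 < W := by omega
  obtain ⟨j, x, rfl, hx0, hxW, hj⟩ : ∃ j x, s = j * W + x ∧ 0 ≤ x ∧ x < W ∧ s / W = j :=
    ⟨s / W, s % W, by rw [mul_comm]; exact (Int.mul_ediv_add_emod s W).symm,
      Int.emod_nonneg _ (by omega), Int.emod_lt_of_pos _ hW, rfl⟩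
  rw [hj]
  clear hj
  have bndW : ∀ i l : ℤ, i ≤ l → i * W ≤ l * W := fun i l hi => mul_le_mul_of_nonneg_right hi hW.le
  have bnd : ∀ i l : ℤ, i ≤ l → i * δ ≤ l * δ := fun i l hi => mul_le_mul_of_nonneg_right hi hδ.le
  have hjk : j ≤ k := by
    by_contra hlt
    have := bndW (k + 1) j (by omega)
    omega
  have hjm : -1 ≤ j := by
    by_contra hlt
    have := bndW j (-2) (by omega)
    omega
  have b1 := bnd _ _ hjk
  have b2 := bnd _ _ hjm
  simp only [add_mul, one_mul] at *
  have hkδ : 0 ≤ k * δ := mul_nonneg hk hδ.le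
  rcases hst with ⟨p1, p2, p3, p4⟩ | ⟨p1, p2, p3, p4⟩
  · have hj0 : 0 ≤ j := by
      by_contra hlt
      have := bndW j (-1) (by omega)
      omega
    have b3 := bnd _ _ hj0
    by_cases hxw : x < w
    · have hj1 : 1 ≤ j := by
        by_contra hlt
        have : j = 0 := by omega
        subst this
        omega
      have b4 := bnd _ _ hj1
      left; omega
    · right; omega
  · by_cases hxw : x < w
    · have hj0 : 0 ≤ j := by
        by_contra hlt
        have : j = -1 := by omega
        subst this
        omega
      have b3 := bnd _ _ hj0
      left; omega
    · right; omega

/-- A staircase-shaped strip: horizontal cuts refine to vertical ones. -/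
theorem strip_to_horizontal {w h W δ k s t : ℤ} (hw : 0 < w) (hwW : w < W) (hδ : 0 < δ)
    (hk : 0 ≤ k) (h1 : k * δ < h) (h2 : h < (k + 1) * δ)
    (hst : ((0 ≤ s ∧ s < w) ∧ 0 ≤ t ∧ t < h) ∨ ((w ≤ s ∧ s < W) ∧ 0 ≤ t ∧ t < h + δ)) :
    ((w ≤ s - (t / δ - k) * W ∧ s - (t / δ - k) * W < (k + 1) * W) ∧ h ≤ t - (t / δ - k) * δ ∧
        t - (t / δ - k) * δ < (k + 1) * δ) ∨
      ((w - W ≤ s - (t / δ - k) * W ∧ s - (t / δ - k) * W < (k + 1) * W) ∧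
        k * δ ≤ t - (t / δ - k) * δ ∧ t - (t / δ - k) * δ < h) := by
  have hW : 0 < W := by omega
  obtain ⟨j, x, rfl, hx0, hxδ, hj⟩ : ∃ j x, t = j * δ + x ∧ 0 ≤ x ∧ x < δ ∧ t / δ = j :=
    ⟨t / δ, t % δ, by rw [mul_comm]; exact (Int.mul_ediv_add_emod t δ).symm,
      Int.emod_nonneg _ (by omega), Int.emod_lt_of_pos _ hδ, rfl⟩
  rw [hj]
  clear hj
  have bndW : ∀ i l : ℤ, i ≤ l → i * W ≤ l * W := fun i l hi => mul_le_mul_of_nonneg_right hi hW.le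
  have bnd : ∀ i l : ℤ, i ≤ l → i * δ ≤ l * δ := fun i l hi => mul_le_mul_of_nonneg_right hi hδ.le
  have hj0 : 0 ≤ j := by
    by_contra hlt
    have := bnd j (-1) (by omega)
    omega
  have c0 := bndW _ _ hj0
  simp only [add_mul, sub_mul, one_mul] at *
  rcases hst with ⟨⟨p1, p2⟩, p3, p4⟩ | ⟨⟨p1, p2⟩, p3, p4⟩
  · have hjk : j ≤ k := by
      by_contra hlt
      have := bnd (k + 1) j (by omega)
      rw [add_mul] at this
      omega
    have c1 := bndW _ _ hjk
    by_cases hx : k * δ + x < h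
    · right; omega
    · have hj1 : j ≤ k - 1 := by
        by_contra hlt
        have : j = k := by omega
        subst this
        omega
      have c2 := bndW _ _ hj1
      rw [sub_mul] at c2
      left; omega
  · have hjk : j ≤ k + 1 := by
      by_contra hlt
      have := bnd (k + 2) j (by omega)
      rw [add_mul] at this
      omega
    have c1 := bndW _ _ hjk
    rw [add_mul] at c1
    by_cases hx : k * δ + x < h
    · right; omega
    · have hj1 : j ≤ k := by
        by_contra hlt
        have : j = k + 1 := by omega
        subst this
        rw [add_mul] at p4
        omega
      have c2 := bndW _ _ hj1
      left; omega

/-- Both pairs of rectangles are fundamental domains of a strip that is periodic under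
`(W, δ)`, so that they cover the same squares of the torus. -/
theorem boxSum_strip {φ : ℤ → ℤ → ℕ} (hφ : Λ.Periodic φ) (a b : ℤ) {w h W δ k : ℤ}
    (m : Λ.mem W δ) (hw : 0 < w) (hwW : w < W) (hδ : 0 < δ)
    (hk : 0 ≤ k) (h1 : k * δ < h) (h2 : h < (k + 1) * δ) :
    boxSum φ a b (a + w) (b + h) + boxSum φ (a + w) b (a + W) (b + (h + δ)) =
      boxSum φ (a + w) (b + h) (a + (k + 1) * W) (b + (k + 1) * δ) +
        boxSum φ (a + (w - W)) (b + k * δ) (a + (k + 1) * W) (b + h) := by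
  classical
  simp only [boxSum_eq_sum_product]
  rw [← Finset.sum_union, ← Finset.sum_union]
  -- a square is moved by the multiple of `(W, δ)` that takes its height, respectively its abscissa,
  -- to the fundamental domain
  · refine Finset.sum_nbij'
      (fun x => (x.1 - ((x.2 - b) / δ - k) * W, x.2 - ((x.2 - b) / δ - k) * δ))
      (fun x => (x.1 - ((x.1 - a) / W) * W, x.2 - ((x.1 - a) / W) * δ)) ?_ ?_ ?_ ?_ ?_
    · rintro ⟨s, t⟩ hst
      simp only [Finset.mem_union, Finset.mem_product, Finset.mem_Ico] at hst ⊢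
      have := strip_to_horizontal (s := s - a) (t := t - b) hw hwW hδ hk h1 h2 (by omega)
      omega
    · rintro ⟨s, t⟩ hst
      simp only [Finset.mem_union, Finset.mem_product, Finset.mem_Ico] at hst ⊢
      have := strip_to_vertical (s := s - a) (t := t - b) hw hwW hδ hk h1 (by omega)
      omega
    · rintro ⟨s, t⟩ hst
      simp only [Finset.mem_union, Finset.mem_product, Finset.mem_Ico] at hst
      have hW : 0 < W := by omega
      have e : (s - ((t - b) / δ - k) * W - a) / W = -((t - b) / δ - k) := by
        rw [show s - ((t - b) / δ - k) * W - a = (s - a) + (-((t - b) / δ - k)) * W by ring,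
          Int.add_mul_ediv_right _ _ hW.ne', Int.ediv_eq_zero_of_lt (by omega) (by omega), zero_add]
      simp only [e]
      ext <;> ring
    · rintro ⟨s, t⟩ hst
      simp only [Finset.mem_union, Finset.mem_product, Finset.mem_Ico] at hst
      have e : (t - (s - a) / W * δ - b) / δ = k - (s - a) / W := by
        rw [show t - (s - a) / W * δ - b = (t - b - k * δ) + (k - (s - a) / W) * δ by ring,
          Int.add_mul_ediv_right _ _ hδ.ne', Int.ediv_eq_zero_of_lt (by omega) ?_, zero_add]
        simp only [add_mul, one_mul] at *
        omega
      simp only [e]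
      ext <;> ring
    · rintro ⟨s, t⟩ _
      have := hφ s t _ _ (neg_mem (zsmul_mem m ((t - b) / δ - k)))
      simpa only [← sub_eq_add_neg] using this.symm
  · rw [Finset.disjoint_left]
    rintro ⟨s, t⟩ hst hst'
    simp only [Finset.mem_product, Finset.mem_Ico] at hst hst'
    omega
  · rw [Finset.disjoint_left]
    rintro ⟨s, t⟩ hst hst'
    simp only [Finset.mem_product, Finset.mem_Ico] at hst hst'
    omega

/-- Two rectangles with the same horizontal circles, side by side above a common bottom circle and
the second one higher than the first one, form an annulus with one reflex corner on each boundary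
component.  The vertical cuts from these corners define the given decomposition, the horizontal
ones, which wind around the annulus, another one. -/
theorem exists_spiral (hX : Λ.IsGen X) (hY : Λ.IsGen Y) (hZ : Λ.IsGen Z)
    (h1 : Λ.IsBox X Y a b a' b') (h2 : Λ.IsBox Y Z a' b c' d') (hlt : b' < d')
    (hd : (Λ.n : ℤ) ∣ d' - b') :
    ∃ k : ℤ, 0 ≤ k ∧ k * (d' - b') < b' - b ∧ b' - b < (k + 1) * (d' - b') ∧
      Λ.mem (c' - a) (d' - b') ∧
    ∃ Y', Λ.IsGen Y' ∧ Λ.IsBox X Y' a' b' (a + (k + 1) * (c' - a)) (b + (k + 1) * (d' - b')) ∧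
      Λ.IsBox Y' Z (a + (a' - c')) (b + k * (d' - b')) (a + (k + 1) * (c' - a)) b' ∧
      (∀ φ, Λ.Periodic φ → boxSum φ a b a' b' + boxSum φ a' b c' d' =
        boxSum φ a' b' (a + (k + 1) * (c' - a)) (b + (k + 1) * (d' - b')) +
        boxSum φ (a + (a' - c')) (b + k * (d' - b')) (a + (k + 1) * (c' - a)) b') := by
  have i1 := h1.hx
  have i2 := h1.hy
  have i3 := h2.hx
  have i4 := h2.hy
  have m : Λ.mem (c' - a) (d' - b') := hY.row h1.ul h2.ur hd
  have nw := h1.ndvd_width hX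
  obtain ⟨W, hW⟩ : ∃ W, W = c' - a := ⟨_, rfl⟩
  obtain ⟨δ, hδ⟩ : ∃ δ, δ = d' - b' := ⟨_, rfl⟩
  obtain ⟨w, hw⟩ : ∃ w, w = a' - a := ⟨_, rfl⟩
  obtain ⟨h, hh⟩ : ∃ h, h = b' - b := ⟨_, rfl⟩
  have ndh := h1.ndvd
  rw [← hW, ← hδ] at m
  rw [← hδ] at hd
  rw [← hh] at ndh
  rw [← hw] at nw
  have hδ0 : 0 < δ := by omega
  have hk0 : 0 ≤ h / δ := Int.ediv_nonneg (by omega) hδ0.le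
  have hmod := Int.mul_ediv_add_emod h δ
  have hm0 := Int.emod_nonneg h hδ0.ne'
  have hm1 := Int.emod_lt_of_pos h hδ0
  have hmne : h % δ ≠ 0 := fun h0 => ndh (hd.trans (Int.dvd_of_emod_eq_zero h0))
  generalize h / δ = k at *
  rw [mul_comm] at hmod
  have k1 : k * δ < h := by omega
  have k2 : h < (k + 1) * δ := by rw [add_mul]; omega
  rw [← hδ, ← hW, ← hh]
  refine ⟨k, hk0, k1, k2, m, ?_⟩
  have mk := zsmul_mem m k
  have mk1 := zsmul_mem m (k + 1)
  have xur : X (a + (k + 1) * W) (b + (k + 1) * δ) := hX.trans h1.ll mk1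
  have dk1 := Λ.dvd_snd mk1
  have nd3 : ¬ (Λ.n : ℤ) ∣ (b + (k + 1) * δ) - b' := by
    rw [show b + (k + 1) * δ - b' = (k + 1) * δ - h by omega, dvd_sub_right dk1]
    exact ndh
  obtain ⟨Y', hY', y1, y2, ag⟩ := hX.exists_swap h1.ur xur nd3
  have em2 : Λ.Emb (W - w) (h + δ) := by
    have := h2.emb
    rwa [show c' - a' = W - w by omega, show d' - b = h + δ by omega] at this
  have em1 : Λ.Emb w h := by rw [hw, hh]; exact h1.emb
  have row3 : ∀ t : ℤ, (Λ.n : ℤ) ∣ t - (b + (k + 1) * δ) ↔ (Λ.n : ℤ) ∣ t - b := by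
    intro t
    rw [← sub_sub, dvd_sub_left dk1]
  have rowk : ∀ t : ℤ, (Λ.n : ℤ) ∣ t - (b + k * δ) ↔ (Λ.n : ℤ) ∣ t - b := by
    intro t
    rw [← sub_sub, dvd_sub_left (Λ.dvd_snd mk)]
  have rowd : ∀ t : ℤ, (Λ.n : ℤ) ∣ t - d' ↔ (Λ.n : ℤ) ∣ t - b' := by
    intro t
    rw [show t - d' = t - b' - δ by omega, dvd_sub_left hd]
  have hkW : 0 ≤ k * W := mul_nonneg hk0 (by omega)
  have ylr : Y' (a + (a' - c')) (b + k * δ) := by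
    refine hY'.trans' y2 (mem_of_eq (neg_mem m) (by omega) ?_)
    rw [add_mul]; omega
  have zlr : Z (a + (k + 1) * W) (b + k * δ) := by
    refine hZ.trans' h2.lr (mem_of_eq mk ?_ ?_)
    · rw [add_mul]; omega
    · omega
  have zul : Z (a + (a' - c')) b' :=
    hZ.trans' h2.ul (mem_of_eq (neg_mem m) (by omega) (by omega))
  refine ⟨Y', hY', ⟨?_, by omega, h1.ur, xur, y1, y2, ?_, nd3, ag⟩,
    ⟨?_, by omega, ylr, y1, zlr, zul, ?_, ?_, ?_⟩, ?_⟩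
  · rw [add_mul]; omega
  · have := Emb.spiral (K := k) (r := (k + 1) * δ - h) em1 em2 m nw (by omega) (by omega) (by omega)
      (by rw [add_mul]; omega) (by rw [add_mul]; omega)
    convert this using 1
    · rw [add_mul]; omega
    · omega
  · rw [add_mul]; omega
  · have := Emb.spiral (K := k + 1) (r := h - k * δ) em1 em2 m nw (by omega) (by omega) (by omega)
      (by rw [add_mul] at k2; omega) (by rw [add_mul]; omega)
    convert this using 1
    · rw [add_mul]; omega
    · omega
  · rw [show b' - (b + k * δ) = h - k * δ by omega, dvd_sub_left (Λ.dvd_snd mk)]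
    exact ndh
  · intro s t q1 q2
    rw [rowk] at q1
    have q3 : ¬ (Λ.n : ℤ) ∣ t - (b + (k + 1) * δ) := by rwa [row3]
    rw [← ag s t q2 q3, h1.agree s t q1 q2, h2.agree s t q1 (by rwa [rowd])]
  · intro φ hφ
    have := boxSum_strip hφ a b m (w := w) (h := h) (by omega) (by omega) hδ0 hk0 k1 k2
    rwa [show a + w = a' by omega, show b + h = b' by omega, show a + W = c' by omega,
      show b + (h + δ) = d' by omega, show w - W = a' - c' by omega] at this

/-- The horizontal cuts of the annulus of `exists_spiral` define empty rectangles: an interior point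
of a new rectangle is a translate of an interior point of an old one. -/
theorem hasAlternative_of_spiral (hX : Λ.IsGen X) (hY : Λ.IsGen Y) (hZ : Λ.IsGen Z)
    (h1 : Λ.IsBox X Y a b a' b') (h2 : Λ.IsBox Y Z a' b c' d') (e1 : EmptyBox X a b a' b')
    (e2 : EmptyBox Y a' b c' d') (hlt : b' < d') (hd : (Λ.n : ℤ) ∣ d' - b') :
    HasAlternative Λ X Y Z a b a' b' a' b c' d' := by
  have i1 := h1.hx
  have i2 := h1.hy
  have i3 := h2.hx
  have i4 := h2.hy
  obtain ⟨k, hk0, k1, k2, m, Y', hY', b3, b4, hsum⟩ := exists_spiral hX hY hZ h1 h2 hlt hd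
  refine ⟨Y', _, _, _, _, _, _, _, _, hY', b3, b4, ?_, ?_, hsum, ?_⟩
  all_goals
    have mk := zsmul_mem m k
    have mk1 := zsmul_mem m (k + 1)
    have row3 : ∀ t : ℤ, (Λ.n : ℤ) ∣ t - (b + (k + 1) * (d' - b')) ↔ (Λ.n : ℤ) ∣ t - b := by
      intro t
      rw [← sub_sub, dvd_sub_left (Λ.dvd_snd mk1)]
    have rowk : ∀ t : ℤ, (Λ.n : ℤ) ∣ t - (b + k * (d' - b')) ↔ (Λ.n : ℤ) ∣ t - b := by
      intro t
      rw [← sub_sub, dvd_sub_left (Λ.dvd_snd mk)]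
    have key : ∀ s t : ℤ, X s t → ¬ (Λ.n : ℤ) ∣ t - b → ¬ (Λ.n : ℤ) ∣ t - b' →
        (a' ≤ s ∧ s < a + (k + 1) * (c' - a) ∧ b' ≤ t ∧ t < b + (k + 1) * (d' - b')) ∨
        (a + (a' - c') ≤ s ∧ s < a + (k + 1) * (c' - a) ∧ b + k * (d' - b') ≤ t ∧ t < b') →
        False := by
      intro s t hs q1 q2 hst
      have hv := strip_to_vertical (w := a' - a) (h := b' - b) (W := c' - a) (δ := d' - b')
        (k := k) (s := s - a) (t := t - b) (by omega) (by omega) (by omega) hk0 k1 (by omega)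
      generalize (s - a) / (c' - a) = j at hv
      have mj := neg_mem (zsmul_mem m j)
      have hs' := hX.trans hs mj
      have dj := Λ.dvd_snd mj
      have r1 : ¬ (Λ.n : ℤ) ∣ t + -(j * (d' - b')) - b := by
        rwa [show t + -(j * (d' - b')) - b = t - b + -(j * (d' - b')) by ring,
          dvd_add_left dj]
      have r2 : ¬ (Λ.n : ℤ) ∣ t + -(j * (d' - b')) - b' := by
        rwa [show t + -(j * (d' - b')) - b' = t - b' + -(j * (d' - b')) by ring,
          dvd_add_left dj]
      have r3 := hX.ndvd_col h1.ll hs' r1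
      have r4 := hX.ndvd_col h1.ur hs' r2
      have r5 : s + -(j * (c' - a)) ≠ a := fun h => r3 (by simp [h])
      have r6 : s + -(j * (c' - a)) ≠ a' := fun h => r4 (by simp [h])
      have r7 : t + -(j * (d' - b')) ≠ b := fun h => r1 (by simp [h])
      rcases hv with hv | hv
      · exact e1 _ _ hs' (by omega) (by omega) (by omega) (by omega)
      · exact e2 _ _ ((h1.agree _ _ r1 r2).1 hs') (by omega) (by omega) (by omega) (by omega)
  · intro s t hs p1 p2 p3 p4
    obtain ⟨q1, q2⟩ := b3.ndvd_of_interior hX hs p1 p2 p3 p4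
    exact key s t hs (by rwa [row3] at q2) q1 (by omega)
  · intro s t hs p1 p2 p3 p4
    obtain ⟨q1, q2⟩ := b4.ndvd_of_interior hY' hs p1 p2 p3 p4
    rw [rowk] at q1
    exact key s t ((b3.agree s t q2 (by rwa [row3])).2 hs) q1 q2 (by omega)
  · intro _ h _
    exact h1.ndvd h

theorem reflect_reflect (Λ : GridLattice) : Λ.reflect.reflect = Λ := by
  cases Λ
  simp [reflect]

/-- Emptiness may be tested on the final generator of a rectangle. -/
theorem IsBox.emptyBox_iff (h : Λ.IsBox X Y a b a' b') (hX : Λ.IsGen X) (hY : Λ.IsGen Y) :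
    EmptyBox X a b a' b' ↔ EmptyBox Y a b a' b' := by
  constructor
  · intro e s t hs p1 p2 p3 p4
    have r := h.reflect.ndvd_of_interior hY.reflect (s := -s) (t := t) (by simpa using hs)
      (by omega) (by omega) p3 p4
    exact e s t ((h.agree s t r.1 r.2).2 hs) p1 p2 p3 p4
  · intro e s t hs p1 p2 p3 p4
    have r := h.ndvd_of_interior hX hs p1 p2 p3 p4
    exact e s t ((h.agree s t r.1 r.2).1 hs) p1 p2 p3 p4

theorem emptyBox_reflect (e : EmptyBox X a b a' b') :
    EmptyBox (fun s t => X (-s) t) (-a') b (-a) b' :=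
  fun s t hs p1 p2 p3 p4 => e (-s) t hs (by omega) (by omega) p3 p4

theorem emptyBox_transpose (e : EmptyBox X a b a' b') :
    EmptyBox (fun s t => X t s) b a b' a' :=
  fun s t hs p1 p2 p3 p4 => e t s hs p3 p4 p1 p2

theorem HasAlternative.reflect
    (H : HasAlternative Λ.reflect (fun s t => Z (-s) t) (fun s t => Y (-s) t) (fun s t => X (-s) t)
      (-c') d (-c) d' (-a') b (-a) b') (hX : Λ.IsGen X) (hZ : Λ.IsGen Z) :
    HasAlternative Λ X Y Z a b a' b' c d c' d' := by
  obtain ⟨Y', e, f, e', f', g, k, g', k', hY', b3, b4, e3, e4, hs, hc⟩ := H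
  have e3' := (b3.emptyBox_iff hZ.reflect hY').1 e3
  have e4' := (b4.emptyBox_iff hY' hX.reflect).1 e4
  have c3 := b3.reflect
  have c4 := b4.reflect
  have hY'' := hY'.reflect
  rw [reflect_reflect] at c3 c4 hY''
  simp only [neg_neg] at c3 c4
  refine ⟨_, _, _, _, _, _, _, _, _, hY'', c4, c3, ?_, emptyBox_reflect e3', ?_, ?_⟩
  · have := emptyBox_reflect e4'
    simpa only [neg_neg] using this
  · intro φ hφ
    have := hs _ hφ.reflect
    rw [← boxSum_reflect, ← boxSum_reflect] at this
    rw [add_comm, this, add_comm, boxSum_reflect φ (-g') k, boxSum_reflect φ (-e') f, neg_neg,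
      neg_neg, neg_neg, neg_neg]
  · intro hyy p1 p2
    refine hc (fun s t => ?_) p2 p1
    have := hyy (-s) t
    rwa [neg_neg] at this

theorem HasAlternative.transpose
    (H : HasAlternative Λ.transpose (fun s t => X t s) (fun s t => Y t s) (fun s t => Z t s)
      b a b' a' d c d' c') (hX : Λ.IsGen X) (hY : Λ.IsGen Y) (hZ : Λ.IsGen Z)
    (h1 : Λ.IsBox X Y a b a' b') (h2 : Λ.IsBox Y Z c d c' d') :
    HasAlternative Λ X Y Z a b a' b' c d c' d' := by
  obtain ⟨Y', e, f, e', f', g, k, g', k', hY', b3, b4, e3, e4, hs, hc⟩ := H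
  have c3 := b3.transpose hX.transpose hY'
  have c4 := b4.transpose hY' hZ.transpose
  refine ⟨_, _, _, _, _, _, _, _, _, hY'.transpose, c3, c4, emptyBox_transpose e3,
    emptyBox_transpose e4, ?_, ?_⟩
  · intro φ hφ
    have := hs _ hφ.transpose
    simpa only [← boxSum_transpose] using this
  · intro hyy p1 p2
    refine hc (fun s t => hyy t s) ?_ ?_
    · exact Λ.dvd_fst (hX.row h1.ll c3.ll p1)
    · exact Λ.dvd_fst (hY.row h2.ll ((hyy _ _).2 c4.ll) p2)

/-- The case of two rectangles whose bottom edges lie on the same horizontal circle. -/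
theorem hasAlternative_of_bot_eq (hX : Λ.IsGen X) (hY : Λ.IsGen Y) (hZ : Λ.IsGen Z)
    (h1 : Λ.IsBox X Y a b a' b') (h2 : Λ.IsBox Y Z c d c' d') (e1 : EmptyBox X a b a' b')
    (e2 : EmptyBox Y c d c' d') (hne : ¬ ∀ s t, X s t ↔ Z s t) (hb : (Λ.n : ℤ) ∣ d - b) :
    HasAlternative Λ X Y Z a b a' b' c d c' d' := by
  -- a lift of the second rectangle that is adjacent to the first one
  have shift : ∀ {Λ : GridLattice} {X Y Z : ℤ → ℤ → Prop} {a b a' b' c d c' d' : ℤ}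
      (_ : Λ.IsGen X) (hY : Λ.IsGen Y) (hZ : Λ.IsGen Z) (h1 : Λ.IsBox X Y a b a' b')
      (h2 : Λ.IsBox Y Z c d c' d') (_ : EmptyBox Y c d c' d') (_ : (Λ.n : ℤ) ∣ d - b),
      ∃ u v, Λ.mem u v ∧ a' = c + u ∧ b = d + v ∧
        Λ.IsBox Y Z a' b (c' + u) (d' + v) ∧ EmptyBox Y a' b (c' + u) (d' + v) := by
    intro Λ X Y Z a b a' b' c d c' d' _ hY hZ h1 h2 e2 hb
    have m := neg_mem (hY.row h1.lr h2.ll hb)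
    refine ⟨_, _, m, by ring, by ring, ?_, ?_⟩
    · have := h2.translate hY hZ m
      rwa [show c + -(c - a') = a' by ring, show d + -(d - b) = b by ring] at this
    · intro s t hs p1 p2 p3 p4
      refine e2 _ _ (hY.trans hs (neg_mem m)) ?_ ?_ ?_ ?_ <;> omega
  -- The decompositions of the translated pair are those of the original one.
  have back : ∀ {Λ : GridLattice} {X Y Z : ℤ → ℤ → Prop} {a b a' b' c d c' d' u v : ℤ}
      (_ : Λ.mem u v),
      HasAlternative Λ X Y Z a b a' b' (c + u) (d + v) (c' + u) (d' + v) →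
      HasAlternative Λ X Y Z a b a' b' c d c' d' := by
    rintro Λ X Y Z a b a' b' c d c' d' u v m
      ⟨Y', e, f, e', f', g, k, g', k', hY', b3, b4, e3, e4, hs, hc⟩
    refine ⟨Y', e, f, e', f', g, k, g', k', hY', b3, b4, e3, e4, fun φ hφ => ?_, fun hyy p1 p2 => ?_⟩
    · rw [← hs φ hφ, boxSum_translate hφ m]
    · refine hc hyy p1 ?_
      rwa [← sub_sub, dvd_sub_left (Λ.dvd_snd m)]
  -- the case in which the second box is lower than the first one, but not by a multiple of `n` (an
  -- L-shape), or higher by a multiple of `n` (an annulus)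
  have core : ∀ {Λ : GridLattice} {X Y Z : ℤ → ℤ → Prop} {a b a' b' c d c' d' : ℤ}
      (_ : Λ.IsGen X) (_ : Λ.IsGen Y) (_ : Λ.IsGen Z) (_ : Λ.IsBox X Y a b a' b')
      (_ : Λ.IsBox Y Z c d c' d') (_ : EmptyBox X a b a' b') (_ : EmptyBox Y c d c' d')
      (_ : (Λ.n : ℤ) ∣ d - b),
      ((d' - d < b' - b ∧ ¬ (Λ.n : ℤ) ∣ (d' - d) - (b' - b)) ∨
        (b' - b < d' - d ∧ (Λ.n : ℤ) ∣ (d' - d) - (b' - b))) →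
      HasAlternative Λ X Y Z a b a' b' c d c' d' := by
    intro Λ X Y Z a b a' b' c d c' d' hX hY hZ h1 h2 e1 e2 hb hcase
    obtain ⟨u, v, m, ha', hbv, h2', e2'⟩ := shift hX hY hZ h1 h2 e2 hb
    have heq : d' - d - (b' - b) = d' + v - b' := by omega
    rw [heq] at hcase
    refine back m ?_
    rw [← ha', ← hbv]
    rcases hcase with ⟨p, q⟩ | ⟨p, q⟩
    · exact hasAlternative_of_corner hX hY hZ h1 h2' e1 e2' (by omega) q
    · exact hasAlternative_of_spiral hX hY hZ h1 h2' e1 e2' (by omega) q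
  by_cases h0 : d' - d = b' - b
  · -- The rectangles form a horizontal annulus.
    exfalso
    obtain ⟨u, v, m, ha', hbv, h2', e2'⟩ := shift hX hY hZ h1 h2 e2 hb
    have hd' : d' + v = b' := by omega
    rw [hd'] at h2'
    have m0 : Λ.mem (c' + u - a) 0 :=
      mem_of_eq (hY.row h1.ul h2'.ur (by simp)) rfl (by ring)
    apply hne
    intro s t
    by_cases q1 : (Λ.n : ℤ) ∣ t - b
    · refine hX.iff_of_row hZ (hX.trans' h1.ll ?_) h2'.lr q1
      exact mem_of_eq m0 rfl (by ring)
    by_cases q2 : (Λ.n : ℤ) ∣ t - b'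
    · exact hX.iff_of_row hZ h1.ur h2'.ul q2
    · rw [h1.agree s t q1 q2, h2'.agree s t q1 q2]
  by_cases hcase : ((d' - d < b' - b ∧ ¬ (Λ.n : ℤ) ∣ (d' - d) - (b' - b)) ∨
        (b' - b < d' - d ∧ (Λ.n : ℤ) ∣ (d' - d) - (b' - b)))
  · exact core hX hY hZ h1 h2 e1 e2 hb hcase
  · -- A reflection in the vertical axis exchanges the order of the rectangles.
    refine HasAlternative.reflect ?_ hX hZ
    refine core hZ.reflect hY.reflect hX.reflect h2.reflect h1.reflect
      (emptyBox_reflect ((h2.emptyBox_iff hY hZ).1 e2))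
      (emptyBox_reflect ((h1.emptyBox_iff hX hY).1 e1)) (dvd_symm_sub hb) ?_
    change ((b' - b < d' - d ∧ ¬ (Λ.n : ℤ) ∣ (b' - b) - (d' - d)) ∨
        (d' - d < b' - b ∧ (Λ.n : ℤ) ∣ (b' - b) - (d' - d)))
    rw [dvd_sub_comm] at hcase
    by_cases hd : (Λ.n : ℤ) ∣ (b' - b) - (d' - d)
    · right; refine ⟨?_, hd⟩; by_contra hlt; exact hcase (Or.inr ⟨by omega, hd⟩)
    · left; refine ⟨?_, hd⟩; by_contra hlt; exact hcase (Or.inl ⟨by omega, hd⟩)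

/-- Every pair of consecutive empty rectangles that is not an annulus has an alternative. -/
theorem hasAlternative (hX : Λ.IsGen X) (hY : Λ.IsGen Y) (hZ : Λ.IsGen Z)
    (h1 : Λ.IsBox X Y a b a' b') (h2 : Λ.IsBox Y Z c d c' d') (e1 : EmptyBox X a b a' b')
    (e2 : EmptyBox Y c d c' d') (hne : ¬ ∀ s t, X s t ↔ Z s t) :
    HasAlternative Λ X Y Z a b a' b' c d c' d' := by
  -- The diagonal reflection turns `d = b'` (modulo `n`) into a coincidence of bottom circles, and
  -- the reflection in the vertical axis, which reverses the order, turns `d' = b` into `d = b'`.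
  have top_bot : ∀ {Λ : GridLattice} {X Y Z : ℤ → ℤ → Prop} {a b a' b' c d c' d' : ℤ}
      (_ : Λ.IsGen X) (_ : Λ.IsGen Y) (_ : Λ.IsGen Z) (_ : Λ.IsBox X Y a b a' b')
      (_ : Λ.IsBox Y Z c d c' d') (_ : EmptyBox X a b a' b') (_ : EmptyBox Y c d c' d')
      (_ : ¬ ∀ s t, X s t ↔ Z s t) (_ : (Λ.n : ℤ) ∣ d - b'),
      HasAlternative Λ X Y Z a b a' b' c d c' d' := by
    intro Λ X Y Z a b a' b' c d c' d' hX hY hZ h1 h2 e1 e2 hne hb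
    refine HasAlternative.transpose ?_ hX hY hZ h1 h2
    exact hasAlternative_of_bot_eq hX.transpose hY.transpose hZ.transpose (h1.transpose hX hY)
      (h2.transpose hY hZ) (emptyBox_transpose e1) (emptyBox_transpose e2)
      (fun h => hne fun s t => h t s) (Λ.dvd_fst (hY.row h1.ul h2.ll hb))
  have bot_top : ∀ {Λ : GridLattice} {X Y Z : ℤ → ℤ → Prop} {a b a' b' c d c' d' : ℤ}
      (_ : Λ.IsGen X) (_ : Λ.IsGen Y) (_ : Λ.IsGen Z) (_ : Λ.IsBox X Y a b a' b')
      (_ : Λ.IsBox Y Z c d c' d') (_ : EmptyBox X a b a' b') (_ : EmptyBox Y c d c' d')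
      (_ : ¬ ∀ s t, X s t ↔ Z s t) (_ : (Λ.n : ℤ) ∣ d' - b),
      HasAlternative Λ X Y Z a b a' b' c d c' d' := by
    intro Λ X Y Z a b a' b' c d c' d' hX hY hZ h1 h2 e1 e2 hne hb
    refine HasAlternative.reflect ?_ hX hZ
    exact top_bot hZ.reflect hY.reflect hX.reflect h2.reflect h1.reflect
      (emptyBox_reflect ((h2.emptyBox_iff hY hZ).1 e2))
      (emptyBox_reflect ((h1.emptyBox_iff hX hY).1 e1))
      (fun h => hne fun s t => by simpa using (h (-s) t).symm) (dvd_symm_sub hb)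
  by_cases n1 : (Λ.n : ℤ) ∣ d - b
  · exact hasAlternative_of_bot_eq hX hY hZ h1 h2 e1 e2 hne n1
  by_cases n2 : (Λ.n : ℤ) ∣ d - b'
  · exact top_bot hX hY hZ h1 h2 e1 e2 hne n2
  by_cases n3 : (Λ.n : ℤ) ∣ d' - b
  · exact bot_top hX hY hZ h1 h2 e1 e2 hne n3
  by_cases n4 : (Λ.n : ℤ) ∣ d' - b'
  · refine HasAlternative.transpose ?_ hX hY hZ h1 h2
    exact bot_top hX.transpose hY.transpose hZ.transpose (h1.transpose hX hY)
      (h2.transpose hY hZ) (emptyBox_transpose e1) (emptyBox_transpose e2)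
      (fun h => hne fun s t => h t s) (Λ.dvd_fst (hY.row h1.ul h2.ur n4))
  · exact hasAlternative_of_disjoint hX hY hZ h1 h2 e1 e2 n1 n2 n3 n4

/-- A pair of rectangles from a generator to itself covers a row or a column of squares. -/
theorem covers_row_or_col (hX : Λ.IsGen X) (hY : Λ.IsGen Y) (h1 : Λ.IsBox X Y a b a' b')
    (h2 : Λ.IsBox Y X c d c' d') :
    (∃ t, ∀ s, Λ.Covers a b a' b' s t ∨ Λ.Covers c d c' d' s t) ∨
      (∃ s, ∀ t, Λ.Covers a b a' b' s t ∨ Λ.Covers c d c' d' s t) := by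
  -- two rectangles with a common bottom circle cover the row above this circle
  have core : ∀ {Λ : GridLattice} {X Y : ℤ → ℤ → Prop} {a b a' b' c d c' d' : ℤ}
      (_ : Λ.IsGen X) (_ : Λ.IsGen Y) (_ : Λ.IsBox X Y a b a' b') (_ : Λ.IsBox Y X c d c' d')
      (_ : (Λ.n : ℤ) ∣ d - b), ∃ t, ∀ s, Λ.Covers a b a' b' s t ∨ Λ.Covers c d c' d' s t := by
    intro Λ X Y a b a' b' c d c' d' hX hY h1 h2 hb
    have m := hY.row h1.lr h2.ll hb
    have m2 := Λ.sub_mem (hX.row h1.ll h2.lr hb) m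
    have hN : (Λ.N : ℤ) ∣ (c' - a) - (c - a') := Λ.row.1 (mem_of_eq m2 rfl (by ring))
    have i1 := h1.hx
    have i2 := h1.hy
    have i3 := h2.hx
    have i4 := h2.hy
    have hle := Int.le_of_dvd (by omega) hN
    have hN0 : (0 : ℤ) < Λ.N := by exact_mod_cast Λ.N_pos
    refine ⟨b, fun s => ?_⟩
    have hdiv := Int.mul_ediv_add_emod (s - a) Λ.N
    have h0 := Int.emod_nonneg (s - a) hN0.ne'
    have hlt := Int.emod_lt_of_pos (s - a) hN0
    have mN : Λ.mem (-(Λ.N * ((s - a) / Λ.N))) 0 :=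
      Λ.row.2 ((dvd_neg).2 (Dvd.intro _ rfl))
    by_cases hs : (s - a) % Λ.N < a' - a
    · exact Or.inl ⟨_, _, mN, by omega, by omega, by omega, by omega⟩
    · exact Or.inr ⟨_, _, add_mem mN m, by omega, by omega, by omega, by omega⟩
  by_cases n1 : (Λ.n : ℤ) ∣ d - b
  · exact Or.inl (core hX hY h1 h2 n1)
  by_cases n2 : (Λ.n : ℤ) ∣ d - b'
  · right
    obtain ⟨t, ht⟩ := core hX.transpose hY.transpose (h1.transpose hX hY) (h2.transpose hY hX)
      (Λ.dvd_fst (hY.row h1.ul h2.ll n2))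
    refine ⟨t, fun s => ?_⟩
    rcases ht s with ⟨u, v, m, q⟩ | ⟨u, v, m, q⟩
    · exact Or.inl ⟨v, u, m, by tauto⟩
    · exact Or.inr ⟨v, u, m, by tauto⟩
  · have x1 := (h1.agree _ _ n1 n2).2 h2.ll
    exact absurd (Λ.dvd_fst (hX.row x1 h2.lr (by simp))) (h2.ndvd_width hY)

end GridLattice

/-! ### The dictionary between the torus and the plane -/

section Dictionary

variable {n p : ℕ} {q : ℤ}

/-- The lattice of periods of the twisted torus. -/
def torusLattice (n p : ℕ) [NeZero n] [NeZero p] {q : ℤ} (hpq : IsCoprime (p : ℤ) q) :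
    GridLattice where
  n := n
  N := n * p
  mem u v := ∃ k : ℤ, v = n * k ∧ u ≡ n * q * k [ZMOD (n * p : ℤ)]
  n_pos := Nat.pos_of_ne_zero (NeZero.ne n)
  N_pos := Nat.mul_pos (Nat.pos_of_ne_zero (NeZero.ne n)) (Nat.pos_of_ne_zero (NeZero.ne p))
  zero_mem := ⟨0, by simp, by simp [Int.ModEq.refl]⟩
  sub_mem := by
    rintro u v u' v' ⟨k, rfl, h⟩ ⟨k', rfl, h'⟩
    refine ⟨k - k', by ring, ?_⟩
    have := h.sub h'
    rwa [← mul_sub] at this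
  dvd_fst := by
    rintro u v ⟨k, rfl, h⟩
    have h1 := (h.of_dvd (Dvd.intro _ rfl : (n : ℤ) ∣ n * p)).dvd
    have h2 : (n : ℤ) ∣ n * q * k := ⟨q * k, by ring⟩
    exact (dvd_sub_right h2).1 h1
  dvd_snd := by
    rintro u v ⟨k, rfl, h⟩
    exact Dvd.intro _ rfl
  row := by
    have hn : (n : ℤ) ≠ 0 := by exact_mod_cast NeZero.ne n
    intro u
    constructor
    · rintro ⟨k, h0, h⟩
      have hk : k = 0 := by
        rcases mul_eq_zero.1 h0.symm with h | h
        · exact absurd h hn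
        · exact h
      subst hk
      rw [mul_zero] at h
      exact_mod_cast Int.modEq_zero_iff_dvd.1 h
    · intro h
      refine ⟨0, by simp, ?_⟩
      rw [mul_zero]
      exact Int.modEq_zero_iff_dvd.2 (by exact_mod_cast h)
  col := by
    have hn : (n : ℤ) ≠ 0 := by exact_mod_cast NeZero.ne n
    intro v
    constructor
    · rintro ⟨k, rfl, h⟩
      have h1 : (n * p : ℤ) ∣ n * q * k := by simpa using h.dvd
      rw [mul_assoc] at h1
      have h2 : (p : ℤ) ∣ q * k := Int.dvd_of_mul_dvd_mul_left hn h1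
      have h3 : (p : ℤ) ∣ k := hpq.dvd_of_dvd_mul_left h2
      push_cast
      exact mul_dvd_mul_left _ h3
    · rintro ⟨k, rfl⟩
      refine ⟨p * k, by push_cast; ring, ?_⟩
      refine (Int.modEq_zero_iff_dvd.2 ⟨q * k, by ring⟩).symm

theorem samePoint_iff [NeZero n] [NeZero p] (hpq : IsCoprime (p : ℤ) q) {s t s' t' : ℤ} :
    SamePoint n p q s t s' t' ↔ (torusLattice n p hpq).mem (s' - s) (t' - t) := by
  constructor
  · rintro ⟨k, h1, h2⟩
    refine ⟨k, by omega, ?_⟩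
    have := h2.sub (Int.ModEq.refl s)
    rwa [add_sub_cancel_left] at this
  · rintro ⟨k, h1, h2⟩
    refine ⟨k, by omega, ?_⟩
    have := h2.add (Int.ModEq.refl s)
    rwa [sub_add_cancel, add_comm] at this

/-- The horizontal circle at a given height. -/
def rowIndex (n : ℕ) [NeZero n] (t : ℤ) : Fin n :=
  ⟨(t % n).toNat, by
    have hn : (0 : ℤ) < n := by exact_mod_cast Nat.pos_of_ne_zero (NeZero.ne n)
    have h1 := Int.emod_nonneg t hn.ne'
    have h2 := Int.emod_lt_of_pos t hn
    omega⟩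

theorem rowIndex_coe [NeZero n] (t : ℤ) : ((rowIndex n t : ℕ) : ℤ) = t % n := by
  have hn : (0 : ℤ) < n := by exact_mod_cast Nat.pos_of_ne_zero (NeZero.ne n)
  exact Int.toNat_of_nonneg (Int.emod_nonneg t hn.ne')

theorem dvd_sub_rowIndex [NeZero n] (t : ℤ) : (n : ℤ) ∣ t - ((rowIndex n t : ℕ) : ℤ) := by
  rw [rowIndex_coe]; exact Int.dvd_self_sub_emod

theorem fin_eq_of_dvd {l m : Fin n} (h : (n : ℤ) ∣ ((l : ℕ) : ℤ) - ((m : ℕ) : ℤ)) : l = m := by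
  have := Int.natCast_modEq_iff.1 (Int.modEq_iff_dvd.2 h)
  exact (Fin.ext (Nat.ModEq.eq_of_lt_of_lt this m.2 l.2)).symm

theorem rowIndex_eq_iff [NeZero n] {t : ℤ} {l : Fin n} :
    rowIndex n t = l ↔ (n : ℤ) ∣ t - ((l : ℕ) : ℤ) := by
  constructor
  · rintro rfl
    exact dvd_sub_rowIndex t
  · intro h
    exact fin_eq_of_dvd (GridLattice.dvd_trans_sub
      (GridLattice.dvd_symm_sub (dvd_sub_rowIndex t)) h)

theorem rowIndex_eq_rowIndex_iff [NeZero n] {t t' : ℤ} :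
    rowIndex n t = rowIndex n t' ↔ (n : ℤ) ∣ t - t' := by
  rw [rowIndex_eq_iff]
  exact ⟨fun h => GridLattice.dvd_trans_sub h (GridLattice.dvd_symm_sub (dvd_sub_rowIndex t')),
    fun h => GridLattice.dvd_trans_sub h (dvd_sub_rowIndex t')⟩

theorem rowIndex_fin [NeZero n] (l : Fin n) : rowIndex n ((l : ℕ) : ℤ) = l :=
  rowIndex_eq_iff.2 (by simp)

theorem col_emod (x : Generator n p) (l : Fin n) : (n : ℤ) ∣ x.col l - ((x.1 l : ℕ) : ℤ) :=
  ⟨(x.2 l).val, by unfold Generator.col; ring⟩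

/-- The coordinates `σ l` and `a l` of a generator can be read off from its abscissa. -/
theorem eq_of_col_modEq [NeZero n] [NeZero p] {x : Generator n p} {l : Fin n} {j : Fin n}
    {e : ZMod p} {k : ℤ} (hk : (k : ZMod p) = e)
    (h : x.col l ≡ ((j : ℕ) : ℤ) + n * k [ZMOD (n * p : ℤ)]) : x.1 l = j ∧ x.2 l = e := by
  have hn : (n : ℤ) ≠ 0 := by exact_mod_cast NeZero.ne n
  have h1 : x.1 l = j := by
    have := (h.of_dvd (Dvd.intro _ rfl : (n : ℤ) ∣ n * p)).symm.dvd
    refine fin_eq_of_dvd ?_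
    rw [show (((x.1 l : Fin n) : ℕ) : ℤ) - ((j : ℕ) : ℤ) =
      (x.col l - (((j : ℕ) : ℤ) + n * k)) - (x.col l - ((x.1 l : ℕ) : ℤ)) + n * k by ring]
    exact dvd_add (dvd_sub this (col_emod x l)) (Dvd.intro _ rfl)
  refine ⟨h1, ?_⟩
  have h2 := h.symm.dvd
  unfold Generator.col at h2
  rw [h1, show ((j : ℕ) : ℤ) + n * ((x.2 l).val : ℤ) - (((j : ℕ) : ℤ) + n * k) =
    n * (((x.2 l).val : ℤ) - k) by ring] at h2
  have h3 : (p : ℤ) ∣ ((x.2 l).val : ℤ) - k := Int.dvd_of_mul_dvd_mul_left hn h2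
  have h4 := (ZMod.intCast_zmod_eq_zero_iff_dvd _ p).2 h3
  push_cast at h4
  rw [ZMod.natCast_zmod_val, sub_eq_zero] at h4
  rw [h4, hk]

theorem onLift_col (x : Generator n p) (l : Fin n) : x.OnLift q (x.col l) ((l : ℕ) : ℤ) :=
  ⟨l, 0, by simp, by simp [Int.ModEq.refl]⟩

theorem Rect.dvd_top {x y : Generator n p} (r : Rect q x y) :
    (n : ℤ) ∣ (((r.bot : ℕ) : ℤ) + r.height) - ((r.top : ℕ) : ℤ) := by
  obtain ⟨k, hk, -⟩ := r.upper_right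
  exact ⟨k, by omega⟩

theorem Rect.eq_of_eq {x y : Generator n p} {r s : Rect q x y} (hb : r.bot = s.bot) (hw : r.width = s.width)
    (hh : r.height = s.height) : r = s := by
  refine Rect.ext hb ?_ hw hh
  have h1 := r.dvd_top
  have h2 := s.dvd_top
  rw [hb, hh] at h1
  exact fin_eq_of_dvd (GridLattice.dvd_trans_sub (GridLattice.dvd_symm_sub h1) h2)

theorem sum_Ico_int (f : ℤ → ℕ) (a : ℤ) (w : ℕ) :
    ∑ s ∈ Finset.Ico a (a + w), f s = ∑ i ∈ Finset.range w, f (a + i) := by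
  refine Finset.sum_nbij' (fun s => (s - a).toNat) (fun i => a + i) ?_ ?_ ?_ ?_ ?_
  · intro s hs; simp only [Finset.mem_Ico, Finset.mem_range] at hs ⊢; omega
  · intro s hs; simp only [Finset.mem_Ico, Finset.mem_range] at hs ⊢; omega
  · intro s hs; simp only [Finset.mem_Ico] at hs; omega
  · intro s hs; omega
  · intro s hs; simp only [Finset.mem_Ico] at hs; congr 1; omega

open Classical in
/-- The indicator function of a square of the torus. -/
def squareIndicator (n p : ℕ) (q : ℤ) (c l : ℤ) (s t : ℤ) : ℕ :=
  if SamePoint n p q c l s t then 1 else 0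

theorem mult_eq_boxSum {x y : Generator n p} (r : Rect q x y) (c l : ℤ) :
    r.mult c l = boxSum (squareIndicator n p q c l) (x.col r.bot) ((r.bot : ℕ) : ℤ)
      (x.col r.bot + r.width) (((r.bot : ℕ) : ℤ) + r.height) := by
  unfold Rect.mult boxSum squareIndicator
  rw [Finset.card_filter, Finset.sum_product, sum_Ico_int]
  exact Finset.sum_congr rfl fun i _ => by rw [sum_Ico_int]

theorem isEmpty_iff {x y : Generator n p} (r : Rect q x y) :
    r.IsEmpty ↔ EmptyBox (fun s t => x.OnLift q s t) (x.col r.bot) ((r.bot : ℕ) : ℤ)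
      (x.col r.bot + r.width) (((r.bot : ℕ) : ℤ) + r.height) := by
  constructor
  · intro H s t hs p1 p2 p3 p4
    refine H (s - x.col r.bot).toNat (t - ((r.bot : ℕ) : ℤ)).toNat (by omega) (by omega) (by omega)
      (by omega) ?_
    convert hs using 1 <;> omega
  · intro H i j p1 p2 p3 p4 hs
    exact H _ _ hs (by omega) (by omega) (by omega) (by omega)

variable [NeZero n] [NeZero p] (hpq : IsCoprime (p : ℤ) q)

theorem torus_dvd_snd {u v : ℤ} (h : (torusLattice n p hpq).mem u v) : (n : ℤ) ∣ v :=
  (torusLattice n p hpq).dvd_snd h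

/-- A coordinate-free form of `OnLift`. -/
theorem onLift_iff {x : Generator n p} {s t : ℤ} :
    x.OnLift q s t ↔ (torusLattice n p hpq).mem (s - x.col (rowIndex n t))
      (t - ((rowIndex n t : ℕ) : ℤ)) := by
  constructor
  · rintro ⟨l, h⟩
    rw [samePoint_iff hpq] at h
    have := rowIndex_eq_iff.2 (torus_dvd_snd hpq h)
    rwa [this]
  · intro h
    exact ⟨_, (samePoint_iff hpq).2 h⟩

/-- The points of the plane above the components of a generator form a generator of the plane. -/
theorem isGen_onLift (x : Generator n p) :
    (torusLattice n p hpq).IsGen fun s t => x.OnLift q s t where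
  trans := by
    rintro s t u v ⟨l, h⟩ m
    refine ⟨l, ?_⟩
    rw [samePoint_iff hpq] at h ⊢
    exact GridLattice.mem_of_eq (GridLattice.add_mem h m) (by ring) (by ring)
  row := by
    rintro s t s' t' h h' hd
    rw [onLift_iff hpq] at h h'
    have hd' : (n : ℤ) ∣ t' - t := hd
    rw [rowIndex_eq_rowIndex_iff.2 hd'] at h'
    exact GridLattice.mem_of_eq (GridLattice.sub_mem _ h' h) (by ring) (by ring)
  col := by
    rintro s t s' t' h h' hd
    rw [onLift_iff hpq] at h h'
    have h1 : (n : ℤ) ∣ _ := (torusLattice n p hpq).dvd_fst h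
    have h2 : (n : ℤ) ∣ _ := (torusLattice n p hpq).dvd_fst h'
    have hd' : (n : ℤ) ∣ s' - s := hd
    have h3 := col_emod x (rowIndex n t)
    have h4 := col_emod x (rowIndex n t')
    have h5 : x.1 (rowIndex n t') = x.1 (rowIndex n t) := by
      refine fin_eq_of_dvd ?_
      have := dvd_add (dvd_sub (dvd_sub (dvd_sub hd' h2) h4) (dvd_neg.2 h1)) h3
      ring_nf at this ⊢
      exact this
    rw [x.1.injective h5] at h'
    exact GridLattice.mem_of_eq (GridLattice.sub_mem _ h' h) (by ring) (by ring)
  exRow := by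
    intro t
    refine ⟨x.col (rowIndex n t) + q * (t - ((rowIndex n t : ℕ) : ℤ)), ?_⟩
    rw [onLift_iff hpq]
    obtain ⟨k, hk⟩ := dvd_sub_rowIndex (n := n) t
    refine ⟨k, hk, ?_⟩
    rw [hk, add_sub_cancel_left]
    exact Int.modEq_iff_dvd.2 ⟨0, by ring⟩
  exCol := by
    intro s
    obtain ⟨l, hl⟩ : ∃ l, x.1 l = rowIndex n s := x.1.surjective _
    have h1 := dvd_sub_rowIndex (n := n) s
    rw [← hl] at h1
    have h2 := dvd_sub h1 (col_emod x l)
    rw [sub_sub_sub_cancel_right] at h2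
    obtain ⟨k, hk⟩ := h2
    obtain ⟨α, β, hαβ⟩ := hpq
    refine ⟨((l : ℕ) : ℤ) + n * (β * k), l, β * k, rfl, ?_⟩
    refine Int.modEq_iff_dvd.2 ⟨-(α * k), ?_⟩
    have : s = x.col l + n * k := by omega
    rw [this]
    linear_combination (n * k : ℤ) * hαβ

theorem generator_eq_of_onLift (hpq : IsCoprime (p : ℤ) q) {x y : Generator n p}
    (h : ∀ s t, x.OnLift q s t ↔ y.OnLift q s t) : x = y := by
  have key : ∀ l, x.1 l = y.1 l ∧ x.2 l = y.2 l := by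
    intro l
    have h1 := (h _ _).1 (onLift_col x l)
    rw [onLift_iff hpq, rowIndex_fin, sub_self] at h1
    have h2 := (torusLattice n p hpq).row.1 h1
    refine eq_of_col_modEq (k := (y.2 l).val) (by simp) ?_
    refine (Int.modEq_iff_dvd.2 ?_).symm
    have : ((torusLattice n p hpq).N : ℤ) = n * p := by simp [torusLattice]
    rwa [this] at h2
  exact Prod.ext (Equiv.ext fun l => (key l).1) (funext fun l => (key l).2)

/-- Every generator of the plane comes from a generator of the twisted grid. -/
theorem exists_generator {Y : ℤ → ℤ → Prop} (hY : (torusLattice n p hpq).IsGen Y) :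
    ∃ y : Generator n p, (fun s t => y.OnLift q s t) = Y := by
  choose f hf using fun l : Fin n => hY.exRow ((l : ℕ) : ℤ)
  have inj : Function.Injective fun l => rowIndex n (f l) := by
    intro l m h
    have hd : (n : ℤ) ∣ f l - f m := rowIndex_eq_rowIndex_iff.1 h
    exact fin_eq_of_dvd ((torusLattice n p hpq).dvd_snd (hY.col (hf m) (hf l) hd))
  let σ : Equiv.Perm (Fin n) := Equiv.ofBijective _ (Finite.injective_iff_bijective.1 inj)
  let y : Generator n p := (σ, fun l => ((f l / n : ℤ) : ZMod p))
  have hcol : ∀ l, (torusLattice n p hpq).mem (f l - y.col l) 0 := by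
    intro l
    have e : y.col l = f l % n + n * (f l / n % p) := by
      unfold Generator.col
      congr 1
      · exact rowIndex_coe _
      · rw [ZMod.val_intCast]
    rw [(torusLattice n p hpq).row, e]
    have h1 := Int.mul_ediv_add_emod (f l) n
    have h2 := Int.mul_ediv_add_emod (f l / n) p
    refine ⟨f l / n / p, ?_⟩
    simp only [torusLattice]
    push_cast
    linear_combination -h1 - n * h2
  have hyY : ∀ l : Fin n, Y (y.col l) ((l : ℕ) : ℤ) := fun l =>
    hY.trans' (hf l) (GridLattice.mem_of_eq (GridLattice.neg_mem (hcol l)) (by ring) (by ring))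
  refine ⟨y, ?_⟩
  funext s t
  have hr : (n : ℤ) ∣ t - ((rowIndex n t : ℕ) : ℤ) := dvd_sub_rowIndex t
  exact propext ((isGen_onLift hpq y).iff_of_row hY (onLift_col y _) (hyY _) hr)

namespace Rect

variable {x y : Generator n p}

/-- The standard lift of a rectangle. -/
theorem isBox (r : Rect q x y) :
    (torusLattice n p hpq).IsBox (fun s t => x.OnLift q s t) (fun s t => y.OnLift q s t)
      (x.col r.bot) ((r.bot : ℕ) : ℤ) (x.col r.bot + r.width) (((r.bot : ℕ) : ℤ) + r.height) where
  hx := by have := r.width_pos; omega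
  hy := by have := r.height_pos; omega
  ll := onLift_col x r.bot
  ur := ⟨r.top, r.upper_right⟩
  lr := ⟨r.bot, r.lower_right⟩
  ul := ⟨r.top, r.upper_left⟩
  ndvd := by
    intro h
    rw [add_sub_cancel_left] at h
    have h2 := r.dvd_top
    rw [add_comm, add_sub_assoc] at h2
    exact r.bot_ne_top (fin_eq_of_dvd ((dvd_add_right h).1 h2))
  emb := by
    intro u v m h1 h2 h3 h4
    rw [add_sub_cancel_left] at *
    have key : ∀ {i i' j j' : ℤ}, i' - i = u → j' - j = v → 0 ≤ i → 0 ≤ j → 0 ≤ i' → 0 ≤ j' →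
        i < r.width → j < r.height → i' < r.width → j' < r.height → u = 0 ∧ v = 0 := by
      intro i i' j j' hu hv p1 p2 p3 p4 p5 p6 p7 p8
      lift i to ℕ using p1
      lift j to ℕ using p2
      lift i' to ℕ using p3
      lift j' to ℕ using p4
      have := r.embedded i j i' j' (by omega) (by omega) (by omega) (by omega)
        ((samePoint_iff hpq).2 (GridLattice.mem_of_eq m (by omega) (by omega)))
      omega
    refine key (i := max (-u) 0) (i' := max u 0) (j := max (-v) 0) (j' := max v 0)
      ?_ ?_ ?_ ?_ ?_ ?_ ?_ ?_ ?_ ?_ <;> omega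
  agree := by
    intro s t hb ht
    have e : rowIndex n t ≠ r.bot := fun h => hb ((rowIndex_eq_iff (n := n)).1 h)
    have e' : rowIndex n t ≠ r.top := fun h =>
      ht (GridLattice.dvd_trans_sub ((rowIndex_eq_iff (n := n)).1 h) (GridLattice.dvd_symm_sub r.dvd_top))
    obtain ⟨h1, h2⟩ := r.agree _ e e'
    have : x.col (rowIndex n t) = y.col (rowIndex n t) := by
      unfold Generator.col
      rw [h1, h2]
    simp only [onLift_iff hpq, this]

/-- The rectangle of the torus below a box of the plane. -/
def ofBox {a b a' b' : ℤ} (h : (torusLattice n p hpq).IsBox (fun s t => x.OnLift q s t)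
    (fun s t => y.OnLift q s t) a b a' b') : Rect q x y where
  bot := rowIndex n b
  top := rowIndex n b'
  width := (a' - a).toNat
  height := (b' - b).toNat
  bot_ne_top := fun e => h.ndvd (GridLattice.dvd_symm_sub ((rowIndex_eq_rowIndex_iff (n := n)).1 e))
  width_pos := by have := h.hx; omega
  width_lt := by
    have nw : ¬ (n : ℤ) ∣ a' - a := h.ndvd_width (isGen_onLift hpq x)
    have hN := (torusLattice n p hpq).row.2 (dvd_refl _)
    have hpos : 0 < n * p := (torusLattice n p hpq).N_pos
    change (torusLattice n p hpq).mem ((n * p : ℕ) : ℤ) 0 at hN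
    have hx := h.hx
    have hy := h.hy
    by_contra hlt
    by_cases he : a' - a = ((n * p : ℕ) : ℤ)
    · rw [he] at nw
      exact nw ⟨p, by push_cast; ring⟩
    · have := h.emb _ _ hN (by omega) (by omega) (by omega) (by omega)
      omega
  height_pos := by have := h.hy; omega
  height_lt := by
    have nh : ¬ (n : ℤ) ∣ b' - b := h.ndvd
    have hN := (torusLattice n p hpq).col.2 (dvd_refl _)
    have hpos : 0 < n * p := (torusLattice n p hpq).N_pos
    change (torusLattice n p hpq).mem 0 ((n * p : ℕ) : ℤ) at hN
    have hx := h.hx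
    have hy := h.hy
    by_contra hlt
    by_cases he : b' - b = ((n * p : ℕ) : ℤ)
    · rw [he] at nh
      exact nh ⟨p, by push_cast; ring⟩
    · have := h.emb _ _ hN (by omega) (by omega) (by omega) (by omega)
      omega
  upper_right := by
    have h1 := (onLift_iff hpq).1 h.ll
    have h2 := (onLift_iff hpq).1 h.ur
    have hx := h.hx
    have hy := h.hy
    exact (samePoint_iff hpq).2 (GridLattice.mem_of_eq (GridLattice.sub_mem _ h2 h1)
      (by omega) (by omega))
  lower_right := by
    have h1 := (onLift_iff hpq).1 h.ll
    have h2 := (onLift_iff hpq).1 h.lr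
    have hx := h.hx
    have hy := h.hy
    exact (samePoint_iff hpq).2 (GridLattice.mem_of_eq (GridLattice.sub_mem _ h2 h1)
      (by omega) (by omega))
  upper_left := by
    have h1 := (onLift_iff hpq).1 h.ll
    have h2 := (onLift_iff hpq).1 h.ul
    have hx := h.hx
    have hy := h.hy
    exact (samePoint_iff hpq).2 (GridLattice.mem_of_eq (GridLattice.sub_mem _ h2 h1)
      (by omega) (by omega))
  agree := by
    intro l hl hl'
    have h1 := (h.agree (x.col l) ((l : ℕ) : ℤ)
      (fun hd => hl ((rowIndex_eq_iff (n := n)).2 (GridLattice.dvd_symm_sub hd)).symm)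
      (fun hd => hl' ((rowIndex_eq_iff (n := n)).2 (GridLattice.dvd_symm_sub hd)).symm)).1 (onLift_col x l)
    rw [onLift_iff hpq, rowIndex_fin, sub_self] at h1
    have h2 := (torusLattice n p hpq).row.1 h1
    refine eq_of_col_modEq (k := (y.2 l).val) (by simp) ?_
    refine (Int.modEq_iff_dvd.2 ?_).symm
    have : ((torusLattice n p hpq).N : ℤ) = n * p := by simp [torusLattice]
    rwa [this] at h2
  embedded := by
    intro i j i' j' hi hj hi' hj' hs
    have := h.emb _ _ ((samePoint_iff hpq).1 hs) (by omega) (by omega) (by omega) (by omega)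
    omega

end Rect

theorem squareIndicator_periodic (c l : ℤ) :
    (torusLattice n p hpq).Periodic (squareIndicator n p q c l) := by
  intro s t u v m
  have : SamePoint n p q c l (s + u) (t + v) ↔ SamePoint n p q c l s t := by
    rw [samePoint_iff hpq, samePoint_iff hpq]
    constructor
    · intro h; exact GridLattice.mem_of_eq (GridLattice.sub_mem _ h m) (by ring) (by ring)
    · intro h; exact GridLattice.mem_of_eq (GridLattice.add_mem h m) (by ring) (by ring)
  by_cases hS : SamePoint n p q c l s t <;> simp [squareIndicator, this, hS]

variable {x y : Generator n p}

variable {a b a' b' : ℤ} (h : (torusLattice n p hpq).IsBox (fun s t => x.OnLift q s t)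
    (fun s t => y.OnLift q s t) a b a' b')

theorem ofBox_mem (h : (torusLattice n p hpq).IsBox (fun s t => x.OnLift q s t)
    (fun s t => y.OnLift q s t) a b a' b') : (torusLattice n p hpq).mem (x.col (rowIndex n b) - a)
    (((rowIndex n b : ℕ) : ℤ) - b) :=
  GridLattice.mem_of_eq (GridLattice.neg_mem ((onLift_iff hpq).1 h.ll)) (by ring) (by ring)

theorem mult_ofBox (c l : ℤ) :
    (Rect.ofBox hpq h).mult c l = boxSum (squareIndicator n p q c l) a b a' b' := by
  rw [mult_eq_boxSum, ← boxSum_translate (squareIndicator_periodic hpq c l) (ofBox_mem hpq h) a b a' b']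
  have h1 := h.hx
  have h2 := h.hy
  simp only [Rect.ofBox]
  congr 1 <;> omega

theorem isEmpty_ofBox_iff :
    (Rect.ofBox hpq h).IsEmpty ↔ EmptyBox (fun s t => x.OnLift q s t) a b a' b' := by
  have h1 := h.hx
  have h2 := h.hy
  have m := ofBox_mem hpq h
  rw [isEmpty_iff]
  simp only [Rect.ofBox]
  constructor
  · intro H s t hs p1 p2 p3 p4
    exact H _ _ ((isGen_onLift hpq x).trans hs m) (by omega) (by omega) (by omega) (by omega)
  · intro H s t hs p1 p2 p3 p4
    exact H _ _ ((isGen_onLift hpq x).trans hs (GridLattice.neg_mem m)) (by omega) (by omega)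
      (by omega) (by omega)

theorem mult_ne_zero_of_covers (r : Rect q x y) {s t : ℤ}
    (H : (torusLattice n p hpq).Covers (x.col r.bot) ((r.bot : ℕ) : ℤ)
      (x.col r.bot + r.width) (((r.bot : ℕ) : ℤ) + r.height) s t) : r.mult s t ≠ 0 := by
  obtain ⟨u, v, m, p1, p2, p3, p4⟩ := H
  rw [mult_eq_boxSum, boxSum_eq_sum_product]
  intro h0
  have := (Finset.sum_eq_zero_iff.1 h0) (s + u, t + v) (by simp; omega)
  have hs : SamePoint n p q s t (s + u) (t + v) :=
    (samePoint_iff hpq).2 (GridLattice.mem_of_eq m (by ring) (by ring))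
  simp [squareIndicator, hs] at this

end Dictionary

/-! ### Rectangles and permutations -/

section RectPerm

variable {n p : ℕ} {q : ℤ} [NeZero n] [NeZero p]

theorem fst_rowIndex {x : Generator n p} {s t : ℤ} (h : x.OnLift q s t) :
    x.1 (rowIndex n t) = rowIndex n s := by
  obtain ⟨l, k, h1, h2⟩ := h
  have e : rowIndex n t = l := rowIndex_eq_iff.2 ⟨k, by omega⟩
  rw [e]
  refine (rowIndex_eq_iff.2 ?_).symm
  have h3 := (h2.of_dvd (Dvd.intro _ rfl : (n : ℤ) ∣ n * p)).symm.dvd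
  have h4 := dvd_add (dvd_add h3 (⟨q * k, by ring⟩ : (n : ℤ) ∣ n * q * k)) (col_emod x l)
  ring_nf at h4 ⊢
  exact h4

variable {x y : Generator n p}

theorem Rect.rowIndex_bot (r : Rect q x y) : rowIndex n ((r.bot : ℕ) : ℤ) = r.bot :=
  rowIndex_fin _

theorem Rect.rowIndex_top (r : Rect q x y) :
    rowIndex n (((r.bot : ℕ) : ℤ) + r.height) = r.top := rowIndex_eq_iff.2 r.dvd_top

theorem Rect.fst_bot (r : Rect q x y) : y.1 r.bot = x.1 r.top := by
  have h1 := fst_rowIndex (q := q) (x := y) ⟨r.bot, r.lower_right⟩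
  have h2 := fst_rowIndex (q := q) (x := x) ⟨r.top, r.upper_right⟩
  rw [r.rowIndex_bot] at h1
  rw [r.rowIndex_top] at h2
  rw [h1, h2]

theorem Rect.fst_top (r : Rect q x y) : y.1 r.top = x.1 r.bot := by
  have h1 := fst_rowIndex (q := q) (x := y) ⟨r.top, r.upper_left⟩
  have h2 := fst_rowIndex (q := q) (onLift_col x r.bot)
  rw [r.rowIndex_bot] at h2
  rw [r.rowIndex_top] at h1
  rw [h1, h2]

theorem Rect.perm_eq (r : Rect q x y) : y.1 = x.1 * Equiv.swap r.bot r.top := by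
  ext l : 1
  rw [Equiv.Perm.mul_apply]
  by_cases h1 : l = r.bot
  · rw [h1, Equiv.swap_apply_left, r.fst_bot]
  by_cases h2 : l = r.top
  · rw [h2, Equiv.swap_apply_right, r.fst_top]
  rw [Equiv.swap_apply_of_ne_of_ne h1 h2]
  exact (r.agree l h1 h2).1.symm

/-- Two rectangles from the same generator with the same corner and the same size end in the same
generator. -/
theorem Rect.target_eq {y' : Generator n p} (hpq : IsCoprime (p : ℤ) q) {r : Rect q x y}
    {s : Rect q x y'} (hb : r.bot = s.bot) (hw : r.width = s.width) (hh : r.height = s.height) :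
    y = y' := by
  refine generator_eq_of_onLift hpq fun a t => ?_
  have h1 := r.isBox hpq
  have h2 := s.isBox hpq
  rw [← hb, ← hw, ← hh] at h2
  by_cases k1 : (n : ℤ) ∣ t - ((r.bot : ℕ) : ℤ)
  · exact (isGen_onLift hpq y).iff_of_row (isGen_onLift hpq y') h1.lr h2.lr k1
  by_cases k2 : (n : ℤ) ∣ t - (((r.bot : ℕ) : ℤ) + r.height)
  · exact (isGen_onLift hpq y).iff_of_row (isGen_onLift hpq y') h1.ul h2.ul k2
  · rw [← h1.agree a t k1 k2, ← h2.agree a t k1 k2]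

/-- The height of a rectangle is determined by its corner and its width. -/
theorem Rect.height_eq {y' : Generator n p} (hpq : IsCoprime (p : ℤ) q) {r : Rect q x y}
    {s : Rect q x y'} (hb : r.bot = s.bot) (hw : r.width = s.width) : r.height = s.height := by
  have h1 := (r.isBox hpq).ur
  have h2 := (s.isBox hpq).ur
  rw [← hb, ← hw] at h2
  have h3 := (isGen_onLift hpq x).col h1 h2 (by simp)
  rw [sub_self, add_sub_add_left_eq_sub] at h3
  have h4 : ((n * p : ℕ) : ℤ) ∣ _ := (torusLattice n p hpq).col.1 h3
  have := r.height_lt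
  have := s.height_lt
  have := Int.eq_zero_of_abs_lt_dvd h4 (by rw [abs_lt]; constructor <;> omega)
  omega

/-- The width of a rectangle is determined by its corner and its height. -/
theorem Rect.width_eq {y' : Generator n p} (hpq : IsCoprime (p : ℤ) q) {r : Rect q x y}
    {s : Rect q x y'} (hb : r.bot = s.bot) (hh : r.height = s.height) : r.width = s.width := by
  have h1 := (r.isBox hpq).ur
  have h2 := (s.isBox hpq).ur
  rw [← hb, ← hh] at h2
  have h3 := (isGen_onLift hpq x).row h1 h2 (by simp)
  rw [sub_self, add_sub_add_left_eq_sub] at h3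
  have h4 : ((n * p : ℕ) : ℤ) ∣ _ := (torusLattice n p hpq).row.1 h3
  have := r.width_lt
  have := s.width_lt
  have := Int.eq_zero_of_abs_lt_dvd h4 (by rw [abs_lt]; constructor <;> omega)
  omega

/-- The product of the transpositions of the horizontal circles of a concatenation. -/
theorem Concat.swap_mul_swap {z : Generator n p} (P : Concat q x z) :
    Equiv.swap P.fst.bot P.fst.top * Equiv.swap P.snd.bot P.snd.top = x.1⁻¹ * z.1 := by
  rw [P.snd.perm_eq, P.fst.perm_eq]
  group

/-- The product of the transpositions of the vertical circles of a concatenation. -/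
theorem Concat.swap_mul_swap_col {z : Generator n p} (P : Concat q x z) :
    Equiv.swap (x.1 P.fst.bot) (x.1 P.fst.top) *
      Equiv.swap (P.mid.1 P.snd.bot) (P.mid.1 P.snd.top) = x.1 * z.1⁻¹ := by
  have h : ∀ (σ : Equiv.Perm (Fin n)) (i j : Fin n),
      Equiv.swap (σ i) (σ j) = σ * Equiv.swap i j * σ⁻¹ := fun σ i j => Equiv.swap_apply_apply σ i j
  rw [h, h, P.snd.perm_eq, P.fst.perm_eq]
  simp [mul_assoc]

end RectPerm

/-! ### Row and column totals of a domain -/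

namespace GridLattice

variable {Λ : GridLattice} {X : ℤ → ℤ → Prop}

open Classical in
/-- Every square of the plane lies over exactly one of the `N` squares of its row. -/
theorem IsGen.sum_row (hX : Λ.IsGen X) (l s t : ℤ) :
    ∑ c ∈ Finset.range Λ.N, (if Λ.mem (s - c) (t - l) then 1 else 0 : ℤ) =
      if (Λ.n : ℤ) ∣ t - l then 1 else 0 := by
  have hN0 : (0 : ℤ) < (Λ.N : ℤ) := by exact_mod_cast Λ.N_pos
  split_ifs with h
  · obtain ⟨s₁, h₁⟩ := hX.exRow l
    obtain ⟨s₂, h₂⟩ := hX.exRow t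
    have m := hX.row h₁ h₂ h
    have h0 := Int.emod_nonneg (s - (s₂ - s₁)) hN0.ne'
    have h1 := Int.emod_lt_of_pos (s - (s₂ - s₁)) hN0
    have key : ∀ c : ℕ, c < Λ.N →
        (Λ.mem (s - c) (t - l) ↔ c = ((s - (s₂ - s₁)) % (Λ.N : ℤ)).toNat) := by
      intro c hc
      have e1 : Λ.mem (s - c) (t - l) ↔ (Λ.N : ℤ) ∣ (s - (s₂ - s₁)) - c := by
        rw [← Λ.row]
        exact ⟨fun hm => mem_of_eq (Λ.sub_mem hm m) (by ring) (by ring),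
          fun hm => mem_of_eq (add_mem hm m) (by ring) (by ring)⟩
      rw [e1, ← Int.modEq_iff_dvd, Int.ModEq,
        Int.emod_eq_of_lt (by omega) (by omega : (c : ℤ) < Λ.N)]
      omega
    rw [Finset.sum_eq_single ((s - (s₂ - s₁)) % (Λ.N : ℤ)).toNat]
    · exact if_pos ((key ((s - (s₂ - s₁)) % (Λ.N : ℤ)).toNat (by omega)).2 rfl)
    · intro c hc hne
      exact if_neg fun h => hne ((key c (Finset.mem_range.1 hc)).1 h)
    · intro hnot
      exact absurd (Finset.mem_range.2 (by omega)) hnot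
  · exact Finset.sum_eq_zero fun c _ => if_neg fun hs => h (Λ.dvd_snd hs)

end GridLattice

section Totals

variable {n p : ℕ} {q : ℤ} [NeZero n] [NeZero p] {x y : Generator n p}

theorem delta_rowIndex (t : ℤ) (l : Fin n) :
    (if (n : ℤ) ∣ t - ((l : ℕ) : ℤ) then 1 else 0 : ℤ) = delta (rowIndex n t) l :=
  if_congr rowIndex_eq_iff.symm rfl rfl

open Classical in
theorem Rect.mult_eq_sum (hpq : IsCoprime (p : ℤ) q) (r : Rect q x y) (c l : ℤ) :
    (r.mult c l : ℤ) = ∑ i ∈ Finset.range r.width, ∑ j ∈ Finset.range r.height,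
      if (torusLattice n p hpq).mem (x.col r.bot + i - c) (((r.bot : ℕ) : ℤ) + j - l)
        then 1 else 0 := by
  unfold Rect.mult
  rw [Finset.card_filter, Finset.sum_product]
  push_cast
  simp only [samePoint_iff hpq]

theorem Rect.sum_mult_row (hpq : IsCoprime (p : ℤ) q) (r : Rect q x y) (l : ℤ) :
    ∑ c ∈ Finset.range (n * p), (r.mult c l : ℤ) =
      r.width * ∑ j ∈ Finset.range r.height,
        if (n : ℤ) ∣ ((r.bot : ℕ) : ℤ) + j - l then 1 else 0 := by
  classical
  simp only [r.mult_eq_sum hpq]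
  rw [Finset.sum_comm]
  have h : ∀ i ∈ Finset.range r.width, (∑ c ∈ Finset.range (n * p), ∑ j ∈ Finset.range r.height,
      (if (torusLattice n p hpq).mem (x.col r.bot + i - c) (((r.bot : ℕ) : ℤ) + j - l)
        then 1 else 0 : ℤ)) = ∑ j ∈ Finset.range r.height,
        if (n : ℤ) ∣ ((r.bot : ℕ) : ℤ) + j - l then 1 else 0 := by
    intro i _
    rw [Finset.sum_comm]
    exact Finset.sum_congr rfl fun j _ => (isGen_onLift hpq x).sum_row l _ _
  rw [Finset.sum_congr rfl h, Finset.sum_const, Finset.card_range, nsmul_eq_mul]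

theorem Rect.sum_mult_col (hpq : IsCoprime (p : ℤ) q) (r : Rect q x y) (c : ℤ) :
    ∑ l ∈ Finset.range (n * p), (r.mult c l : ℤ) =
      r.height * ∑ i ∈ Finset.range r.width,
        if (n : ℤ) ∣ x.col r.bot + i - c then 1 else 0 := by
  classical
  simp only [r.mult_eq_sum hpq]
  rw [Finset.sum_comm]
  have h : ∀ i ∈ Finset.range r.width, (∑ l ∈ Finset.range (n * p), ∑ j ∈ Finset.range r.height,
      (if (torusLattice n p hpq).mem (x.col r.bot + i - c) (((r.bot : ℕ) : ℤ) + j - l)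
        then 1 else 0 : ℤ)) = r.height * (if (n : ℤ) ∣ x.col r.bot + i - c then 1 else 0) := by
    intro i _
    rw [Finset.sum_comm]
    have key : ∀ j : ℕ, (∑ l ∈ Finset.range (n * p),
        (if (torusLattice n p hpq).mem (x.col r.bot + i - c) (((r.bot : ℕ) : ℤ) + j - l)
          then 1 else 0 : ℤ)) = if (n : ℤ) ∣ x.col r.bot + i - c then 1 else 0 := fun j =>
      (isGen_onLift hpq x).transpose.sum_row c (((r.bot : ℕ) : ℤ) + j) (x.col r.bot + i)
    simp only [key, Finset.sum_const, Finset.card_range, nsmul_eq_mul]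
  rw [Finset.sum_congr rfl h, Finset.mul_sum]

theorem sum_range_dvd_sub (a l : ℤ) (k : ℕ) :
    (∑ j ∈ Finset.range k, if (n : ℤ) ∣ a + j - l then 1 else 0 : ℤ) -
      (∑ j ∈ Finset.range k, if (n : ℤ) ∣ a + j - (l - 1) then 1 else 0) =
      (if (n : ℤ) ∣ a - l then 1 else 0) - if (n : ℤ) ∣ a + k - l then 1 else 0 := by
  rw [← Finset.sum_sub_distrib]
  have := Finset.sum_range_sub' (fun j : ℕ => (if (n : ℤ) ∣ a + j - l then 1 else 0 : ℤ)) k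
  simp only [Nat.cast_zero, add_zero] at this
  rw [← this]
  refine Finset.sum_congr rfl fun j _ => ?_
  rw [show a + (j : ℤ) - (l - 1) = a + ((j + 1 : ℕ) : ℤ) - l by push_cast; ring]

/-- The jump of the number of squares of a rectangle between two consecutive rows. -/
theorem Rect.sum_mult_row_sub (hpq : IsCoprime (p : ℤ) q) (r : Rect q x y) (l : Fin n) :
    ∑ c ∈ Finset.range (n * p), (r.mult c ((l : ℕ) : ℤ) : ℤ) -
      ∑ c ∈ Finset.range (n * p), (r.mult c (((l : ℕ) : ℤ) - 1) : ℤ) =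
      r.width * (delta r.bot l - delta r.top l) := by
  rw [r.sum_mult_row hpq, r.sum_mult_row hpq, ← mul_sub, sum_range_dvd_sub, delta_rowIndex,
    delta_rowIndex, r.rowIndex_top, r.rowIndex_bot]

/-- The jump of the number of squares of a rectangle between two consecutive columns. -/
theorem Rect.sum_mult_col_sub (hpq : IsCoprime (p : ℤ) q) (r : Rect q x y) (c : Fin n) :
    ∑ l ∈ Finset.range (n * p), (r.mult ((c : ℕ) : ℤ) l : ℤ) -
      ∑ l ∈ Finset.range (n * p), (r.mult (((c : ℕ) : ℤ) - 1) l : ℤ) =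
      r.height * (delta (x.1 r.bot) c - delta (x.1 r.top) c) := by
  have h1 := fst_rowIndex (q := q) (onLift_col x r.bot)
  have h2 := fst_rowIndex (q := q) (x := y) ⟨r.bot, r.lower_right⟩
  rw [r.rowIndex_bot] at h1 h2
  rw [r.sum_mult_col hpq, r.sum_mult_col hpq, ← mul_sub, sum_range_dvd_sub, delta_rowIndex,
    delta_rowIndex, ← h1, ← h2, r.fst_bot]

/-- The row totals of a domain determine its horizontal edges, with their lengths. -/
theorem Concat.row_sum_eq (hpq : IsCoprime (p : ℤ) q) {z : Generator n p} {P Q : Concat q x z}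
    (h : P.domain = Q.domain) (l : Fin n) :
    P.fst.width * (delta P.fst.bot l - delta P.fst.top l) +
      P.snd.width * (delta P.snd.bot l - delta P.snd.top l) =
    Q.fst.width * (delta Q.fst.bot l - delta Q.fst.top l) +
      Q.snd.width * (delta Q.snd.bot l - delta Q.snd.top l) := by
  have h' : ∀ c l : ℤ, (P.fst.mult c l + P.snd.mult c l : ℤ) = Q.fst.mult c l + Q.snd.mult c l :=
    fun c l => by have := congr_fun (congr_fun h c) l; unfold Concat.domain at this; omega
  rw [← Rect.sum_mult_row_sub hpq, ← Rect.sum_mult_row_sub hpq, ← Rect.sum_mult_row_sub hpq,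
    ← Rect.sum_mult_row_sub hpq, sub_add_sub_comm, sub_add_sub_comm, ← Finset.sum_add_distrib,
    ← Finset.sum_add_distrib, ← Finset.sum_add_distrib, ← Finset.sum_add_distrib]
  simp only [h']

/-- The column totals of a domain determine its vertical edges, with their lengths. -/
theorem Concat.col_sum_eq (hpq : IsCoprime (p : ℤ) q) {z : Generator n p} {P Q : Concat q x z}
    (h : P.domain = Q.domain) (c : Fin n) :
    P.fst.height * (delta (x.1 P.fst.bot) c - delta (x.1 P.fst.top) c) +
      P.snd.height * (delta (P.mid.1 P.snd.bot) c - delta (P.mid.1 P.snd.top) c) =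
    Q.fst.height * (delta (x.1 Q.fst.bot) c - delta (x.1 Q.fst.top) c) +
      Q.snd.height * (delta (Q.mid.1 Q.snd.bot) c - delta (Q.mid.1 Q.snd.top) c) := by
  have h' : ∀ c l : ℤ, (P.fst.mult c l + P.snd.mult c l : ℤ) = Q.fst.mult c l + Q.snd.mult c l :=
    fun c l => by have := congr_fun (congr_fun h c) l; unfold Concat.domain at this; omega
  rw [← Rect.sum_mult_col_sub hpq, ← Rect.sum_mult_col_sub hpq, ← Rect.sum_mult_col_sub hpq,
    ← Rect.sum_mult_col_sub hpq, sub_add_sub_comm, sub_add_sub_comm, ← Finset.sum_add_distrib,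
    ← Finset.sum_add_distrib, ← Finset.sum_add_distrib, ← Finset.sum_add_distrib]
  simp only [h']

end Totals

/-! ### Sections induce sign assignments -/

section Edges

variable {ι : Type*} [DecidableEq ι] {b₁ t₁ b₂ t₂ b₃ t₃ b₄ t₄ : ι} {w₁ w₂ w₃ w₄ : ℤ}

theorem delta_self (i : ι) : delta i i = 1 := if_pos rfl

theorem delta_of_ne {i j : ι} (h : i ≠ j) : delta i j = 0 := if_neg h

theorem delta_comm (i j : ι) : delta i j = delta j i := by
  unfold delta; simp only [eq_comm]

theorem delta_nonneg (i j : ι) : 0 ≤ delta i j := by unfold delta; split_ifs <;> simp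

theorem delta_apply {κ : Type*} [DecidableEq κ] (σ : ι ≃ κ) (i j : ι) :
    delta (σ i) (σ j) = delta i j := by
  unfold delta; simp

theorem rootDot_comm (i j k l : ι) : rootDot i j k l = rootDot k l i j := by
  unfold rootDot
  rw [delta_comm k i, delta_comm l j, delta_comm k j, delta_comm l i]
  ring

theorem rootDot_apply {κ : Type*} [DecidableEq κ] (σ : ι ≃ κ) (i j k l : ι) :
    rootDot (σ i) (σ j) (σ k) (σ l) = rootDot i j k l := by
  unfold rootDot; simp only [delta_apply]

theorem rootDot_swap_swap (i j k l : ι) : rootDot j i l k = rootDot i j k l := by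
  unfold rootDot; ring

/-- The reflection `(i j)` negates the root `e_i - e_j`. -/
theorem rootDot_swap_apply (i j k l : ι) :
    rootDot i j (Equiv.swap i j k) (Equiv.swap i j l) = -rootDot i j k l := by
  have h1 : ∀ m, delta i (Equiv.swap i j m) = delta j m := fun m => by
    conv_rhs => rw [← delta_apply (Equiv.swap i j), Equiv.swap_apply_right]
  have h2 : ∀ m, delta j (Equiv.swap i j m) = delta i m := fun m => by
    conv_rhs => rw [← delta_apply (Equiv.swap i j), Equiv.swap_apply_left]
  unfold rootDot
  rw [h1, h1, h2, h2]
  ring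

theorem ne_of_rootDot_eq_zero (h₁ : b₁ ≠ t₁) (h₂ : b₂ ≠ t₂) (h : rootDot b₁ t₁ b₂ t₂ = 0) :
    b₁ ≠ b₂ ∧ b₁ ≠ t₂ ∧ t₁ ≠ b₂ ∧ t₁ ≠ t₂ := by
  unfold rootDot delta at h
  refine ⟨?_, ?_, ?_, ?_⟩ <;> rintro rfl <;> split_ifs at h <;> simp_all

theorem eq_or_eq_of_rootDot_pos (h : 0 < rootDot b₁ t₁ b₂ t₂) : b₁ = b₂ ∨ t₁ = t₂ := by
  by_contra hc
  push Not at hc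
  have h1 := delta_nonneg b₁ t₂
  have h2 := delta_nonneg t₁ b₂
  unfold rootDot at h
  rw [delta_of_ne hc.1, delta_of_ne hc.2] at h
  omega

/-- A pair of parallel edges that start at the same point is determined by its boundary, the product
of the corresponding transpositions and the scalar product of the corresponding roots. -/
theorem edges_eq_of_eq (h₁ : b₁ ≠ t₁) (h₂ : b₁ ≠ t₂) (h₃ : b₃ ≠ t₃) (h₄ : b₄ ≠ t₄)
    (p₁ : 0 < w₁) (p₂ : 0 < w₂) (p₃ : 0 < w₃) (p₄ : 0 < w₄)
    (H : ∀ l, w₁ * (delta b₁ l - delta t₁ l) + w₂ * (delta b₁ l - delta t₂ l) =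
      w₃ * (delta b₃ l - delta t₃ l) + w₄ * (delta b₄ l - delta t₄ l))
    (hs : Equiv.swap b₁ t₁ * Equiv.swap b₁ t₂ = Equiv.swap b₃ t₃ * Equiv.swap b₄ t₄)
    (hd : rootDot b₁ t₁ b₁ t₂ = rootDot b₃ t₃ b₄ t₄) :
    b₁ = b₃ ∧ t₁ = t₃ ∧ b₁ = b₄ ∧ t₂ = t₄ ∧
      ((w₁ = w₃ ∧ w₂ = w₄) ∨ (t₁ = t₂ ∧ w₁ + w₂ = w₃ + w₄)) := by
  have e : rootDot b₁ t₁ b₁ t₂ = 1 + delta t₁ t₂ := by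
    unfold rootDot
    rw [delta_self, delta_of_ne h₂, delta_of_ne h₁.symm]; ring
  have hp : 0 < rootDot b₃ t₃ b₄ t₄ := by have := delta_nonneg t₁ t₂; omega
  have Hb := H b₁
  have H1 := H t₁
  have H2 := H t₂
  rw [delta_self, delta_of_ne h₁.symm, delta_of_ne h₂.symm] at Hb
  rw [delta_self, delta_of_ne h₁] at H1
  rw [delta_self, delta_of_ne h₂] at H2
  have nn : ∀ {w : ℤ} (i j : ι), 0 < w → 0 ≤ w * delta i j := fun i j hw =>
    mul_nonneg hw.le (delta_nonneg i j)
  -- The scalar product is positive, so that the other two edges share their start or their end.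
  by_cases hb : b₃ = b₄
  · subst hb
    have e' : rootDot b₃ t₃ b₃ t₄ = 1 + delta t₃ t₄ := by
      unfold rootDot
      rw [delta_self, delta_of_ne h₄, delta_of_ne h₃.symm]; ring
    have hb : b₁ = b₃ := by
      by_contra hne
      rw [delta_of_ne (Ne.symm hne)] at Hb
      have := nn t₃ b₁ p₃
      have := nn t₄ b₁ p₄
      linarith
    subst hb
    rw [delta_of_ne h₁] at H1
    rw [delta_of_ne h₂] at H2
    have ed : delta t₁ t₂ = delta t₃ t₄ := by omega
    by_cases ht : t₁ = t₂
    · subst ht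
      rw [delta_self] at ed H1
      have ht' : t₃ = t₄ := by by_contra hne; rw [delta_of_ne hne] at ed; omega
      subst ht'
      have : t₁ = t₃ := by
        by_contra hne
        rw [delta_of_ne (Ne.symm hne)] at H1
        linarith
      subst this
      rw [delta_self] at H1
      exact ⟨rfl, rfl, rfl, rfl, Or.inr ⟨rfl, by linarith⟩⟩
    · rw [delta_of_ne ht] at ed
      have ht' : t₃ ≠ t₄ := by rintro rfl; rw [delta_self] at ed; omega
      rw [delta_of_ne (Ne.symm ht)] at H1
      rw [delta_of_ne ht] at H2
      -- the product of the transpositions excludes the other order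
      have key : t₁ = t₄ → t₂ = t₃ → False := by
        rintro rfl rfl
        have := Equiv.congr_fun hs t₁
        rw [Equiv.Perm.mul_apply, Equiv.Perm.mul_apply,
          Equiv.swap_apply_of_ne_of_ne h₁.symm ht, Equiv.swap_apply_right, Equiv.swap_apply_left] at this
        exact h₂ this
      have d1 : t₁ = t₃ ∨ t₁ = t₄ := by
        by_contra hc
        push Not at hc
        rw [delta_of_ne (Ne.symm hc.1), delta_of_ne (Ne.symm hc.2)] at H1
        linarith
      have d2 : t₂ = t₃ ∨ t₂ = t₄ := by
        by_contra hc
        push Not at hc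
        rw [delta_of_ne (Ne.symm hc.1), delta_of_ne (Ne.symm hc.2)] at H2
        linarith
      have f1 : t₁ = t₃ := by
        rcases d1 with d | d
        · exact d
        · rcases d2 with d' | d'
          · exact (key d d').elim
          · exact absurd (d.trans d'.symm) ht
      have f2 : t₂ = t₄ := by
        rcases d2 with d | d
        · exact absurd (f1.trans d.symm) ht
        · exact d
      subst f1 f2
      rw [delta_self, delta_of_ne (Ne.symm ht)] at H1
      rw [delta_self, delta_of_ne ht] at H2
      exact ⟨rfl, rfl, rfl, rfl, Or.inl ⟨by linarith, by linarith⟩⟩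
  -- A common end `t₃` would absorb both `t₁` and `t₂`, and the scalar products would differ.
  · have ht := (eq_or_eq_of_rootDot_pos hp).resolve_left hb
    subst ht
    have f1 : t₃ = t₁ := by
      by_contra hne
      rw [delta_of_ne hne] at H1
      have := nn b₃ t₁ p₃
      have := nn b₄ t₁ p₄
      have := nn t₂ t₁ p₂
      linarith
    have f2 : t₃ = t₂ := by
      by_contra hne
      rw [delta_of_ne hne] at H2
      have := nn b₃ t₂ p₃
      have := nn b₄ t₂ p₄
      have := nn t₁ t₂ p₁
      linarith
    have e' : rootDot b₃ t₃ b₄ t₃ = 1 := by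
      unfold rootDot
      rw [delta_self, delta_of_ne hb, delta_of_ne h₃, delta_of_ne h₄.symm]; ring
    rw [e, e', ← f1, f2, delta_self] at hd
    omega

/-- Two pairs of parallel edges with the same boundary agree if the two edges of each of them have
a common start or end, and the products of the corresponding transpositions are equal. -/
theorem edges_eq (h₁ : b₁ ≠ t₁) (h₂ : b₂ ≠ t₂) (h₃ : b₃ ≠ t₃) (h₄ : b₄ ≠ t₄)
    (p₁ : 0 < w₁) (p₂ : 0 < w₂) (p₃ : 0 < w₃) (p₄ : 0 < w₄)
    (H : ∀ l, w₁ * (delta b₁ l - delta t₁ l) + w₂ * (delta b₂ l - delta t₂ l) =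
      w₃ * (delta b₃ l - delta t₃ l) + w₄ * (delta b₄ l - delta t₄ l))
    (hs : Equiv.swap b₁ t₁ * Equiv.swap b₂ t₂ = Equiv.swap b₃ t₃ * Equiv.swap b₄ t₄)
    (hd : rootDot b₁ t₁ b₂ t₂ = rootDot b₃ t₃ b₄ t₄) (hp : 0 < rootDot b₁ t₁ b₂ t₂) :
    b₁ = b₃ ∧ t₁ = t₃ ∧ b₂ = b₄ ∧ t₂ = t₄ ∧
      ((w₁ = w₃ ∧ w₂ = w₄) ∨ (b₁ = b₂ ∧ t₁ = t₂ ∧ w₁ + w₂ = w₃ + w₄)) := by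
  rcases eq_or_eq_of_rootDot_pos hp with rfl | rfl
  · obtain ⟨k1, k2, k3, k4, k5⟩ := edges_eq_of_eq h₁ h₂ h₃ h₄ p₁ p₂ p₃ p₄ H hs hd
    exact ⟨k1, k2, k3, k4, k5.imp_right fun h => ⟨rfl, h⟩⟩
  · rw [Equiv.swap_comm b₁, Equiv.swap_comm b₂, Equiv.swap_comm b₃, Equiv.swap_comm b₄] at hs
    rw [← rootDot_swap_swap, ← rootDot_swap_swap b₃] at hd
    obtain ⟨k1, k2, k3, k4, k5⟩ := edges_eq_of_eq h₁.symm h₂.symm h₃.symm h₄.symm p₁ p₂ p₃ p₄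
      (fun l => by linear_combination -H l) hs hd
    exact ⟨k2, k1, k4, k3, k5.imp_right fun h => ⟨h.1, rfl, h.2⟩⟩

/-- Two pairs of disjoint edges with the same boundary agree up to order. -/
theorem edges_eq_or_of_disjoint (h₁ : b₁ ≠ t₁) (h₂ : b₂ ≠ t₂) (h₃ : b₃ ≠ t₃) (h₄ : b₄ ≠ t₄)
    (p₁ : 0 < w₁) (p₂ : 0 < w₂)
    (H : ∀ l, w₁ * (delta b₁ l - delta t₁ l) + w₂ * (delta b₂ l - delta t₂ l) =
      w₃ * (delta b₃ l - delta t₃ l) + w₄ * (delta b₄ l - delta t₄ l))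
    (p₃ : 0 < w₃) (p₄ : 0 < w₄)
    (hs : Equiv.swap b₁ t₁ * Equiv.swap b₂ t₂ = Equiv.swap b₃ t₃ * Equiv.swap b₄ t₄)
    (hd : rootDot b₁ t₁ b₂ t₂ = 0) (hd' : rootDot b₃ t₃ b₄ t₄ = 0) :
    (b₁ = b₃ ∧ t₁ = t₃ ∧ b₂ = b₄ ∧ t₂ = t₄ ∧ w₁ = w₃ ∧ w₂ = w₄) ∨
      (b₁ = b₄ ∧ t₁ = t₄ ∧ b₂ = b₃ ∧ t₂ = t₃) := by
  obtain ⟨d1, d2, d3, d4⟩ := ne_of_rootDot_eq_zero h₁ h₂ hd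
  obtain ⟨f1, f2, f3, f4⟩ := ne_of_rootDot_eq_zero h₃ h₄ hd'
  have Hb1 := H b₁
  have Hb2 := H b₂
  rw [delta_self, delta_of_ne h₁.symm, delta_of_ne d1.symm, delta_of_ne d2.symm] at Hb1
  rw [delta_self, delta_of_ne d1, delta_of_ne d3, delta_of_ne h₂.symm] at Hb2
  have nn : ∀ {w : ℤ} (i j : ι), 0 < w → 0 ≤ w * delta i j := fun i j hw =>
    mul_nonneg hw.le (delta_nonneg i j)
  have c1 : b₃ = b₁ ∨ b₄ = b₁ := by
    by_contra hc
    push Not at hc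
    rw [delta_of_ne hc.1, delta_of_ne hc.2] at Hb1
    have := nn t₃ b₁ p₃
    have := nn t₄ b₁ p₄
    linarith
  have c2 : b₃ = b₂ ∨ b₄ = b₂ := by
    by_contra hc
    push Not at hc
    rw [delta_of_ne hc.1, delta_of_ne hc.2] at Hb2
    have := nn t₃ b₂ p₃
    have := nn t₄ b₂ p₄
    linarith
  have s1 := Equiv.congr_fun hs b₁
  have s2 := Equiv.congr_fun hs b₂
  rw [Equiv.Perm.mul_apply, Equiv.Perm.mul_apply, Equiv.swap_apply_of_ne_of_ne d1 d2,
    Equiv.swap_apply_left] at s1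
  rw [Equiv.Perm.mul_apply, Equiv.Perm.mul_apply, Equiv.swap_apply_left,
    Equiv.swap_apply_of_ne_of_ne d2.symm d4.symm] at s2
  rcases c1 with rfl | rfl
  · have c2 := c2.resolve_left d1
    subst c2
    rw [Equiv.swap_apply_of_ne_of_ne f1 f2, Equiv.swap_apply_left] at s1
    rw [Equiv.swap_apply_left, Equiv.swap_apply_of_ne_of_ne f2.symm f4.symm] at s2
    subst s1 s2
    rw [delta_self, delta_of_ne h₁.symm, delta_of_ne d1.symm, delta_of_ne d2.symm] at Hb1
    rw [delta_self, delta_of_ne d1, delta_of_ne d3, delta_of_ne h₂.symm] at Hb2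
    exact Or.inl ⟨rfl, rfl, rfl, rfl, by linarith, by linarith⟩
  · have c2 := c2.resolve_right d1
    subst c2
    rw [Equiv.swap_apply_left, Equiv.swap_apply_of_ne_of_ne f2.symm f4.symm] at s1
    rw [Equiv.swap_apply_of_ne_of_ne f1 f2, Equiv.swap_apply_left] at s2
    exact Or.inr ⟨rfl, s1, rfl, s2⟩

end Edges

namespace GridLattice

variable {Λ : GridLattice}

/-- The total width and the difference of the heights determine a pair of embedded rectangles, if the
upper right corners of the first rectangles agree in the torus: their difference is smaller than
one of the four rectangles. -/
theorem Emb.pair_eq {w₁ w₂ w₃ w₄ h₁ h₂ h₃ h₄ : ℤ} (E₁ : Λ.Emb w₁ h₁) (E₂ : Λ.Emb w₂ h₂)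
    (E₃ : Λ.Emb w₃ h₃) (E₄ : Λ.Emb w₄ h₄) (pw₁ : 0 < w₁) (pw₂ : 0 < w₂) (pw₃ : 0 < w₃)
    (pw₄ : 0 < w₄) (ph₁ : 0 < h₁) (ph₂ : 0 < h₂) (ph₃ : 0 < h₃) (ph₄ : 0 < h₄)
    (hw : w₁ + w₂ = w₃ + w₄) (hh : h₁ - h₂ = h₃ - h₄) (m : Λ.mem (w₃ - w₁) (h₃ - h₁)) :
    w₁ = w₃ ∧ h₁ = h₃ := by
  rcases le_total w₁ w₃ with hu | hu <;> rcases le_total h₁ h₃ with hv | hv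
  · have := E₃ _ _ m (by omega) (by omega) (by omega) (by omega); omega
  · have := E₂ _ _ m (by omega) (by omega) (by omega) (by omega); omega
  · have := E₄ _ _ m (by omega) (by omega) (by omega) (by omega); omega
  · have := E₁ _ _ m (by omega) (by omega) (by omega) (by omega); omega

end GridLattice

section Existence

variable {n p : ℕ} {q : ℤ} [NeZero n] [NeZero p] {x y z : Generator n p}
  {ρ : Equiv.Perm (Fin n) → SpinExt n}

theorem spinTau_congr {i j i' j' : Fin n} {h : i ≠ j} (h' : i' ≠ j') (hi : i = i') (hj : j = j') :
    spinTau i j h = spinTau i' j' h' := by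
  subst hi hj; rfl

theorem Rect.left_ne_right (r : Rect q x y) : x.1 r.bot ≠ x.1 r.top :=
  fun h => r.bot_ne_top (x.1.injective h)

/-- The generalized transposition `τ̃_{i,j}` of a rectangle, indexed by the vertical circles of the
left edge and of the right edge. -/
def Rect.tau (r : Rect q x y) : SpinExt n := spinTau (x.1 r.bot) (x.1 r.top) r.left_ne_right

theorem Rect.phi_mul (r : Rect q x y) :
    r.phi * extendSection ρ x = (r.tau * ρ x.1, Multiplicative.ofAdd y.2) := by
  refine Prod.ext ?_ ?_
  · change spinTau _ _ _ * _ = _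
    rw [spinTau_congr r.left_ne_right rfl r.fst_bot]
    rfl
  · change Multiplicative.ofAdd (y.2 - x.2) * Multiplicative.ofAdd x.2 = _
    rw [← ofAdd_add, sub_add_cancel]

theorem spinProj_tau_mul (hρ : IsSection ρ) (r : Rect q x y) :
    spinProj n (r.tau * ρ x.1) = spinProj n (ρ y.1) := by
  rw [map_mul, hρ, hρ, r.perm_eq]
  unfold Rect.tau
  rw [spinProj_tau, Equiv.swap_apply_apply]
  simp

theorem phi_mul_eq_iff (r : Rect q x y) :
    r.phi * extendSection ρ x = extendSection ρ y ↔ r.tau * ρ x.1 = ρ y.1 := by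
  rw [r.phi_mul, extendSection, Prod.mk.injEq]
  exact and_iff_left rfl

theorem phi_mul_eq_z_iff (r : Rect q x y) :
    r.phi * extendSection ρ x = prodZ n p * extendSection ρ y ↔
      r.tau * ρ x.1 = spinZ n * ρ y.1 := by
  rw [r.phi_mul, extendSection, prodZ, Prod.mk_mul_mk, Prod.mk.injEq, one_mul]
  exact and_iff_left rfl

/-- The defining property of `S_ρ`. -/
theorem tau_mul_section (hρ : IsSection ρ) (r : Rect q x y) :
    r.tau * ρ x.1 = spinSign (signOfSection q ρ x y r) * ρ y.1 := by
  unfold signOfSection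
  split_ifs with h <;> rw [phi_mul_eq_iff] at h
  · rw [h, spinSign_one, one_mul]
  · obtain ⟨ε, hε⟩ := exists_eq_spinSign_mul (spinProj_tau_mul hρ r)
    rcases Int.units_eq_one_or ε with rfl | rfl
    · rw [spinSign_one, one_mul] at hε
      exact absurd hε h
    · exact hε

theorem signOfSection_eq_one_iff (r : Rect q x y) :
    signOfSection q ρ x y r = 1 ↔ r.phi * extendSection ρ x = extendSection ρ y := by
  unfold signOfSection
  split_ifs with h
  · simp [h]
  · simp only [h, iff_false]; decide

theorem signOfSection_eq_neg_one_iff (hρ : IsSection ρ) (r : Rect q x y) :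
    signOfSection q ρ x y r = -1 ↔
      r.phi * extendSection ρ x = prodZ n p * extendSection ρ y := by
  rw [phi_mul_eq_z_iff]
  constructor
  · intro h
    rw [tau_mul_section hρ, h, spinSign_neg_one]
  · intro h
    rw [tau_mul_section hρ] at h
    exact spinSign_injective ((mul_right_cancel h).trans spinSign_neg_one.symm)

/-- The product of the two generalized transpositions of a concatenation, up to the sign of the
concatenation, depends only on its ends. -/
theorem tau_mul_tau (hρ : IsSection ρ) (P : Concat q x z) :
    P.snd.tau * P.fst.tau = spinSign ((signOfSection q ρ : SignFunction n p q).onConcat P) *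
      (ρ z.1 * (ρ x.1)⁻¹) := by
  have h1 := tau_mul_section hρ P.fst
  have h2 := tau_mul_section hρ P.snd
  have : P.snd.tau * P.fst.tau * ρ x.1 =
      spinSign ((signOfSection q ρ : SignFunction n p q).onConcat P) * ρ z.1 := by
    rw [mul_assoc, h1, ← mul_assoc, ← spinSign_comm, mul_assoc, h2, ← mul_assoc, ← spinSign_mul]
    rfl
  rw [← mul_assoc, ← this, mul_inv_cancel_right]

/-- The two roots of a concatenation, expressed by vertical instead of horizontal circles, have the
opposite scalar product, since the first rectangle permutes the circles by a reflection. -/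
theorem Concat.rootDot_col (P : Concat q x z) :
    rootDot (x.1 P.fst.bot) (x.1 P.fst.top) (P.mid.1 P.snd.bot) (P.mid.1 P.snd.top) =
      -rootDot P.fst.bot P.fst.top P.snd.bot P.snd.top := by
  rw [P.fst.perm_eq, Equiv.Perm.mul_apply, Equiv.Perm.mul_apply, rootDot_apply,
    rootDot_swap_apply]

theorem Concat.eq_of_bot_eq (hpq : IsCoprime (p : ℤ) q) {P Q : Concat q x z}
    (h1 : P.fst.bot = Q.fst.bot) (h4 : P.snd.bot = Q.snd.bot)
    (h : (P.fst.width = Q.fst.width ∧ P.snd.width = Q.snd.width) ∨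
      (P.fst.height = Q.fst.height ∧ P.snd.height = Q.snd.height)) : P = Q := by
  obtain ⟨y, r1, r2⟩ := P
  obtain ⟨y', r3, r4⟩ := Q
  rcases h with ⟨h2, h5⟩ | ⟨h2, h5⟩
  · have h3 := Rect.height_eq hpq h1 h2
    obtain rfl : y = y' := Rect.target_eq hpq h1 h2 h3
    obtain rfl : r1 = r3 := Rect.eq_of_eq h1 h2 h3
    obtain rfl : r2 = r4 := Rect.eq_of_eq h4 h5 (Rect.height_eq hpq h4 h5)
    rfl
  · have h3 := Rect.width_eq hpq h1 h2
    obtain rfl : y = y' := Rect.target_eq hpq h1 h3 h2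
    obtain rfl : r1 = r3 := Rect.eq_of_eq h1 h3 h2
    obtain rfl : r2 = r4 := Rect.eq_of_eq h4 (Rect.width_eq hpq h4 h5) h5
    rfl

theorem Rect.emb (hpq : IsCoprime (p : ℤ) q) (r : Rect q x y) :
    (torusLattice n p hpq).Emb r.width r.height := by
  have := (r.isBox hpq).emb
  rwa [add_sub_cancel_left, add_sub_cancel_left] at this

theorem Rect.corner_mem (hpq : IsCoprime (p : ℤ) q) {y' : Generator n p} {r : Rect q x y}
    {s : Rect q x y'} (hb : r.bot = s.bot) (ht : r.top = s.top) :
    (torusLattice n p hpq).mem ((s.width : ℤ) - r.width) ((s.height : ℤ) - r.height) := by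
  have h1 := (samePoint_iff hpq).1 r.upper_right
  have h2 := (samePoint_iff hpq).1 s.upper_right
  rw [← hb, ← ht] at h2
  exact GridLattice.mem_of_eq (GridLattice.sub_mem _ h2 h1) (by ring) (by ring)

/-- Decompositions of the same domain whose roots have equal non-zero scalar products agree. -/
theorem Concat.eq_of_rootDot_eq (hpq : IsCoprime (p : ℤ) q) {P Q : Concat q x z}
    (h : P.domain = Q.domain)
    (hd : rootDot P.fst.bot P.fst.top P.snd.bot P.snd.top =
      rootDot Q.fst.bot Q.fst.top Q.snd.bot Q.snd.top)
    (h0 : rootDot P.fst.bot P.fst.top P.snd.bot P.snd.top ≠ 0) : P = Q := by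
  have hr := Concat.row_sum_eq hpq h
  have hc := Concat.col_sum_eq hpq h
  have w1 := P.fst.width_pos
  have w2 := P.snd.width_pos
  have w3 := Q.fst.width_pos
  have w4 := Q.snd.width_pos
  have k1 := P.fst.height_pos
  have k2 := P.snd.height_pos
  have k3 := Q.fst.height_pos
  have k4 := Q.snd.height_pos
  -- A negative scalar product of the horizontal edges is a positive one of the vertical edges.
  rcases lt_or_gt_of_ne h0 with hneg | hpos
  · have hd' := (P.rootDot_col.trans (congrArg Neg.neg hd)).trans Q.rootDot_col.symm
    obtain ⟨e1, e2, e3, e4, e5⟩ := edges_eq P.fst.left_ne_right P.snd.left_ne_right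
      Q.fst.left_ne_right Q.snd.left_ne_right (by omega) (by omega) (by omega) (by omega) hc
      (P.swap_mul_swap_col.trans Q.swap_mul_swap_col.symm) hd' (by rw [P.rootDot_col]; omega)
    have b1 := x.1.injective e1
    have t1 := x.1.injective e2
    have hmid : P.mid.1 = Q.mid.1 := by rw [P.fst.perm_eq, Q.fst.perm_eq, b1, t1]
    have b2 : P.snd.bot = Q.snd.bot := P.mid.1.injective (by rw [e3, hmid])
    refine Concat.eq_of_bot_eq hpq b1 b2 (Or.inr ?_)
    rcases e5 with ⟨f1, f2⟩ | ⟨f1, f2, f3⟩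
    · omega
    -- the two rectangles lie above each other, so that only the total height is known so far
    · rw [← P.fst.fst_top] at f1
      rw [← P.fst.fst_bot] at f2
      have g1 := P.mid.1.injective f1
      have g2 := P.mid.1.injective f2
      have hw := hr P.fst.bot
      rw [← b2, ← b1, ← t1, ← g1, ← g2, delta_self, delta_of_ne P.fst.bot_ne_top.symm] at hw
      have t2 : P.snd.top = Q.snd.top := P.mid.1.injective (by rw [e4, hmid])
      rw [← t2, ← g2, delta_self] at hw
      have := GridLattice.Emb.pair_eq (P.fst.emb hpq).transpose (P.snd.emb hpq).transpose
        (Q.fst.emb hpq).transpose (Q.snd.emb hpq).transpose (by omega) (by omega) (by omega)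
        (by omega) (by omega) (by omega) (by omega) (by omega) f3 (by linarith)
        (Rect.corner_mem hpq b1 t1)
      omega
  · obtain ⟨e1, e2, e3, e4, e5⟩ := edges_eq P.fst.bot_ne_top P.snd.bot_ne_top
      Q.fst.bot_ne_top Q.snd.bot_ne_top (by omega) (by omega) (by omega) (by omega) hr
      (P.swap_mul_swap.trans Q.swap_mul_swap.symm) hd hpos
    refine Concat.eq_of_bot_eq hpq e1 e3 (Or.inl ?_)
    rcases e5 with ⟨f1, f2⟩ | ⟨f1, f2, f3⟩
    · omega
    -- the two rectangles lie side by side, so that only the total width is known so far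
    · have hh := hc (x.1 P.fst.bot)
      have hq1 : Q.mid.1 Q.snd.bot = x.1 P.fst.top := by
        rw [← e3, ← f1, e1, Q.fst.fst_bot, e2]
      have hq2 : Q.mid.1 Q.snd.top = x.1 P.fst.bot := by
        rw [← e4, ← f2, e2, Q.fst.fst_top, e1]
      rw [hq1, hq2, ← f1, ← f2, P.fst.fst_bot, P.fst.fst_top, ← e1, ← e2, delta_self,
        delta_of_ne P.fst.left_ne_right.symm] at hh
      have := GridLattice.Emb.pair_eq (P.fst.emb hpq) (P.snd.emb hpq)
        (Q.fst.emb hpq) (Q.snd.emb hpq) (by omega) (by omega) (by omega)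
        (by omega) (by omega) (by omega) (by omega) (by omega) f3 (by linarith)
        (Rect.corner_mem hpq e1 e2)
      omega

/-- Two decompositions of a domain into rectangles with disjoint boundaries either agree or differ
by the order of the rectangles. -/
theorem Concat.eq_or_of_rootDot_eq_zero (hpq : IsCoprime (p : ℤ) q) {P Q : Concat q x z}
    (h : P.domain = Q.domain) (h0 : rootDot P.fst.bot P.fst.top P.snd.bot P.snd.top = 0)
    (h0' : rootDot Q.fst.bot Q.fst.top Q.snd.bot Q.snd.top = 0) :
    P = Q ∨ P.snd.tau * P.fst.tau = spinZ n * (Q.snd.tau * Q.fst.tau) := by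
  have w1 := P.fst.width_pos
  have w2 := P.snd.width_pos
  have w3 := Q.fst.width_pos
  have w4 := Q.snd.width_pos
  rcases edges_eq_or_of_disjoint P.fst.bot_ne_top P.snd.bot_ne_top
    Q.fst.bot_ne_top Q.snd.bot_ne_top (by omega) (by omega) (Concat.row_sum_eq hpq h)
    (by omega) (by omega) (P.swap_mul_swap.trans Q.swap_mul_swap.symm) h0 h0' with
    ⟨e1, e2, e3, e4, e5, e6⟩ | ⟨e1, e2, e3, e4⟩
  · exact Or.inl (Concat.eq_of_bot_eq hpq e1 e3 (Or.inl (by omega)))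
  · right
    obtain ⟨d1, d2, d3, d4⟩ := ne_of_rootDot_eq_zero P.fst.bot_ne_top P.snd.bot_ne_top h0
    have m1 : P.mid.1 P.snd.bot = x.1 P.snd.bot := by
      rw [P.fst.perm_eq, Equiv.Perm.mul_apply, Equiv.swap_apply_of_ne_of_ne d1.symm d3.symm]
    have m2 : P.mid.1 P.snd.top = x.1 P.snd.top := by
      rw [P.fst.perm_eq, Equiv.Perm.mul_apply, Equiv.swap_apply_of_ne_of_ne d2.symm d4.symm]
    have m3 : Q.mid.1 Q.snd.bot = x.1 P.fst.bot := by
      rw [Q.fst.perm_eq, Equiv.Perm.mul_apply, ← e1, ← e3, ← e4,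
        Equiv.swap_apply_of_ne_of_ne d1 d2]
    have m4 : Q.mid.1 Q.snd.top = x.1 P.fst.top := by
      rw [Q.fst.perm_eq, Equiv.Perm.mul_apply, ← e2, ← e3, ← e4,
        Equiv.swap_apply_of_ne_of_ne d3 d4]
    have ne2 : x.1 P.snd.bot ≠ x.1 P.snd.top := fun h => P.snd.bot_ne_top (x.1.injective h)
    have t1 : P.snd.tau = spinTau (x.1 P.snd.bot) (x.1 P.snd.top) ne2 := spinTau_congr _ m1 m2
    have t2 : Q.fst.tau = spinTau (x.1 P.snd.bot) (x.1 P.snd.top) ne2 :=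
      spinTau_congr _ (by rw [e3]) (by rw [e4])
    have t3 : Q.snd.tau = P.fst.tau := spinTau_congr _ m3 m4
    have inj := x.1.injective
    rw [t1, t2, t3, Rect.tau, spinTau_disjoint _ _ _ _ ne2 P.fst.left_ne_right
      (fun h => d1 (inj h).symm) (fun h => d3 (inj h).symm) (fun h => d2 (inj h).symm)
      (fun h => d4 (inj h).symm), mul_assoc]

/-- If the signs of two decompositions agreed, so would the products of their generalized
transpositions and, by the Clifford representation, the scalar products of their roots. -/
theorem signOfSection_polygon (hpq : IsCoprime (p : ℤ) q) (hρ : IsSection ρ) (P Q : Concat q x z)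
    (hne : P ≠ Q) (h : P.domain = Q.domain) :
    (signOfSection q ρ : SignFunction n p q).onConcat P =
      -(signOfSection q ρ : SignFunction n p q).onConcat Q := by
  have hP := tau_mul_tau hρ P
  have hQ := tau_mul_tau hρ Q
  by_contra hc
  have heq : (signOfSection q ρ : SignFunction n p q).onConcat P =
      (signOfSection q ρ : SignFunction n p q).onConcat Q := by
    rcases Int.units_eq_one_or ((signOfSection q ρ : SignFunction n p q).onConcat P) with e | e <;>
    rcases Int.units_eq_one_or ((signOfSection q ρ : SignFunction n p q).onConcat Q) with e' | e' <;>
    rw [e, e'] at hc ⊢ <;> exact absurd rfl hc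
  rw [heq, ← hQ] at hP
  have hdot := rootDot_eq_of_spinTau_mul_eq P.snd.left_ne_right P.fst.left_ne_right
    Q.snd.left_ne_right Q.fst.left_ne_right (ε := 1) (by rw [spinSign_one, one_mul]; exact hP)
  rw [Units.val_one, one_mul, rootDot_comm, P.rootDot_col, rootDot_comm (Q.mid.1 _),
    Q.rootDot_col, neg_inj] at hdot
  by_cases h0 : rootDot P.fst.bot P.fst.top P.snd.bot P.snd.top = 0
  · rcases Concat.eq_or_of_rootDot_eq_zero hpq h h0 (hdot ▸ h0) with e | e
    · exact hne e
    · rw [hP] at e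
      exact spinZ_ne_one (mul_right_cancel ((one_mul _).trans e)).symm
  · exact hne (Concat.eq_of_rootDot_eq hpq h hdot h0)

theorem isSignAssignment_signOfSection (hpq : IsCoprime (p : ℤ) q) (hρ : IsSection ρ) :
    IsSignAssignment (signOfSection q ρ : SignFunction n p q) where
  polygon x z P Q hne h := signOfSection_polygon hpq hρ P Q hne h
  horizontal x P hP := by
    obtain ⟨h1, h2, h3⟩ := hP
    have e1 := rowIndex_eq_rowIndex_iff.2 (torus_dvd_snd hpq ((samePoint_iff hpq).1 h3))
    rw [rowIndex_fin, rowIndex_fin] at e1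
    have e2 : P.snd.top = P.fst.top := by
      rw [← P.snd.rowIndex_top, ← P.fst.rowIndex_top, h1, e1]
    have hP := tau_mul_tau hρ P
    have t : P.snd.tau = spinTau (x.1 P.fst.top) (x.1 P.fst.bot) P.fst.left_ne_right.symm :=
      spinTau_congr _ (by rw [← e1, P.fst.fst_bot]) (by rw [e2, P.fst.fst_top])
    rw [t, spinTau_symm, Rect.tau, mul_assoc, spinTau_mul_self, spinZ_mul_self,
      mul_inv_cancel, mul_one] at hP
    exact spinSign_injective (hP.symm.trans spinSign_one.symm)
  vertical x P hP := by
    obtain ⟨h1, h2, h3⟩ := hP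
    have e1 := rowIndex_eq_rowIndex_iff.2 (torus_dvd_snd hpq ((samePoint_iff hpq).1 h3))
    rw [rowIndex_fin, P.fst.rowIndex_top] at e1
    have e2 : P.snd.top = P.fst.bot := by
      rw [← P.snd.rowIndex_top, ← P.fst.rowIndex_bot, rowIndex_eq_rowIndex_iff]
      have h4 := P.fst.dvd_top
      rw [e1] at h4
      have h5 : (n : ℤ) ∣ (P.fst.height + P.snd.height : ℤ) := ⟨p, by exact_mod_cast h2⟩
      have h6 := dvd_sub h5 h4
      ring_nf at h6 ⊢
      exact h6
    have hP := tau_mul_tau hρ P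
    have t : P.snd.tau = spinTau (x.1 P.fst.bot) (x.1 P.fst.top) P.fst.left_ne_right :=
      spinTau_congr _ (by rw [← e1, P.fst.fst_top]) (by rw [e2, P.fst.fst_bot])
    rw [t, Rect.tau, spinTau_mul_self, mul_inv_cancel, mul_one] at hP
    exact spinSign_injective (hP.symm.trans spinSign_neg_one.symm)

theorem exists_section (n : ℕ) : ∃ ρ : Equiv.Perm (Fin n) → SpinExt n, IsSection ρ :=
  ⟨Function.surjInv spinProj_surjective, Function.surjInv_eq spinProj_surjective⟩

end Existence

/-! ### The differential squares to zero -/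

theorem units_int_ne_neg (u : ℤˣ) : u ≠ -u := by
  rcases Int.units_eq_one_or u with rfl | rfl <;> decide

section Differential

variable {n p : ℕ} {q : ℤ} {x y z : Generator n p}

/-- A sign assignment can exist only if every domain has at most two decompositions. -/
theorem IsSignAssignment.eq_of_domain_eq {S : SignFunction n p q} (hS : IsSignAssignment S)
    {P Q R : Concat q x z} (hPQ : P.domain = Q.domain) (hQR : Q.domain = R.domain) (h1 : P ≠ Q)
    (h2 : Q ≠ R) : P = R := by
  by_contra h3
  have e1 := hS.polygon x z P Q h1 hPQ
  have e2 := hS.polygon x z Q R h2 hQR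
  have e3 := hS.polygon x z P R h3 (hPQ.trans hQR)
  rw [e2, neg_neg] at e1
  exact units_int_ne_neg _ (e1.symm.trans e3)

namespace Concat

/-- Both rectangles of the concatenation are empty. -/
def IsEmpty (P : Concat q x z) : Prop := P.fst.IsEmpty ∧ P.snd.IsEmpty

theorem domain_eq_of_boxSum [NeZero n] [NeZero p] (hpq : IsCoprime (p : ℤ) q) (P : Concat q x z)
    {Y : Generator n p} {e f e' f' g k g' k' : ℤ}
    (h1 : (torusLattice n p hpq).IsBox (fun s t => x.OnLift q s t)
      (fun s t => Y.OnLift q s t) e f e' f')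
    (h2 : (torusLattice n p hpq).IsBox (fun s t => Y.OnLift q s t)
      (fun s t => z.OnLift q s t) g k g' k')
    (hd : ∀ φ, (torusLattice n p hpq).Periodic φ →
      boxSum φ (x.col P.fst.bot) ((P.fst.bot : ℕ) : ℤ) (x.col P.fst.bot + P.fst.width)
          (((P.fst.bot : ℕ) : ℤ) + P.fst.height) +
        boxSum φ (P.mid.col P.snd.bot) ((P.snd.bot : ℕ) : ℤ) (P.mid.col P.snd.bot + P.snd.width)
          (((P.snd.bot : ℕ) : ℤ) + P.snd.height) =
      boxSum φ e f e' f' + boxSum φ g k g' k') :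
    P.domain = (⟨Y, Rect.ofBox hpq h1, Rect.ofBox hpq h2⟩ : Concat q x z).domain := by
  funext c l
  change P.fst.mult c l + P.snd.mult c l =
    (Rect.ofBox hpq h1).mult c l + (Rect.ofBox hpq h2).mult c l
  rw [mult_ofBox, mult_ofBox, mult_eq_boxSum, mult_eq_boxSum,
    hd _ (squareIndicator_periodic hpq c l)]

/-- The domain of two empty rectangles with different ends has a second such decomposition. -/
theorem exists_ne [NeZero n] [NeZero p] (hpq : IsCoprime (p : ℤ) q) (hxz : x ≠ z)
    (P : Concat q x z) (hP : P.IsEmpty) : ∃ Q : Concat q x z, Q.IsEmpty ∧ Q ≠ P ∧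
      P.domain = Q.domain := by
  obtain ⟨Y', e, f, e', f', g, k, g', k', hY', h1, h2, e1, e2, hd, hne⟩ :=
    GridLattice.hasAlternative (isGen_onLift hpq x) (isGen_onLift hpq P.mid)
      (isGen_onLift hpq z) (P.fst.isBox hpq) (P.snd.isBox hpq) ((isEmpty_iff _).1 hP.1)
      ((isEmpty_iff _).1 hP.2) (fun h => hxz (generator_eq_of_onLift hpq h))
  obtain ⟨Y, rfl⟩ := exists_generator hpq hY'
  refine ⟨⟨Y, Rect.ofBox hpq h1, Rect.ofBox hpq h2⟩, ⟨(isEmpty_ofBox_iff hpq h1).2 e1,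
    (isEmpty_ofBox_iff hpq h2).2 e2⟩, ?_, P.domain_eq_of_boxSum hpq h1 h2 hd⟩
  intro hQ
  obtain ⟨y, r1, r2⟩ := P
  simp only [Concat.mk.injEq] at hQ
  obtain ⟨rfl, hr1, hr2⟩ := hQ
  rw [heq_eq_eq] at hr1 hr2
  subst hr1 hr2
  exact hne (fun s t => Iff.rfl) (dvd_sub_rowIndex (n := n) f) (dvd_sub_rowIndex (n := n) k)

end Concat

theorem mult_ne_zero_of_covers_onLift [NeZero n] [NeZero p] (hpq : IsCoprime (p : ℤ) q)
    {m : Generator n p} {s t : ℤ} (hm : m.OnLift q s t) (r : Rect q x y)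
    (H : (torusLattice n p hpq).Covers (x.col r.bot) ((r.bot : ℕ) : ℤ)
      (x.col r.bot + r.width) (((r.bot : ℕ) : ℤ) + r.height) s t) :
    r.mult (m.col (rowIndex n t)) ((rowIndex n t : ℕ) : ℤ) ≠ 0 := by
  obtain ⟨u, v, k, p1, p2, p3, p4⟩ := H
  refine mult_ne_zero_of_covers hpq r ⟨_, _, GridLattice.add_mem k ((onLift_iff hpq).1 hm), ?_⟩
  omega

namespace Markings

variable (G : Markings n p)

/-- The domain of two rectangles from a generator to itself contains an `𝕏`: every row and every
column has one. -/
theorem not_avoidsX [NeZero n] [NeZero p] (hpq : IsCoprime (p : ℤ) q) (P : Concat q x x)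
    (h1 : G.AvoidsX P.fst) (h2 : G.AvoidsX P.snd) : False := by
  have key : ∀ {s t : ℤ}, G.X.OnLift q s t →
      ¬ ((torusLattice n p hpq).Covers (x.col P.fst.bot) ((P.fst.bot : ℕ) : ℤ)
          (x.col P.fst.bot + P.fst.width) (((P.fst.bot : ℕ) : ℤ) + P.fst.height) s t ∨
        (torusLattice n p hpq).Covers (P.mid.col P.snd.bot) ((P.snd.bot : ℕ) : ℤ)
          (P.mid.col P.snd.bot + P.snd.width) (((P.snd.bot : ℕ) : ℤ) + P.snd.height) s t) := by
    rintro s t hs (h | h)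
    · exact mult_ne_zero_of_covers_onLift hpq hs _ h (h1 _)
    · exact mult_ne_zero_of_covers_onLift hpq hs _ h (h2 _)
  rcases GridLattice.covers_row_or_col (isGen_onLift hpq x) (isGen_onLift hpq P.mid)
    (P.fst.isBox hpq) (P.snd.isBox hpq) with ⟨t, h⟩ | ⟨s, h⟩
  · obtain ⟨s, hs⟩ := (isGen_onLift hpq G.X).exRow t
    exact key hs (h s)
  · obtain ⟨t, ht⟩ := (isGen_onLift hpq G.X).exCol s
    exact key ht (h t)

variable {A : Type} [CommRing A] (V : Fin n → A) (S : SignFunction n p q) [NeZero p]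

open Classical in
/-- The coefficient of `y` in `∂_S x`. -/
def coeff (x y : Generator n p) : A :=
  ∑ r : Rect q x y, if r.IsEmpty ∧ G.AvoidsX r then
    (((S x y r : ℤˣ) : ℤ) : A) * ∏ i, V i ^ G.countO r i else 0

theorem differential_single (x y : Generator n p) (a : A) :
    G.differential V S (Pi.single x a) y = a * G.coeff V S x y := by
  classical
  unfold differential coeff
  rw [Fintype.linearCombination_apply_single, Pi.smul_apply, smul_eq_mul, Finset.sum_apply]
  congr 1
  rw [Finset.sum_eq_single y]
  · rw [Finset.sum_apply]
    refine Finset.sum_congr rfl fun r _ => ?_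
    split_ifs
    · rw [Pi.single_eq_same]
    · rfl
  · intro b _ hb
    rw [Finset.sum_apply]
    refine Finset.sum_eq_zero fun r _ => ?_
    split_ifs
    · rw [Pi.single_eq_of_ne hb.symm]
    · rfl
  · intro h
    exact absurd (Finset.mem_univ _) h

theorem differential_apply (f : Generator n p → A) (y : Generator n p) :
    G.differential V S f y = ∑ x, f x * G.coeff V S x y := by
  classical
  conv_lhs => rw [← Finset.univ_sum_single f, map_sum, Finset.sum_apply]
  exact Finset.sum_congr rfl fun x _ => G.differential_single V S x y (f x)

/-- The concatenations that contribute to `∂_S²`. -/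
def Contributes (P : Concat q x z) : Prop :=
  (P.fst.IsEmpty ∧ G.AvoidsX P.fst) ∧ P.snd.IsEmpty ∧ G.AvoidsX P.snd

theorem contributes_iff (P : Concat q x z) : G.Contributes P ↔
    P.IsEmpty ∧ ∀ i : Fin n, P.domain (G.X.col i) ((i : ℕ) : ℤ) = 0 := by
  unfold Contributes Concat.IsEmpty AvoidsX Concat.domain
  simp only [Nat.add_eq_zero_iff, forall_and]
  tauto

/-- The equivalence between concatenations and pairs of rectangles. -/
def concatEquiv (x z : Generator n p) :
    Concat q x z ≃ Σ y : Generator n p, Rect q x y × Rect q y z where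
  toFun P := ⟨P.mid, P.fst, P.snd⟩
  invFun P := ⟨P.1, P.2.1, P.2.2⟩
  left_inv _ := rfl
  right_inv _ := rfl

instance : Fintype (Concat q x z) := Fintype.ofEquiv _ (concatEquiv x z).symm

open Classical in
theorem sum_coeff_mul_coeff (x z : Generator n p) :
    ∑ y, G.coeff V S x y * G.coeff V S y z =
      ∑ P ∈ Finset.univ.filter fun P : Concat q x z => G.Contributes P,
        (((S.onConcat P : ℤˣ) : ℤ) : A) * ∏ i, V i ^ P.domain (G.O.col i) ((i : ℕ) : ℤ) := by
  rw [Finset.sum_filter, ← (concatEquiv x z).symm.sum_comp, Fintype.sum_sigma]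
  refine Finset.sum_congr rfl fun y _ => ?_
  rw [coeff, coeff, Finset.sum_mul_sum, Fintype.sum_prod_type]
  refine Finset.sum_congr rfl fun r _ => Finset.sum_congr rfl fun r' _ => ?_
  rw [ite_zero_mul_ite_zero]
  refine if_congr Iff.rfl ?_ rfl
  change _ = (((S x y r * S y z r' : ℤˣ) : ℤ) : A) * ∏ i, V i ^ (G.countO r i + G.countO r' i)
  simp only [pow_add, Finset.prod_mul_distrib, Units.val_mul, Int.cast_mul]
  ring

/-- The concatenations of two empty rectangles cancel in pairs with the same polygon and opposite
signs. -/
theorem differential_comp_differential [NeZero n] (hpq : IsCoprime (p : ℤ) q)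
    (hS : IsSignAssignment S) : G.differential V S ∘ₗ G.differential V S = 0 := by
  classical
  refine LinearMap.pi_ext fun x a => ?_
  funext z
  rw [LinearMap.comp_apply, differential_apply]
  simp only [differential_single, mul_assoc, LinearMap.zero_apply, Pi.zero_apply]
  rw [← Finset.mul_sum, sum_coeff_mul_coeff]
  refine mul_eq_zero_of_right _ ?_
  have partner : ∀ P ∈ Finset.univ.filter fun P : Concat q x z => G.Contributes P,
      ∃ Q ∈ Finset.univ.filter fun P : Concat q x z => G.Contributes P,
        Q ≠ P ∧ P.domain = Q.domain := by
    intro P hP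
    have hP' := (Finset.mem_filter.1 hP).2
    have hxz : x ≠ z := by
      rintro rfl
      exact G.not_avoidsX hpq P hP'.1.2 hP'.2.2
    obtain ⟨h1, h2⟩ := (G.contributes_iff P).1 hP'
    obtain ⟨Q, k1, k2, k3⟩ := P.exists_ne hpq hxz h1
    exact ⟨Q, Finset.mem_filter.2 ⟨Finset.mem_univ _,
      (G.contributes_iff Q).2 ⟨k1, fun i => by rw [← k3]; exact h2 i⟩⟩, k2, k3⟩
  -- A polygon has only two decompositions, so that the choice of partners is an involution.
  choose f hf hf1 hf2 using partner
  refine Finset.sum_involution f ?_ ?_ hf ?_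
  · intro P hP
    rw [hS.polygon x z P (f P hP) (hf1 P hP).symm (hf2 P hP), ← hf2 P hP]
    push_cast
    ring
  · intro P hP _
    exact hf1 P hP
  · intro P hP
    exact (hS.eq_of_domain_eq (hf2 P hP) (hf2 _ (hf P hP)) (hf1 P hP).symm
      (hf1 _ (hf P hP)).symm).symm

end Markings

end Differential

/-! ### Low rectangles -/

namespace GridLattice

variable {Λ : GridLattice} {X Y Z : ℤ → ℤ → Prop} {a b a' b' : ℤ}

theorem emb_of_low {w h : ℤ} (hw : w ≤ Λ.N) (hh : h ≤ Λ.n) : Λ.Emb w h := by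
  intro u v m h1 h2 h3 h4
  have hv := Int.eq_zero_of_abs_lt_dvd (Λ.dvd_snd m) (by rw [abs_lt]; constructor <;> omega)
  subst hv
  exact ⟨Int.eq_zero_of_abs_lt_dvd (Λ.row.1 m) (by rw [abs_lt]; constructor <;> omega), rfl⟩

theorem not_dvd_of_pos_of_lt {k d : ℤ} (h0 : 0 < d) (h1 : d < k) : ¬ k ∣ d :=
  fun h => absurd (Int.le_of_dvd h0 h) (by omega)

/-- There is a rectangle of height less than `n` between any two horizontal circles. -/
theorem IsGen.exists_low (hX : Λ.IsGen X) (h1 : X a b) (h2 : X a' b') (ha : a < a')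
    (ha' : a' < a + Λ.N) (hb : b < b') (hb' : b' < b + Λ.n) :
    ∃ Y, Λ.IsGen Y ∧ Λ.IsBox X Y a b a' b' := by
  have nd := not_dvd_of_pos_of_lt (k := (Λ.n : ℤ)) (d := b' - b) (by omega) (by omega)
  obtain ⟨Y, hY, y1, y2, ag⟩ := hX.exists_swap h1 h2 nd
  exact ⟨Y, hY, ha, hb, h1, h2, y1, y2, emb_of_low (by omega) (by omega), nd, ag⟩

/-- There is a rectangle of width less than `n` between any two vertical circles. -/
theorem IsGen.exists_narrow (hX : Λ.IsGen X) (h1 : X a b) (h2 : X a' b') (ha : a < a')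
    (ha' : a' < a + Λ.n) (hb : b < b') (hb' : b' < b + Λ.N) :
    ∃ Y, Λ.IsGen Y ∧ Λ.IsBox X Y a b a' b' := by
  have nd := hX.ndvd_row h1 h2
    (not_dvd_of_pos_of_lt (k := (Λ.n : ℤ)) (d := a' - a) (by omega) (by omega))
  obtain ⟨Y, hY, y1, y2, ag⟩ := hX.exists_swap h1 h2 nd
  exact ⟨Y, hY, ha, hb, h1, h2, y1, y2,
    (emb_of_low (Λ := Λ.transpose) (w := b' - b) (h := a' - a) (by change _ ≤ (Λ.N : ℤ); omega)
      (by change _ ≤ (Λ.n : ℤ); omega)).transpose, nd, ag⟩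

/-- The point of a row in a half-open interval of length `N`. -/
theorem IsGen.exists_mem_row (hX : Λ.IsGen X) (a b : ℤ) :
    ∃ s, X s b ∧ a ≤ s ∧ s < a + Λ.N := by
  have hN : (0 : ℤ) < Λ.N := by exact_mod_cast Λ.N_pos
  obtain ⟨s, hs⟩ := hX.exRow b
  have h0 := Int.emod_nonneg (s - a) hN.ne'
  have h1 := Int.emod_lt_of_pos (s - a) hN
  have h2 := Int.mul_ediv_add_emod (s - a) Λ.N
  refine ⟨a + (s - a) % Λ.N, hX.trans' hs ?_, by omega, by omega⟩
  rw [sub_self, Λ.row]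
  exact ⟨-((s - a) / Λ.N), by rw [mul_neg]; omega⟩

/-- The point of a row strictly between a point of another row and its next translate. -/
theorem IsGen.exists_mem_row' (hX : Λ.IsGen X) {c : ℤ} (h : X a c) (hb : ¬ (Λ.n : ℤ) ∣ b - c) :
    ∃ s, X s b ∧ a < s ∧ s < a + Λ.N := by
  obtain ⟨s, h1, h2, h3⟩ := hX.exists_mem_row a b
  refine ⟨s, h1, lt_of_le_of_ne h2 ?_, h3⟩
  rintro rfl
  exact hX.ndvd_col h h1 hb (by simp)

/-- The two rectangles of a horizontal annulus. -/
theorem IsBox.complement_row (h : Λ.IsBox X Y a b a' b') (ha : a' < a + Λ.N)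
    (hb : b' - b < Λ.n) (hX : Λ.IsGen X) (hY : Λ.IsGen Y) :
    Λ.IsBox Y X a' b (a + Λ.N) b' := by
  have m : Λ.mem Λ.N 0 := Λ.row.2 (dvd_refl _)
  have e := h.hx
  refine ⟨ha, h.hy, h.lr, ?_, ?_, h.ur, emb_of_low (by omega) (by omega), h.ndvd,
    fun s t k1 k2 => (h.agree s t k1 k2).symm⟩
  · simpa using hY.trans h.ul m
  · simpa using hX.trans h.ll m

/-- The two rectangles of a vertical annulus of width less than `n`. -/
theorem IsBox.complement_col (h : Λ.IsBox X Y a b a' b') (hb : b' < b + Λ.N)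
    (ha : a' - a < Λ.n) (hX : Λ.IsGen X) (hY : Λ.IsGen Y) :
    Λ.IsBox Y X a b' a' (b + Λ.N) := by
  have m : Λ.mem 0 Λ.N := Λ.col.2 (dvd_refl _)
  have e := h.hx
  have e2 := h.hy
  have y1 : Y a' (b + Λ.N) := by simpa using hY.trans h.lr m
  have x1 : X a (b + Λ.N) := by simpa using hX.trans h.ll m
  have nd : (Λ.n : ℤ) ∣ Λ.N := Λ.dvd_snd m
  refine ⟨h.hx, hb, h.ul, y1, h.ur, x1,
    (emb_of_low (Λ := Λ.transpose) (by change _ ≤ (Λ.N : ℤ); omega)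
      (by change _ ≤ (Λ.n : ℤ); omega)).transpose, ?_, ?_⟩
  · intro hd
    have := dvd_sub nd hd
    rw [show (Λ.N : ℤ) - (b + Λ.N - b') = b' - b by ring] at this
    exact h.ndvd this
  · intro s t k1 k2
    refine (h.agree s t (fun hd => k2 ?_) k1).symm
    rw [← sub_sub]
    exact dvd_sub hd nd

/-- The end of a pair of rectangles with three horizontal circles is determined by its points on
these circles. -/
theorem iff_of_three_rows {X Y Y' Z Z' : ℤ → ℤ → Prop} {t₁ t₂ t₃ s₁ s₂ s₃ s t : ℤ}
    (hZ : Λ.IsGen Z) (hZ' : Λ.IsGen Z') (h1 : Z s₁ t₁) (h1' : Z' s₁ t₁) (h2 : Z s₂ t₂)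
    (h2' : Z' s₂ t₂) (h3 : Z s₃ t₃) (h3' : Z' s₃ t₃)
    (k : ¬ (Λ.n : ℤ) ∣ t - t₁ → ¬ (Λ.n : ℤ) ∣ t - t₂ → ¬ (Λ.n : ℤ) ∣ t - t₃ →
      ((X s t ↔ Y s t) ∧ (Y s t ↔ Z s t)) ∧ (X s t ↔ Y' s t) ∧ (Y' s t ↔ Z' s t)) :
    Z s t ↔ Z' s t := by
  by_cases k1 : (Λ.n : ℤ) ∣ t - t₁
  · exact hZ.iff_of_row hZ' h1 h1' k1
  by_cases k2 : (Λ.n : ℤ) ∣ t - t₂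
  · exact hZ.iff_of_row hZ' h2 h2' k2
  by_cases k3 : (Λ.n : ℤ) ∣ t - t₃
  · exact hZ.iff_of_row hZ' h3 h3' k3
  · have := k k1 k2 k3
    tauto

theorem not_dvd_sub_of_lt {t₁ t₂ : ℤ} (h : t₁ < t₂) (h' : t₂ < t₁ + Λ.n) :
    ¬ (Λ.n : ℤ) ∣ t₂ - t₁ ∧ ¬ (Λ.n : ℤ) ∣ t₁ - t₂ := by
  have := not_dvd_of_pos_of_lt (k := (Λ.n : ℤ)) (d := t₂ - t₁) (by omega) (by omega)
  exact ⟨this, fun h => this (dvd_symm_sub h)⟩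

/-- The two dissections of an L-shape with its reflex corner on the right. -/
theorem IsGen.exists_corner_right (hX : Λ.IsGen X) {t₁ t₂ t₃ a₁ a₂ a₃ : ℤ} (x1 : X a₁ t₁) (x2 : X a₂ t₂)
    (x3 : X a₃ t₃) (ht : t₁ < t₂) (ht' : t₂ < t₃) (ht'' : t₃ < t₁ + Λ.n) (h1 : a₁ < a₃)
    (h2 : a₃ < a₂) (h3 : a₂ < a₁ + Λ.N) :
    ∃ Y Y' Z, Λ.IsGen Y ∧ Λ.IsGen Y' ∧ Λ.IsGen Z ∧ Λ.IsBox X Y a₁ t₁ a₃ t₃ ∧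
      Λ.IsBox Y Z a₃ t₁ a₂ t₂ ∧ Λ.IsBox X Y' a₁ t₁ a₂ t₂ ∧ Λ.IsBox Y' Z a₁ t₂ a₃ t₃ ∧
      ∀ φ, boxSum φ a₁ t₁ a₃ t₃ + boxSum φ a₃ t₁ a₂ t₂ =
        boxSum φ a₁ t₁ a₂ t₂ + boxSum φ a₁ t₂ a₃ t₃ := by
  obtain ⟨n12, n21⟩ := not_dvd_sub_of_lt (Λ := Λ) ht (by omega)
  obtain ⟨n23, n32⟩ := not_dvd_sub_of_lt (Λ := Λ) ht' (by omega)
  obtain ⟨n13, n31⟩ := not_dvd_sub_of_lt (Λ := Λ) (ht.trans ht') (by omega)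
  obtain ⟨Y, hY, b1⟩ := hX.exists_low x1 x3 h1 (by omega) (by omega) (by omega)
  have y2 := (b1.agree a₂ t₂ n12 n32).1 x2
  obtain ⟨Z, hZ, b2⟩ := hY.exists_low b1.lr y2 h2 (by omega) ht (by omega)
  obtain ⟨Y', hY', b3⟩ := hX.exists_low x1 x2 (by omega) (by omega) ht (by omega)
  have y3' := (b3.agree a₃ t₃ n13 n23).1 x3
  obtain ⟨Z', hZ', b4⟩ := hY'.exists_low b3.ul y3' h1 (by omega) ht' (by omega)
  have hZZ : Z' = Z := by
    funext s t
    refine propext (iff_of_three_rows hZ' hZ (X := X) (Y := Y') (Y' := Y)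
      ((b4.agree a₂ t₁ n21 n31).1 b3.lr)
      b2.lr b4.lr b2.ul b4.ul ((b2.agree a₁ t₃ n13 n23).1 b1.ul) fun k1 k2 k3 => ?_)
    exact ⟨⟨b3.agree s t k1 k2, b4.agree s t k2 k3⟩, b1.agree s t k1 k3, b2.agree s t k1 k2⟩
  subst hZZ
  exact ⟨Y, Y', Z', hY, hY', hZ', b1, b2, b3, b4,
    fun φ => boxSum_corner φ (by omega) (by omega) (by omega) (by omega)⟩

/-- The two dissections of an L-shape with its reflex corner on the left. -/
theorem IsGen.exists_corner_left (hX : Λ.IsGen X) {t₁ t₂ t₃ a₁ a₂ a₃ : ℤ} (x1 : X a₁ t₁) (x2 : X a₂ t₂)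
    (x3 : X a₃ t₃) (ht : t₁ < t₂) (ht' : t₂ < t₃) (ht'' : t₃ < t₁ + Λ.n) (h1 : a₂ < a₁)
    (h2 : a₁ < a₃) (h3 : a₃ < a₂ + Λ.N) :
    ∃ Y Y' Z, Λ.IsGen Y ∧ Λ.IsGen Y' ∧ Λ.IsGen Z ∧ Λ.IsBox X Y a₁ t₁ a₃ t₃ ∧
      Λ.IsBox Y Z a₂ t₂ a₁ t₃ ∧ Λ.IsBox X Y' a₂ t₂ a₃ t₃ ∧ Λ.IsBox Y' Z a₁ t₁ a₃ t₂ ∧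
      ∀ φ, boxSum φ a₁ t₁ a₃ t₃ + boxSum φ a₂ t₂ a₁ t₃ =
        boxSum φ a₂ t₂ a₃ t₃ + boxSum φ a₁ t₁ a₃ t₂ := by
  obtain ⟨n12, n21⟩ := not_dvd_sub_of_lt (Λ := Λ) ht (by omega)
  obtain ⟨n23, n32⟩ := not_dvd_sub_of_lt (Λ := Λ) ht' (by omega)
  obtain ⟨n13, n31⟩ := not_dvd_sub_of_lt (Λ := Λ) (ht.trans ht') (by omega)
  obtain ⟨Y, hY, b1⟩ := hX.exists_low x1 x3 h2 (by omega) (by omega) (by omega)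
  have y2 := (b1.agree a₂ t₂ n12 n32).1 x2
  obtain ⟨Z, hZ, b2⟩ := hY.exists_low y2 b1.ul h1 (by omega) ht' (by omega)
  obtain ⟨Y', hY', b3⟩ := hX.exists_low x2 x3 (by omega) (by omega) ht' (by omega)
  have y1' := (b3.agree a₁ t₁ n21 n31).1 x1
  obtain ⟨Z', hZ', b4⟩ := hY'.exists_low y1' b3.lr h2 (by omega) ht (by omega)
  have hZZ : Z' = Z := by
    funext s t
    refine propext (iff_of_three_rows hZ' hZ (X := X) (Y := Y') (Y' := Y)
      b4.lr ((b2.agree a₃ t₁ n21 n31).1 b1.lr) b4.ul b2.lr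
      ((b4.agree a₂ t₃ n13 n23).1 b3.ul) b2.ul fun k1 k2 k3 => ?_)
    exact ⟨⟨b3.agree s t k2 k3, b4.agree s t k1 k2⟩, b1.agree s t k1 k3, b2.agree s t k2 k3⟩
  subst hZZ
  refine ⟨Y, Y', Z', hY, hY', hZ', b1, b2, b3, b4, fun φ => ?_⟩
  rw [boxSum_split_y φ a₁ a₃ ht.le ht'.le, boxSum_split_x φ t₂ t₃ h1.le h2.le]
  omega

/-- Two low rectangles with four different horizontal circles can be exchanged. -/
theorem IsGen.exists_exchange (hX : Λ.IsGen X) {c d c' d' : ℤ} (x1 : X a b) (x2 : X a' b')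
    (x3 : X c d) (x4 : X c' d') (ha : a < a') (ha' : a' < a + Λ.N) (hb : b < b')
    (hb' : b' < b + Λ.n) (hc : c < c') (hc' : c' < c + Λ.N) (hd : d < d') (hd' : d' < d + Λ.n)
    (n1 : ¬ (Λ.n : ℤ) ∣ d - b) (n2 : ¬ (Λ.n : ℤ) ∣ d - b')
    (n3 : ¬ (Λ.n : ℤ) ∣ d' - b) (n4 : ¬ (Λ.n : ℤ) ∣ d' - b') :
    ∃ Y Y' Z, Λ.IsGen Y ∧ Λ.IsGen Y' ∧ Λ.IsGen Z ∧ Λ.IsBox X Y a b a' b' ∧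
      Λ.IsBox Y Z c d c' d' ∧ Λ.IsBox X Y' c d c' d' ∧ Λ.IsBox Y' Z a b a' b' := by
  have n1' := fun h => n1 (dvd_symm_sub h)
  have n2' := fun h => n2 (dvd_symm_sub h)
  have n3' := fun h => n3 (dvd_symm_sub h)
  have n4' := fun h => n4 (dvd_symm_sub h)
  obtain ⟨Y, hY, b1⟩ := hX.exists_low x1 x2 ha ha' hb hb'
  obtain ⟨Z, hZ, b2⟩ := hY.exists_low ((b1.agree _ _ n1 n2).1 x3) ((b1.agree _ _ n3 n4).1 x4)
    hc hc' hd hd'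
  obtain ⟨Y', hY', b3⟩ := hX.exists_low x3 x4 hc hc' hd hd'
  obtain ⟨Z', hZ', b4⟩ := hY'.exists_low ((b3.agree _ _ n1' n3').1 x1)
    ((b3.agree _ _ n2' n4').1 x2) ha ha' hb hb'
  have hZZ : Z' = Z := by
    funext s t
    by_cases k : (Λ.n : ℤ) ∣ t - d
    · exact propext (hZ'.iff_of_row hZ
        ((b4.agree c' d n1 n2).1 b3.lr) b2.lr k)
    · refine propext (iff_of_three_rows hZ' hZ (X := X) (Y := Y') (Y' := Y)
        b4.lr ((b2.agree a' b n1' n3').1 b1.lr) b4.ul ((b2.agree a b' n2' n4').1 b1.ul)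
        ((b4.agree c d' n3 n4).1 b3.ul) b2.ul fun k1 k2 k3 => ?_)
      exact ⟨⟨b3.agree s t k k3, b4.agree s t k1 k2⟩, b1.agree s t k1 k2, b2.agree s t k k3⟩
  subst hZZ
  exact ⟨Y, Y', Z', hY, hY', hZ', b1, b2, b3, b4⟩

end GridLattice

/-! ### Groups generated by affine transpositions -/

section AffineTranspositions

variable {ι M : Type*} [Group M] [LinearOrder ι]

/-- The relations of the involutions that exchange the horizontal circles `i` and `j` along the
arc going up from `i` to `j`; the arcs from `i` to `j` and from `j` to `i` differ.  The convention
`T i i = 1` is used. -/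
structure AffineFamily (T : ι → ι → M) : Prop where
  refl : ∀ i, T i i = 1
  mul_self : ∀ i j, T i j * T i j = 1
  comm : ∀ i j k l, i ≠ k → i ≠ l → j ≠ k → j ≠ l → T i j * T k l = T k l * T i j
  cyc : ∀ i j k, (i < j ∧ j < k) ∨ (j < k ∧ k < i) ∨ (k < i ∧ i < j) →
    T i k = T i j * T j k * T i j ∧ T i k = T j k * T i j * T j k

theorem mul_conj_of_involutions {a b c : M} (ha : a * a = 1) (hb : b * b = 1)
    (h1 : c = a * b * a) (h2 : c = b * a * b) :
    b * c * b = a ∧ a * c * a = b ∧ c * a * c = b ∧ c * b * c = a := by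
  have ha' := inv_eq_of_mul_eq_one_left ha
  have hb' := inv_eq_of_mul_eq_one_left hb
  have e1 : b * c * b = a := by
    rw [h2, ← mul_assoc, ← mul_assoc, hb, one_mul, mul_assoc, hb, mul_one]
  have e2 : a * c * a = b := by
    rw [h1, ← mul_assoc, ← mul_assoc, ha, one_mul, mul_assoc, ha, mul_one]
  refine ⟨e1, e2, ?_, ?_⟩
  · calc c * a * c = (b * a * b) * a * (a * b * a) := by rw [← h2, ← h1]
      _ = b * a * (b * (a * a) * b) * a := by simp only [mul_assoc]
      _ = b := by rw [ha, mul_one, hb, mul_one, mul_assoc, ha, mul_one]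
  · calc c * b * c = (a * b * a) * b * (b * a * b) := by rw [← h2, ← h1]
      _ = a * b * (a * (b * b) * a) * b := by simp only [mul_assoc]
      _ = a := by rw [hb, mul_one, ha, mul_one, mul_assoc, hb, mul_one]

namespace AffineFamily

variable {T : ι → ι → M}

/-- The involution along the arc that does not cross the top of the planar grid. -/
def planar (T : ι → ι → M) (i j : ι) : M := T (min i j) (max i j)

/-- The translation obtained by going along both arcs between `i` and `j`. -/
def translation (T : ι → ι → M) (i j : ι) : M := T i j * T j i

theorem planar_of_lt {i j : ι} (h : i < j) : planar T i j = T i j := by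
  rw [planar, min_eq_left h.le, max_eq_right h.le]

theorem planar_symm (i j : ι) : planar T i j = planar T j i := by
  rw [planar, planar, min_comm, max_comm]

theorem planar_of_gt {i j : ι} (h : j < i) : planar T i j = T j i := by
  rw [planar_symm, planar_of_lt h]

theorem planar_eq (i j : ι) : planar T i j = T i j ∨ planar T i j = T j i := by
  rcases le_total i j with h | h
  · left; rw [planar, min_eq_left h, max_eq_right h]
  · right; rw [planar, min_eq_right h, max_eq_left h]

theorem planar_mul_self (hT : AffineFamily T) (i j : ι) : planar T i j * planar T i j = 1 :=
  hT.mul_self _ _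

theorem triangle_of_lt (hT : AffineFamily T) {a b c : ι} (h1 : a < b) (h2 : b < c) :
    T a c = T a b * T b c * T a b ∧ T a c = T b c * T a b * T b c :=
  hT.cyc a b c (Or.inl ⟨h1, h2⟩)

theorem transpositionFamily_planar (hT : AffineFamily T) : TranspositionFamily (planar T) where
  refl i := by rw [planar, min_self, max_self, hT.refl]
  symm := planar_symm
  mul_self := hT.planar_mul_self
  comm i j k l h1 h2 h3 h4 := by
    rcases planar_eq (T := T) i j with e | e <;> rcases planar_eq (T := T) k l with e' | e' <;>
      rw [e, e'] <;> apply hT.comm <;> assumption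
  triangle i j k hij hjk hik := by
    have key : ∀ {a b c : ι}, a < b → b < c → _ := fun h1 h2 =>
      mul_conj_of_involutions (hT.mul_self _ _) (hT.mul_self _ _) (hT.triangle_of_lt h1 h2).1
        (hT.triangle_of_lt h1 h2).2
    rcases lt_or_gt_of_ne hij with h1 | h1 <;> rcases lt_or_gt_of_ne hjk with h2 | h2 <;>
      rcases lt_or_gt_of_ne hik with h3 | h3
    · rw [planar_of_lt h1, planar_of_lt h2, planar_of_lt h3]
      exact (hT.triangle_of_lt h1 h2).1.symm
    · exact absurd (h1.trans h2) h3.asymm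
    · rw [planar_of_lt h1, planar_of_gt h2, planar_of_lt h3]
      exact (key h3 h2).2.2.2
    · rw [planar_of_lt h1, planar_of_gt h2, planar_of_gt h3]
      exact (key h3 h1).1
    · rw [planar_of_gt h1, planar_of_lt h2, planar_of_lt h3]
      exact (key h1 h3).2.1
    · rw [planar_of_gt h1, planar_of_lt h2, planar_of_gt h3]
      exact (key h2 h3).2.2.1
    · exact absurd (h2.trans h1) h3.asymm
    · rw [planar_of_gt h1, planar_of_gt h2, planar_of_gt h3]
      exact (hT.triangle_of_lt h2 h1).2.symm

theorem translation_mul_symm (hT : AffineFamily T) (i j : ι) :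
    translation T i j * translation T j i = 1 := by
  unfold translation
  rw [mul_assoc, ← mul_assoc (T j i) (T j i), hT.mul_self, one_mul, hT.mul_self]

theorem translation_inv (hT : AffineFamily T) (i j : ι) :
    (translation T i j)⁻¹ = translation T j i :=
  inv_eq_of_mul_eq_one_right (hT.translation_mul_symm i j)

theorem conj_planar_mul (hT : AffineFamily T) (k l : ι) (x y : M) :
    planar T k l * (x * y) * planar T k l =
      (planar T k l * x * planar T k l) * (planar T k l * y * planar T k l) := by
  have h := hT.planar_mul_self k l
  calc planar T k l * (x * y) * planar T k l
      = planar T k l * x * 1 * y * planar T k l := by simp only [mul_assoc, mul_one]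
    _ = _ := by rw [← h]; simp only [mul_assoc]

theorem conj_planar_inv (hT : AffineFamily T) (k l : ι) (x : M) :
    planar T k l * x⁻¹ * planar T k l = (planar T k l * x * planar T k l)⁻¹ := by
  have h : (planar T k l)⁻¹ = planar T k l := inv_eq_of_mul_eq_one_left (hT.planar_mul_self k l)
  rw [mul_inv_rev, mul_inv_rev, h, mul_assoc]

theorem conj_planar_symm (hT : AffineFamily T) {k l : ι} {x y : M}
    (h : planar T k l * x * planar T k l = y) : planar T k l * y * planar T k l = x := by
  have e := hT.planar_mul_self k l
  rw [← h, ← mul_assoc, ← mul_assoc, e, one_mul, mul_assoc, e, mul_one]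

/-- The arcs crossing the top of the planar grid are permuted by planar involutions. -/
theorem conj_wrap (hT : AffineFamily T) {a b c : ι} (h1 : a < b) (h2 : b < c) :
    T b c * T c a * T b c = T b a ∧ T a b * T c a * T a b = T c b :=
  ⟨(hT.cyc b c a (Or.inr (Or.inr ⟨h1, h2⟩))).1.symm,
    (hT.cyc c a b (Or.inr (Or.inl ⟨h1, h2⟩))).2.symm⟩

theorem conj_translation_self (hT : AffineFamily T) (i j : ι) :
    planar T i j * translation T i j * planar T i j = translation T j i := by
  unfold translation
  rcases planar_eq (T := T) i j with e | e <;> rw [e]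
  · rw [← mul_assoc, hT.mul_self, one_mul]
  · rw [mul_assoc, mul_assoc, hT.mul_self, mul_one]

theorem conj_translation_of_lt (hT : AffineFamily T) {a b c : ι} (h1 : a < b) (h2 : b < c) :
    planar T b c * translation T a c * planar T b c = translation T a b ∧
      planar T a b * translation T a c * planar T a b = translation T b c := by
  have ht := hT.transpositionFamily_planar
  have w := hT.conj_wrap h1 h2
  rw [← planar_of_lt (T := T) h1, ← planar_of_lt (T := T) h2] at w
  have e1 := ht.triangle b c a h2.ne (h1.trans h2).ne' h1.ne'
  have e2 := ht.triangle b a c h1.ne' (h1.trans h2).ne h2.ne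
  rw [planar_symm c a, planar_symm b a] at e1
  rw [planar_symm b a] at e2
  unfold translation
  rw [hT.conj_planar_mul, hT.conj_planar_mul, w.1, w.2, ← planar_of_lt (T := T) h1,
    ← planar_of_lt (T := T) h2, ← planar_of_lt (T := T) (h1.trans h2), e1, e2]
  exact ⟨rfl, rfl⟩

/-- A planar involution permutes the translations involving exactly one of its two circles. -/
theorem conj_translation (hT : AffineFamily T) {i j k : ι} (hij : i ≠ j) (hjk : j ≠ k)
    (hik : i ≠ k) : planar T j k * translation T i j * planar T j k = translation T i k := by
  have ht := hT.transpositionFamily_planar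
  -- the case in which the common circle is between the two others
  have mid : ∀ {a b c : ι}, a < b → b < c →
      planar T a c * translation T b a * planar T a c = translation T b c := by
    intro a b c h1 h2
    rw [← ht.triangle a b c h1.ne h2.ne (h1.trans h2).ne,
      ← (hT.conj_translation_of_lt h1 h2).2,
      ← hT.conj_planar_symm (hT.conj_translation_of_lt h1 h2).1, ← hT.conj_translation_self b a,
      planar_symm b a]
    simp only [mul_assoc]
  rcases lt_or_gt_of_ne hij with h1 | h1 <;> rcases lt_or_gt_of_ne hjk with h2 | h2 <;>
    rcases lt_or_gt_of_ne hik with h3 | h3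
  · exact hT.conj_planar_symm (hT.conj_translation_of_lt h1 h2).1
  · exact absurd (h1.trans h2) h3.asymm
  · rw [planar_symm]
    exact (hT.conj_translation_of_lt h3 h2).1
  · rw [planar_symm]
    exact hT.conj_planar_symm (mid h3 h1)
  · exact mid h1 h3
  · rw [← hT.translation_inv, hT.conj_planar_inv, (hT.conj_translation_of_lt h2 h3).2,
      hT.translation_inv]
  · exact absurd (h2.trans h1) h3.asymm
  · rw [planar_symm, ← hT.translation_inv, hT.conj_planar_inv,
      hT.conj_planar_symm (hT.conj_translation_of_lt h2 h1).2, hT.translation_inv]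

/-- The planar involutions normalize the set of translations. -/
theorem exists_planar_mul_translation (hT : AffineFamily T) (k l i j : ι) :
    ∃ i' j', translation T i j * planar T k l = planar T k l * translation T i' j' := by
  have ht := hT.transpositionFamily_planar
  suffices h : ∃ i' j', planar T k l * translation T i j * planar T k l = translation T i' j' by
    obtain ⟨i', j', h⟩ := h
    refine ⟨i', j', ?_⟩
    rw [← h, ← mul_assoc, ← mul_assoc, ht.mul_self, one_mul]
  by_cases hij : i = j
  · subst hij
    refine ⟨i, i, ?_⟩
    rw [translation, hT.refl, mul_one, mul_one, ht.mul_self]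
  by_cases hkl : k = l
  · subst hkl
    exact ⟨i, j, by rw [ht.refl, one_mul, mul_one]⟩
  by_cases h1 : j = k
  · subst h1
    by_cases h2 : i = l
    · subst h2
      exact ⟨j, i, by rw [planar_symm, hT.conj_translation_self]⟩
    · exact ⟨i, l, hT.conj_translation hij hkl h2⟩
  by_cases h2 : j = l
  · subst h2
    by_cases h3 : i = k
    · subst h3
      exact ⟨j, i, hT.conj_translation_self i j⟩
    · exact ⟨i, k, by rw [planar_symm]; exact hT.conj_translation hij h1 h3⟩
  by_cases h3 : i = k
  · subst h3
    refine ⟨l, j, ?_⟩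
    rw [← hT.translation_inv, hT.conj_planar_inv, hT.conj_translation (Ne.symm hij) hkl h2,
      hT.translation_inv]
  by_cases h4 : i = l
  · subst h4
    refine ⟨k, j, ?_⟩
    rw [← hT.translation_inv, hT.conj_planar_inv, planar_symm,
      hT.conj_translation (Ne.symm hij) (Ne.symm hkl) h1, hT.translation_inv]
  · refine ⟨i, j, ?_⟩
    have c : ∀ i j, i ≠ k → i ≠ l → j ≠ k → j ≠ l →
        planar T k l * T i j = T i j * planar T k l := by
      intro i j h1 h2 h3 h4
      rcases planar_eq (T := T) k l with e | e <;> rw [e] <;> apply hT.comm <;>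
        first | assumption | (apply Ne.symm; assumption)
    unfold translation
    rw [← mul_assoc, c i j h3 h4 h1 h2, mul_assoc, mul_assoc, ← mul_assoc (planar T k l),
      c j i h1 h2 h3 h4, mul_assoc, ht.mul_self, mul_one]

/-- A planar group element can be moved to the left of a translation. -/
theorem exists_mul_translation (hT : AffineFamily T) {s : Finset ι} {κ : M}
    (hκ : κ ∈ transpositionClosure (planar T) s) (i j : ι) :
    ∃ i' j', translation T i j * κ = κ * translation T i' j' := by
  have ht := hT.transpositionFamily_planar
  have inv : ∀ i j, (planar T i j)⁻¹ = planar T i j := fun i j =>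
    inv_eq_of_mul_eq_one_left (ht.mul_self i j)
  refine Subgroup.closure_induction_left (p := fun κ _ => ∀ i j, ∃ i' j',
    translation T i j * κ = κ * translation T i' j') ?_ ?_ ?_ hκ i j
  · exact fun i j => ⟨i, j, by rw [mul_one, one_mul]⟩
  · rintro _ ⟨k, -, l, -, rfl⟩ y _ hy i j
    obtain ⟨i', j', e⟩ := hT.exists_planar_mul_translation k l i j
    obtain ⟨i'', j'', e'⟩ := hy i' j'
    exact ⟨i'', j'', by rw [← mul_assoc, e, mul_assoc, e', mul_assoc]⟩
  · rintro _ ⟨k, -, l, -, rfl⟩ y _ hy i j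
    rw [inv]
    obtain ⟨i', j', e⟩ := hT.exists_planar_mul_translation k l i j
    obtain ⟨i'', j'', e'⟩ := hy i' j'
    exact ⟨i'', j'', by rw [← mul_assoc, e, mul_assoc, e', mul_assoc]⟩

theorem eq_conj_mul_of_mul_eq {x y d u g : M} (hx : x * x = 1) (hy : y * y = 1)
    (hu : x * y * x = u) (h : u * g = x * d * y * (x * d)) : g = x * (y * d * y) * x * d := by
  have hu' : u⁻¹ = x * y * x := by
    rw [← hu, mul_inv_rev, mul_inv_rev, inv_eq_of_mul_eq_one_left hx,
      inv_eq_of_mul_eq_one_left hy, mul_assoc]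
  rw [← inv_mul_cancel_left u g, h, hu']
  calc x * y * x * (x * d * y * (x * d)) = x * y * (x * x) * d * y * x * d := by
        simp only [mul_assoc]
    _ = _ := by rw [hx]; simp only [mul_assoc, one_mul]

/-- The relation between the translations of three circles. -/
theorem translation_eq_of_lt (hT : AffineFamily T) {a b c : ι} (h1 : a < b) (h2 : b < c) :
    translation T a b = translation T c b * translation T a c ∧
      translation T b c = translation T b a * translation T a c := by
  have ht := hT.transpositionFamily_planar
  have hac := h1.trans h2
  have w1 := (hT.cyc b c a (Or.inr (Or.inr ⟨h1, h2⟩))).2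
  have w2 := (hT.cyc c a b (Or.inr (Or.inl ⟨h1, h2⟩))).1
  have wrap : ∀ {i j : ι}, i < j → T j i = planar T i j * translation T i j := by
    intro i j h
    rw [translation, planar_of_lt h, ← mul_assoc, hT.mul_self, one_mul]
  have e1 := ht.triangle a c b hac.ne h2.ne' h1.ne
  have e2 := ht.triangle c a b hac.ne' h1.ne h2.ne'
  rw [planar_symm c a, planar_symm c b] at e2
  rw [planar_symm c b] at e1
  have c1 := hT.conj_translation_of_lt h1 h2
  have s1 : planar T a c * translation T a b * planar T a c = translation T c b := by
    rw [← hT.translation_inv, hT.conj_planar_inv, hT.conj_translation h1.ne' hac.ne h2.ne,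
      hT.translation_inv]
  have s2 : planar T a c * translation T b c * planar T a c = translation T b a := by
    rw [planar_symm]
    exact hT.conj_translation h2.ne hac.ne' h1.ne'
  -- Write the arcs that cross the top as planar involutions times translations, and cancel the
  -- planar parts in the relations between them.
  rw [wrap h1, wrap hac, ← planar_of_lt (T := T) h2, mul_assoc, ← mul_assoc] at w1
  rw [wrap h2, wrap hac, ← planar_of_lt (T := T) h1, mul_assoc, ← mul_assoc] at w2
  refine ⟨?_, ?_⟩
  · rw [← s1, ← c1.1]
    exact eq_conj_mul_of_mul_eq (ht.mul_self _ _) (ht.mul_self _ _) e1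
      (by rw [c1.1]; simpa only [mul_assoc] using w1)
  · rw [← s2, ← c1.2]
    exact eq_conj_mul_of_mul_eq (ht.mul_self _ _) (ht.mul_self _ _) e2
      (by rw [c1.2]; simpa only [mul_assoc] using w2)

section Bottom

variable {o : ι}

/-- By the two relations of `translation_eq_of_lt`, a translation `translation T b c` is the left
as well as the right quotient of `translation T o c` by `translation T o b`. -/
theorem translation_comm (hT : AffineFamily T) (ho : ∀ i, o ≤ i) (i j : ι) :
    Commute (translation T o i) (translation T o j) := by
  have hrefl : translation T o o = 1 := by rw [translation, hT.refl, one_mul]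
  have key : ∀ {b c : ι}, o < b → b < c → Commute (translation T o b) (translation T o c) := by
    intro b c h1 h2
    obtain ⟨e1, e2⟩ := hT.translation_eq_of_lt h1 h2
    rw [← hT.translation_inv b c, e2, mul_inv_rev, hT.translation_inv b o] at e1
    have : translation T o c * translation T o b = translation T o b * translation T o c := by
      conv_lhs => rw [e1]
      rw [mul_assoc, mul_inv_cancel_left]
    exact this.symm
  rcases (ho i).eq_or_lt with rfl | hi
  · rw [hrefl]; exact Commute.one_left _
  rcases (ho j).eq_or_lt with rfl | hj
  · rw [hrefl]; exact Commute.one_right _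
  rcases lt_trichotomy i j with h | rfl | h
  · exact key hi h
  · exact Commute.refl _
  · exact (key hj h).symm

theorem translation_eq (hT : AffineFamily T) (ho : ∀ i, o ≤ i) (i j : ι) :
    translation T i j = (translation T o i)⁻¹ * translation T o j := by
  have hrefl : ∀ i, translation T i i = 1 := fun i => by rw [translation, hT.refl, one_mul]
  have key : ∀ {b c : ι}, b < c → translation T b c = (translation T o b)⁻¹ * translation T o c := by
    intro b c h
    rcases (ho b).eq_or_lt with rfl | hb
    · rw [hrefl, inv_one, one_mul]
    · rw [hT.translation_inv]
      exact (hT.translation_eq_of_lt hb h).2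
  rcases lt_trichotomy i j with h | rfl | h
  · exact key h
  · rw [hrefl, inv_mul_cancel]
  · rw [← hT.translation_inv, key h, mul_inv_rev, inv_inv]

variable [Fintype ι]

theorem pairwise_commute_translation (hT : AffineFamily T) (ho : ∀ i, o ≤ i) :
    Pairwise fun i j => ∀ x y : Multiplicative ℤ,
      Commute (zpowersHom M (translation T o i) x) (zpowersHom M (translation T o j) y) := by
  intro i j _ x y
  rw [zpowersHom_apply, zpowersHom_apply]
  exact ((hT.translation_comm ho i j).zpow_left _).zpow_right _

/-- The homomorphism from `ℤ^ι` onto the group generated by the translations. -/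
def translationHom (hT : AffineFamily T) (ho : ∀ i, o ≤ i) : (ι → Multiplicative ℤ) →* M :=
  MonoidHom.noncommPiCoprod (fun j => zpowersHom M (translation T o j))
    (hT.pairwise_commute_translation ho)

theorem translationHom_mulSingle (hT : AffineFamily T) (ho : ∀ i, o ≤ i) (j : ι)
    (m : Multiplicative ℤ) : hT.translationHom ho (Pi.mulSingle j m) =
      translation T o j ^ m.toAdd := by
  rw [translationHom, MonoidHom.noncommPiCoprod_mulSingle, zpowersHom_apply]

theorem translationHom_eq_one (hT : AffineFamily T) (ho : ∀ i, o ≤ i) {k : ι → Multiplicative ℤ}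
    (h : ∀ j, translation T o j ^ (k j).toAdd = 1) : hT.translationHom ho k = 1 := by
  refine (Finset.noncommProd_eq_pow_card _ _
    (fun _ _ _ _ h => hT.pairwise_commute_translation ho h _ _) 1 fun j _ => ?_).trans (one_pow _)
  rw [zpowersHom_apply]
  exact h j

theorem exists_eq_translationHom (hT : AffineFamily T) (ho : ∀ i, o ≤ i) (i j : ι) :
    ∃ k, translation T i j = hT.translationHom ho k := by
  refine ⟨(Pi.mulSingle i (Multiplicative.ofAdd 1))⁻¹ * Pi.mulSingle j (Multiplicative.ofAdd 1), ?_⟩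
  rw [map_mul, map_inv, translationHom_mulSingle, translationHom_mulSingle, toAdd_ofAdd, zpow_one,
    zpow_one, hT.translation_eq ho]

/-- Every element of the group is the product of a permutation and of a translation. -/
theorem exists_eq_mul_translationHom (hT : AffineFamily T) (ho : ∀ i, o ≤ i) {g : M}
    (hg : g ∈ Subgroup.closure {g | ∃ i j, g = T i j}) :
    ∃ κ ∈ transpositionClosure (planar T) Finset.univ, ∃ k, g = κ * hT.translationHom ho k := by
  have inv : ∀ i j, (T i j)⁻¹ = T i j := fun i j => inv_eq_of_mul_eq_one_left (hT.mul_self i j)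
  have mem : ∀ i j, planar T i j ∈ transpositionClosure (planar T) Finset.univ := fun i j =>
    Subgroup.subset_closure ⟨i, Finset.mem_univ _, j, Finset.mem_univ _, rfl⟩
  have gen : ∀ (i j : ι) (y : M), (∃ κ ∈ transpositionClosure (planar T) Finset.univ,
        ∃ k, y = κ * hT.translationHom ho k) →
      ∃ κ ∈ transpositionClosure (planar T) Finset.univ,
        ∃ k, T i j * y = κ * hT.translationHom ho k := by
    rintro i j y ⟨κ, hκ, k, rfl⟩
    rcases planar_eq (T := T) i j with e | e
    · exact ⟨_, mul_mem (mem i j) hκ, k, by rw [e, mul_assoc]⟩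
    · obtain ⟨i', j', e'⟩ := hT.exists_mul_translation hκ j i
      obtain ⟨k', hk'⟩ := hT.exists_eq_translationHom ho i' j'
      refine ⟨_, mul_mem (mem i j) hκ, k' * k, ?_⟩
      have e2 : T i j = planar T i j * translation T j i := by
        rw [e, translation, ← mul_assoc, hT.mul_self, one_mul]
      rw [e2, mul_assoc, ← mul_assoc (translation T j i), e', hk', map_mul]
      simp only [mul_assoc]
  refine Subgroup.closure_induction_left (p := fun g _ =>
    ∃ κ ∈ transpositionClosure (planar T) Finset.univ,
      ∃ k, g = κ * hT.translationHom ho k) ?_ ?_ ?_ hg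
  · exact ⟨1, one_mem _, 1, by rw [map_one, mul_one]⟩
  · rintro _ ⟨i, j, rfl⟩ y _ hy
    exact gen i j y hy
  · rintro _ ⟨i, j, rfl⟩ y _ hy
    rw [inv]
    exact gen i j y hy

end Bottom

end AffineFamily

end AffineTranspositions

/-! ### Flat sign functions -/

section Flat

variable {n p : ℕ} {q : ℤ}

/-- A sign function is flat if its value on a pair of rectangles depends only on the domain, and is
`1` on annuli. -/
structure IsFlat (c : SignFunction n p q) : Prop where
  polygon : ∀ (x z : Generator n p) (P Q : Concat q x z), P.domain = Q.domain →
    c.onConcat P = c.onConcat Q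
  horizontal : ∀ (x : Generator n p) (P : Concat q x x), P.IsHorizontalAnnulus → c.onConcat P = 1
  vertical : ∀ (x : Generator n p) (P : Concat q x x), P.IsVerticalAnnulus → c.onConcat P = 1

/-- The quotient of two sign assignments is flat; as the values are signs, it is their product. -/
theorem IsSignAssignment.isFlat_mul {S S' : SignFunction n p q} (hS : IsSignAssignment S)
    (hS' : IsSignAssignment S') : IsFlat fun x y r => S x y r * S' x y r := by
  have e : ∀ {x z : Generator n p} (P : Concat q x z),
      SignFunction.onConcat (fun x y r => S x y r * S' x y r) P =
        S.onConcat P * S'.onConcat P := fun P => mul_mul_mul_comm _ _ _ _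
  refine ⟨fun x z P Q h => ?_, fun x P h => ?_, fun x P h => ?_⟩
  · by_cases hPQ : P = Q
    · rw [hPQ]
    · rw [e, e, hS.polygon x z P Q hPQ h, hS'.polygon x z P Q hPQ h, neg_mul_neg]
  · rw [e, hS.horizontal x P h, hS'.horizontal x P h, one_mul]
  · rw [e, hS.vertical x P h, hS'.vertical x P h, neg_mul_neg, one_mul]

variable [NeZero n] [NeZero p]

/-- Two horizontal circles carry the edges of a rectangle of height less than `n`. -/
theorem exists_rows (hpq : IsCoprime (p : ℤ) q) (x : Generator n p) {l m : Fin n} (h : l ≠ m) :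
    ∃ a b a' b' : ℤ, x.OnLift q a b ∧ x.OnLift q a' b' ∧ a < a' ∧ a' < a + (n * p : ℕ) ∧ b < b' ∧
      b' < b + n ∧ rowIndex n b = l ∧ rowIndex n b' = m := by
  have hne : (l : ℕ) ≠ m := fun e => h (Fin.ext e)
  have hl := l.2
  have hm := m.2
  obtain ⟨b', h1, h2, h3⟩ : ∃ b' : ℤ, ((l : ℕ) : ℤ) < b' ∧ b' < ((l : ℕ) : ℤ) + n ∧
      (n : ℤ) ∣ b' - ((m : ℕ) : ℤ) := by
    rcases lt_or_gt_of_ne hne with hlt | hlt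
    · exact ⟨((m : ℕ) : ℤ), by omega, by omega, by simp⟩
    · exact ⟨((m : ℕ) : ℤ) + n, by omega, by omega, by simp⟩
  obtain ⟨a', k1, k2, k3⟩ := (isGen_onLift hpq x).exists_mem_row' (onLift_col x l) (b := b')
    (GridLattice.not_dvd_of_pos_of_lt (k := (n : ℤ)) (by omega) (by omega))
  exact ⟨_, _, a', b', onLift_col x l, k1, k2, k3, h1, h2, rowIndex_fin l, rowIndex_eq_iff.2 h3⟩

theorem exists_low_rect (hpq : IsCoprime (p : ℤ) q) (x : Generator n p) {l m : Fin n}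
    (h : l ≠ m) : ∃ y, ∃ r : Rect q x y, r.bot = l ∧ r.top = m ∧ r.height < n := by
  obtain ⟨a, b, a', b', h1, h2, h3, h4, h5, h6, h7, h8⟩ := exists_rows hpq x h
  obtain ⟨Y, hY, hb⟩ := (isGen_onLift hpq x).exists_low h1 h2 h3 h4 h5 h6
  obtain ⟨y, rfl⟩ := exists_generator hpq hY
  exact ⟨y, Rect.ofBox hpq hb, h7, h8, by simp only [Rect.ofBox]; omega⟩

/-- The generator at the end of the rectangle of height less than `n` from `x` whose bottom and top
edges are on `α_l` and `α_m`. -/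
def lowTarget (hpq : IsCoprime (p : ℤ) q) (x : Generator n p) {l m : Fin n} (h : l ≠ m) :
    Generator n p := (exists_low_rect hpq x h).choose

/-- The rectangle of height less than `n` from `x` whose bottom and top edges are on `α_l` and
`α_m`. -/
def lowRect (hpq : IsCoprime (p : ℤ) q) (x : Generator n p) {l m : Fin n} (h : l ≠ m) :
    Rect q x (lowTarget hpq x h) := (exists_low_rect hpq x h).choose_spec.choose

theorem lowRect_spec (hpq : IsCoprime (p : ℤ) q) (x : Generator n p) {l m : Fin n} (h : l ≠ m) :
    (lowRect hpq x h).bot = l ∧ (lowRect hpq x h).top = m ∧ (lowRect hpq x h).height < n :=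
  (exists_low_rect hpq x h).choose_spec.choose_spec

/-- Parallel transport along the rectangles of height less than `n`, with the signs of `c`. -/
def lowStep (hpq : IsCoprime (p : ℤ) q) (c : SignFunction n p q) (l m : Fin n)
    (u : Generator n p × ℤˣ) : Generator n p × ℤˣ :=
  if h : l = m then u else (lowTarget hpq u.1 h, u.2 * c _ _ (lowRect hpq u.1 h))

variable {hpq : IsCoprime (p : ℤ) q} {c : SignFunction n p q} {x y z : Generator n p}

theorem Rect.height_eq_of_low {y' : Generator n p} {r : Rect q x y} {s : Rect q x y'}
    (hb : r.bot = s.bot) (ht : r.top = s.top) (hr : r.height < n) (hs : s.height < n) :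
    r.height = s.height := by
  have h1 := r.dvd_top
  have h2 := s.dvd_top
  rw [← hb, ← ht] at h2
  have h3 := dvd_sub h1 h2
  rw [sub_sub_sub_cancel_right, add_sub_add_left_eq_sub] at h3
  have := Int.eq_zero_of_abs_lt_dvd h3 (by rw [abs_lt]; constructor <;> omega)
  omega

theorem lowStep_rect (r : Rect q x y) (hr : r.height < n) (e : ℤˣ) :
    lowStep hpq c r.bot r.top (x, e) = (y, e * c x y r) := by
  have key : ∀ (y' : Generator n p) (s : Rect q x y'), s.bot = r.bot → s.top = r.top →
      s.height < n → (y', e * c x y' s) = (y, e * c x y r) := by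
    intro y' s h1 h2 h3
    have hh := Rect.height_eq_of_low h1 h2 h3 hr
    have hw := Rect.width_eq hpq h1 hh
    obtain rfl : y' = y := Rect.target_eq hpq h1 hw hh
    rw [Rect.eq_of_eq h1 hw hh]
  obtain ⟨h1, h2, h3⟩ := lowRect_spec hpq x r.bot_ne_top
  unfold lowStep
  rw [dif_neg r.bot_ne_top]
  exact key _ _ h1 h2 h3

variable {a b a' b' : ℤ}

theorem lowStep_box (h : (torusLattice n p hpq).IsBox (fun s t => x.OnLift q s t)
    (fun s t => y.OnLift q s t) a b a' b') (hb : b' - b < n) (e : ℤˣ) :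
    lowStep hpq c (rowIndex n b) (rowIndex n b') (x, e) = (y, e * c x y (Rect.ofBox hpq h)) :=
  lowStep_rect (Rect.ofBox hpq h) (by have := h.hy; simp only [Rect.ofBox]; omega) e

theorem IsFlat.box (hc : IsFlat c) {y' : Generator n p}
    {a₁ b₁ a₁' b₁' a₂ b₂ a₂' b₂' a₃ b₃ a₃' b₃' a₄ b₄ a₄' b₄' : ℤ}
    (h₁ : (torusLattice n p hpq).IsBox (fun s t => x.OnLift q s t)
      (fun s t => y.OnLift q s t) a₁ b₁ a₁' b₁')
    (h₂ : (torusLattice n p hpq).IsBox (fun s t => y.OnLift q s t)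
      (fun s t => z.OnLift q s t) a₂ b₂ a₂' b₂')
    (h₃ : (torusLattice n p hpq).IsBox (fun s t => x.OnLift q s t)
      (fun s t => y'.OnLift q s t) a₃ b₃ a₃' b₃')
    (h₄ : (torusLattice n p hpq).IsBox (fun s t => y'.OnLift q s t)
      (fun s t => z.OnLift q s t) a₄ b₄ a₄' b₄')
    (hφ : ∀ φ, (torusLattice n p hpq).Periodic φ → boxSum φ a₁ b₁ a₁' b₁' + boxSum φ a₂ b₂ a₂' b₂' =
      boxSum φ a₃ b₃ a₃' b₃' + boxSum φ a₄ b₄ a₄' b₄') :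
    c x y (Rect.ofBox hpq h₁) * c y z (Rect.ofBox hpq h₂) =
      c x y' (Rect.ofBox hpq h₃) * c y' z (Rect.ofBox hpq h₄) := by
  refine hc.polygon x z ⟨y, Rect.ofBox hpq h₁, Rect.ofBox hpq h₂⟩
    ⟨y', Rect.ofBox hpq h₃, Rect.ofBox hpq h₄⟩ ?_
  funext k l
  change (Rect.ofBox hpq h₁).mult k l + (Rect.ofBox hpq h₂).mult k l =
    (Rect.ofBox hpq h₃).mult k l + (Rect.ofBox hpq h₄).mult k l
  rw [mult_ofBox, mult_ofBox, mult_ofBox, mult_ofBox]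
  exact hφ _ (squareIndicator_periodic hpq k l)

theorem IsFlat.box_row (hc : IsFlat c)
    (h₁ : (torusLattice n p hpq).IsBox (fun s t => x.OnLift q s t)
      (fun s t => y.OnLift q s t) a b a' b')
    (h₂ : (torusLattice n p hpq).IsBox (fun s t => y.OnLift q s t)
      (fun s t => x.OnLift q s t) a' b (a + (n * p : ℕ)) b') :
    c x y (Rect.ofBox hpq h₁) * c y x (Rect.ofBox hpq h₂) = 1 := by
  refine hc.horizontal x ⟨y, Rect.ofBox hpq h₁, Rect.ofBox hpq h₂⟩ ⟨rfl, ?_, ?_⟩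
  · have := h₁.hx
    have := h₂.hx
    simp only [Rect.ofBox]
    omega
  · exact (Rect.ofBox hpq h₁).lower_right

theorem IsFlat.box_col (hc : IsFlat c)
    (h₁ : (torusLattice n p hpq).IsBox (fun s t => x.OnLift q s t)
      (fun s t => y.OnLift q s t) a b a' b')
    (h₂ : (torusLattice n p hpq).IsBox (fun s t => y.OnLift q s t)
      (fun s t => x.OnLift q s t) a b' a' (b + (n * p : ℕ))) :
    c x y (Rect.ofBox hpq h₁) * c y x (Rect.ofBox hpq h₂) = 1 := by
  refine hc.vertical x ⟨y, Rect.ofBox hpq h₁, Rect.ofBox hpq h₂⟩ ⟨rfl, ?_, ?_⟩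
  · have := h₁.hy
    have := h₂.hy
    simp only [Rect.ofBox]
    omega
  · exact (Rect.ofBox hpq h₁).upper_left

/-- The transport is an involution, by the value of `c` on horizontal annuli. -/
theorem lowStep_lowStep (hc : IsFlat c) (l m : Fin n) (u : Generator n p × ℤˣ) :
    lowStep hpq c l m (lowStep hpq c l m u) = u := by
  by_cases h : l = m
  · unfold lowStep
    simp only [h, dif_pos]
  obtain ⟨x, e⟩ := u
  obtain ⟨a, b, a', b', h1, h2, h3, h4, h5, h6, rfl, rfl⟩ := exists_rows hpq x h
  obtain ⟨Y, hY, hb⟩ := (isGen_onLift hpq x).exists_low h1 h2 h3 h4 h5 h6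
  obtain ⟨y, rfl⟩ := exists_generator hpq hY
  have hb' := hb.complement_row h4 (by change _ < (n : ℤ); omega) (isGen_onLift hpq x)
    (isGen_onLift hpq y)
  rw [lowStep_box hb (by omega), lowStep_box hb' (by omega), mul_assoc,
    show c x y (Rect.ofBox hpq hb) * c y x (Rect.ofBox hpq hb') = 1 from hc.box_row hb hb', mul_one]

/-- The parallel transports as permutations. -/
def lowPerm (hpq : IsCoprime (p : ℤ) q) (hc : IsFlat c) (l m : Fin n) :
    Equiv.Perm (Generator n p × ℤˣ) :=
  Function.Involutive.toPerm (lowStep hpq c l m) (lowStep_lowStep hc l m)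

theorem lowPerm_mul_self (hc : IsFlat c) (l m : Fin n) :
    lowPerm hpq hc l m * lowPerm hpq hc l m = 1 :=
  Equiv.ext fun u => lowStep_lowStep hc l m u

theorem lowPerm_refl (hc : IsFlat c) (l : Fin n) : lowPerm hpq hc l l = 1 :=
  Equiv.ext fun u => by
    change lowStep hpq c l l u = u
    unfold lowStep
    rw [dif_pos rfl]

theorem lowPerm_box (hc : IsFlat c) (h : (torusLattice n p hpq).IsBox (fun s t => x.OnLift q s t)
    (fun s t => y.OnLift q s t) a b a' b') (hb : b' - b < n) (e : ℤˣ) :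
    lowPerm hpq hc (rowIndex n b) (rowIndex n b') (x, e) = (y, e * c x y (Rect.ofBox hpq h)) :=
  lowStep_box h hb e

theorem lowPerm_comm (hc : IsFlat c) {i j k l : Fin n} (h1 : i ≠ k) (h2 : i ≠ l) (h3 : j ≠ k)
    (h4 : j ≠ l) : lowPerm hpq hc i j * lowPerm hpq hc k l =
      lowPerm hpq hc k l * lowPerm hpq hc i j := by
  by_cases hij : i = j
  · rw [hij, lowPerm_refl, one_mul, mul_one]
  by_cases hkl : k = l
  · rw [hkl, lowPerm_refl, one_mul, mul_one]
  refine Equiv.ext fun u => ?_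
  obtain ⟨x, e⟩ := u
  rw [Equiv.Perm.mul_apply, Equiv.Perm.mul_apply]
  obtain ⟨a, b, a', b', x1, x2, p1, p2, p3, p4, rfl, rfl⟩ := exists_rows hpq x hkl
  obtain ⟨d, f, d', f', x3, x4, p5, p6, p7, p8, rfl, rfl⟩ := exists_rows hpq x hij
  rw [Ne, rowIndex_eq_rowIndex_iff] at h1 h2 h3 h4
  obtain ⟨Y, Y', Z, hY, hY', hZ, b1, b2, b3, b4⟩ := (isGen_onLift hpq x).exists_exchange x1 x2 x3 x4
    p1 p2 p3 p4 p5 p6 p7 p8 h1 h2 h3 h4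
  obtain ⟨y, rfl⟩ := exists_generator hpq hY
  obtain ⟨y', rfl⟩ := exists_generator hpq hY'
  obtain ⟨z, rfl⟩ := exists_generator hpq hZ
  rw [lowPerm_box hc b1 (by omega), lowPerm_box hc b2 (by omega), lowPerm_box hc b3 (by omega),
    lowPerm_box hc b4 (by omega), mul_assoc, mul_assoc,
    hc.box b1 b2 b3 b4 fun φ _ => add_comm _ _]

/-- The points of `x` on three consecutive rows are in the position in which the rectangle between
the outer two rows avoids the point on the middle one. -/
def IsOuter (q : ℤ) (x : Generator n p) (t₁ t₂ t₃ : ℤ) : Prop :=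
  ∃ a₁ a₂ a₃ : ℤ, x.OnLift q a₁ t₁ ∧ x.OnLift q a₂ t₂ ∧ x.OnLift q a₃ t₃ ∧ a₁ < a₃ ∧ a₃ < a₂ ∧
    a₂ < a₁ + (n * p : ℕ)

theorem onLift_add_period (hpq : IsCoprime (p : ℤ) q) {s t : ℤ} (h : x.OnLift q s t) :
    x.OnLift q (s + (n * p : ℕ)) t := by
  have := (isGen_onLift hpq x).trans h ((torusLattice n p hpq).row.2 (dvd_refl _))
  rw [add_zero] at this
  exact this

theorem onLift_sub_period (hpq : IsCoprime (p : ℤ) q) {s t : ℤ} (h : x.OnLift q s t) :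
    x.OnLift q (s - (n * p : ℕ)) t := by
  have := (isGen_onLift hpq x).trans h
    (GridLattice.neg_mem ((torusLattice n p hpq).row.2 (dvd_refl _)))
  rw [neg_zero, add_zero] at this
  exact this

section ThreeRows

variable {t₁ t₂ t₃ : ℤ}

/-- The rectangle between the outer two rows exchanges the two possible positions. -/
theorem isOuter_or (h1 : t₁ < t₂) (h2 : t₂ < t₃) (h3 : t₃ < t₁ + n) (hc : IsFlat c)
    (u : Generator n p × ℤˣ) : IsOuter q u.1 t₁ t₂ t₃ ∨
      IsOuter q (lowPerm hpq hc (rowIndex n t₁) (rowIndex n t₃) u).1 t₁ t₂ t₃ := by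
  obtain ⟨x, e⟩ := u
  have nd : ∀ {s t : ℤ}, s < t → t < s + n → ¬ (n : ℤ) ∣ t - s := fun k1 k2 =>
    GridLattice.not_dvd_of_pos_of_lt (by omega) (by omega)
  obtain ⟨a₁, x1⟩ := (isGen_onLift hpq x).exRow t₁
  obtain ⟨a₂, x2, k1, k2⟩ := (isGen_onLift hpq x).exists_mem_row' x1 (nd h1 (by omega))
  obtain ⟨a₃, x3, k3, k4⟩ := (isGen_onLift hpq x).exists_mem_row' x1 (nd (h1.trans h2) (by omega))
  rcases lt_trichotomy a₂ a₃ with hlt | rfl | hlt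
  · right
    obtain ⟨Y, hY, hb⟩ := (isGen_onLift hpq x).exists_low x1 x3 k3 k4 (h1.trans h2) h3
    obtain ⟨y, rfl⟩ := exists_generator hpq hY
    rw [lowPerm_box hc hb (by omega)]
    have y2 := (hb.agree a₂ t₂ (nd h1 (by omega))
      (fun h => nd h2 (by omega) (GridLattice.dvd_symm_sub h))).1 x2
    change _ < a₁ + ((n * p : ℕ) : ℤ) at k2 k4
    exact ⟨a₃, _, _, hb.lr, onLift_add_period hpq y2, onLift_add_period hpq hb.ul, by omega,
      by omega, by omega⟩
  · exact absurd (by simp) ((isGen_onLift hpq x).ndvd_col x2 x3 (nd h2 (by omega)))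
  · exact Or.inl ⟨a₁, a₂, a₃, x1, x2, x3, k3, hlt, k2⟩

/-- The relations between the transports of three rows come from L-shaped polygons with the reflex
corner on the right and on the left. -/
theorem IsOuter.lowPerm_eq (h1 : t₁ < t₂) (h2 : t₂ < t₃) (h3 : t₃ < t₁ + n) (hc : IsFlat c)
    (hx : IsOuter q x t₁ t₂ t₃) (e : ℤˣ) :
    lowPerm hpq hc (rowIndex n t₁) (rowIndex n t₂)
        (lowPerm hpq hc (rowIndex n t₁) (rowIndex n t₃) (x, e)) =
      lowPerm hpq hc (rowIndex n t₂) (rowIndex n t₃)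
        (lowPerm hpq hc (rowIndex n t₁) (rowIndex n t₂) (x, e)) ∧
    lowPerm hpq hc (rowIndex n t₂) (rowIndex n t₃)
        (lowPerm hpq hc (rowIndex n t₁) (rowIndex n t₃) (x, e)) =
      lowPerm hpq hc (rowIndex n t₁) (rowIndex n t₂)
        (lowPerm hpq hc (rowIndex n t₂) (rowIndex n t₃) (x, e)) := by
  obtain ⟨a₁, a₂, a₃, x1, x2, x3, k1, k2, k3⟩ := hx
  constructor
  · obtain ⟨Y, Y', Z, hY, hY', hZ, b1, b2, b3, b4, hφ⟩ :=
      (isGen_onLift hpq x).exists_corner_right x1 x2 x3 h1 h2 h3 k1 k2 k3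
    obtain ⟨y, rfl⟩ := exists_generator hpq hY
    obtain ⟨y', rfl⟩ := exists_generator hpq hY'
    obtain ⟨z, rfl⟩ := exists_generator hpq hZ
    rw [lowPerm_box hc b1 (by omega), lowPerm_box hc b2 (by omega), lowPerm_box hc b3 (by omega),
      lowPerm_box hc b4 (by omega), mul_assoc, mul_assoc, hc.box b1 b2 b3 b4 fun φ _ => hφ φ]
  · obtain ⟨Y, Y', Z, hY, hY', hZ, b1, b2, b3, b4, hφ⟩ :=
      (isGen_onLift hpq x).exists_corner_left x1 (onLift_sub_period hpq x2) x3 h1 h2 h3 (by omega) k1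
        (by change _ < _ + ((n * p : ℕ) : ℤ); omega)
    obtain ⟨y, rfl⟩ := exists_generator hpq hY
    obtain ⟨y', rfl⟩ := exists_generator hpq hY'
    obtain ⟨z, rfl⟩ := exists_generator hpq hZ
    rw [lowPerm_box hc b1 (by omega), lowPerm_box hc b2 (by omega), lowPerm_box hc b3 (by omega),
      lowPerm_box hc b4 (by omega), mul_assoc, mul_assoc, hc.box b1 b2 b3 b4 fun φ _ => hφ φ]

theorem lowPerm_three_rows (h1 : t₁ < t₂) (h2 : t₂ < t₃) (h3 : t₃ < t₁ + n) (hc : IsFlat c) :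
    lowPerm hpq hc (rowIndex n t₁) (rowIndex n t₂) *
        lowPerm hpq hc (rowIndex n t₁) (rowIndex n t₃) =
      lowPerm hpq hc (rowIndex n t₂) (rowIndex n t₃) *
        lowPerm hpq hc (rowIndex n t₁) (rowIndex n t₂) ∧
    lowPerm hpq hc (rowIndex n t₂) (rowIndex n t₃) *
        lowPerm hpq hc (rowIndex n t₁) (rowIndex n t₃) =
      lowPerm hpq hc (rowIndex n t₁) (rowIndex n t₂) *
        lowPerm hpq hc (rowIndex n t₂) (rowIndex n t₃) := by
  have inv : ∀ (l m : Fin n) (u : Generator n p × ℤˣ),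
      lowPerm hpq hc l m (lowPerm hpq hc l m u) = u := fun l m u => lowStep_lowStep hc l m u
  constructor <;> refine Equiv.ext fun u => ?_ <;> rw [Equiv.Perm.mul_apply, Equiv.Perm.mul_apply]
  · rcases isOuter_or (hpq := hpq) h1 h2 h3 hc u with h | h
    · exact (h.lowPerm_eq h1 h2 h3 hc u.2).1
    · have e := (h.lowPerm_eq (hpq := hpq) h1 h2 h3 hc
        (lowPerm hpq hc (rowIndex n t₁) (rowIndex n t₃) u).2).1
      rw [Prod.mk.eta, inv] at e
      rw [e, inv]
  · rcases isOuter_or (hpq := hpq) h1 h2 h3 hc u with h | h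
    · exact (h.lowPerm_eq h1 h2 h3 hc u.2).2
    · have e := (h.lowPerm_eq (hpq := hpq) h1 h2 h3 hc
        (lowPerm hpq hc (rowIndex n t₁) (rowIndex n t₃) u).2).2
      rw [Prod.mk.eta, inv] at e
      rw [e, inv]

end ThreeRows

/-- The transports satisfy the relations of affine transpositions.  The second component records
the permutation of the horizontal circles. -/
theorem affineFamily_lowPerm (hpq : IsCoprime (p : ℤ) q) (hc : IsFlat c) :
    AffineFamily fun i j : Fin n => (lowPerm hpq hc i j, Equiv.swap i j) where
  refl i := Prod.ext (lowPerm_refl hc i) (Equiv.swap_self i)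
  mul_self i j := Prod.ext (lowPerm_mul_self hc i j) (Equiv.swap_mul_self i j)
  comm i j k l h1 h2 h3 h4 := by
    refine Prod.ext (lowPerm_comm hc h1 h2 h3 h4) ?_
    have hd : Equiv.Perm.Disjoint (Equiv.swap i j) (Equiv.swap k l) := by
      intro a
      by_cases e1 : a = i
      · subst e1; right; exact Equiv.swap_apply_of_ne_of_ne h1 h2
      · by_cases e2 : a = j
        · subst e2; right; exact Equiv.swap_apply_of_ne_of_ne h3 h4
        · left; exact Equiv.swap_apply_of_ne_of_ne e1 e2
    exact hd.commute.eq
  cyc i j k h := by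
    have hi := i.2
    have hj := j.2
    have hk := k.2
    simp only [Fin.lt_def] at h
    have hij : i ≠ j := by rintro rfl; omega
    have hjk : j ≠ k := by rintro rfl; omega
    have hik : i ≠ k := by rintro rfl; omega
    obtain ⟨t₂, t₃, h1, h2, h3, e2, e3⟩ : ∃ t₂ t₃ : ℤ, ((i : ℕ) : ℤ) < t₂ ∧ t₂ < t₃ ∧
        t₃ < ((i : ℕ) : ℤ) + n ∧ (n : ℤ) ∣ t₂ - ((j : ℕ) : ℤ) ∧ (n : ℤ) ∣ t₃ - ((k : ℕ) : ℤ) := by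
      rcases h with h | h | h
      · exact ⟨((j : ℕ) : ℤ), ((k : ℕ) : ℤ), by omega, by omega, by omega, by simp, by simp⟩
      · exact ⟨((j : ℕ) : ℤ) + n, ((k : ℕ) : ℤ) + n, by omega, by omega, by omega, by simp, by simp⟩
      · exact ⟨((j : ℕ) : ℤ), ((k : ℕ) : ℤ) + n, by omega, by omega, by omega, by simp, by simp⟩
    have e := lowPerm_three_rows (hpq := hpq) h1 h2 h3 hc
    rw [rowIndex_fin, rowIndex_eq_iff.2 e2, rowIndex_eq_iff.2 e3] at e
    have sw : ∀ {i j k : Fin n}, i ≠ j → j ≠ k → i ≠ k →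
        Equiv.swap i k = Equiv.swap i j * Equiv.swap j k * Equiv.swap i j := by
      intro i j k hij hjk hik
      rw [Equiv.swap_comm i j, Equiv.swap_comm j k, Equiv.swap_mul_swap_mul_swap hjk.symm hik.symm,
        Equiv.swap_comm]
    have inv := fun l m => lowPerm_mul_self (hpq := hpq) hc l m
    refine ⟨Prod.ext ?_ (sw hij hjk hik), Prod.ext ?_ ?_⟩
    · change lowPerm hpq hc i k = lowPerm hpq hc i j * lowPerm hpq hc j k * lowPerm hpq hc i j
      rw [mul_assoc, ← e.1, ← mul_assoc, inv, one_mul]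
    · change lowPerm hpq hc i k = lowPerm hpq hc j k * lowPerm hpq hc i j * lowPerm hpq hc j k
      rw [mul_assoc, ← e.2, ← mul_assoc, inv, one_mul]
    · change Equiv.swap i k = Equiv.swap j k * Equiv.swap i j * Equiv.swap j k
      rw [Equiv.swap_comm i k, sw hjk.symm hij.symm hik.symm, Equiv.swap_comm k j,
        Equiv.swap_comm j i]

end Flat

/-! ### Tall rectangles -/

section Gauge

variable {n p : ℕ} {q : ℤ} [NeZero n] [NeZero p] {hpq : IsCoprime (p : ℤ) q}
  {c : SignFunction n p q} {x y z : Generator n p}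

/-- The transport around a tall rectangle, which winds `κ` times through the horizontal circles of
its edges, is the product of the transports of an alternating sequence of low rectangles. -/
theorem lowPerm_word_box (hc : IsFlat c) (κ : ℕ) : ∀ {x y : Generator n p} {a b a' b' h : ℤ}
    (H : (torusLattice n p hpq).IsBox (fun s t => x.OnLift q s t)
      (fun s t => y.OnLift q s t) a b a' b'), 0 < h → h < n → b' - b = h + κ * n → ∀ e : ℤˣ,
    (lowPerm hpq hc (rowIndex n b) (rowIndex n b') *
      (lowPerm hpq hc (rowIndex n b') (rowIndex n b) *
        lowPerm hpq hc (rowIndex n b) (rowIndex n b')) ^ κ) (x, e) =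
      (y, e * c x y (Rect.ofBox hpq H)) := by
  induction κ with
  | zero =>
    intro x y a b a' b' h H h0 h1 h2 e
    rw [pow_zero, mul_one]
    exact lowPerm_box hc H (by rw [h2]; push_cast; omega) e
  | succ κ ih =>
    intro y z a' b c' d' h H h0 h1 h2 e
    have hn : (0 : ℤ) < n := by exact_mod_cast Nat.pos_of_ne_zero (NeZero.ne n)
    have hδ : d' - (b + h) = (κ + 1) * n := by push_cast at h2; linarith
    have hδn : (n : ℤ) ≤ d' - (b + h) := by
      rw [hδ]; nlinarith [Int.natCast_nonneg (n := κ)]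
    -- a low rectangle ending in `y`, on the left of the given one
    obtain ⟨a'', k1, k2, k3⟩ := (isGen_onLift hpq y).exists_mem_row' H.ll (b := b + h)
      (GridLattice.not_dvd_of_pos_of_lt (k := (n : ℤ)) (by omega) (by omega))
    obtain ⟨X, hX, B⟩ := (isGen_onLift hpq y).exists_low H.ll k1 k2 k3 (by omega)
      (by change _ < b + (n : ℤ); omega)
    obtain ⟨x, rfl⟩ := exists_generator hpq hX
    have B1 := (B.complement_row k3 (by change _ < (n : ℤ); omega) (isGen_onLift hpq y) hX).translate
      hX (isGen_onLift hpq y)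
      (GridLattice.neg_mem ((torusLattice n p hpq).row.2 (dvd_refl _)))
    rw [neg_zero, add_zero, add_zero, add_neg_cancel_right] at B1
    obtain ⟨a, ha⟩ : ∃ a, a = a'' + -((torusLattice n p hpq).N : ℤ) := ⟨_, rfl⟩
    rw [← ha] at B1
    -- The second pair of rectangles of the annulus consists of a rectangle with one turn less and
    -- of a low one.
    obtain ⟨k, q0, q1, q2, -, Y', hY', B3, B4, hφ⟩ := GridLattice.exists_spiral hX
      (isGen_onLift hpq y) (isGen_onLift hpq z) B1 H (by omega)
      (by rw [hδ]; exact Dvd.intro_left _ rfl)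
    obtain rfl : k = 0 := by
      by_contra hk
      have : (1 : ℤ) ≤ k := by omega
      nlinarith
    obtain ⟨y', rfl⟩ := exists_generator hpq hY'
    simp only [zero_add, one_mul, zero_mul, add_zero] at B3 B4 hφ
    have r1 : rowIndex n (b + h) = rowIndex n d' := by
      refine rowIndex_eq_rowIndex_iff.2 (GridLattice.dvd_symm_sub ?_)
      rw [hδ]; exact Dvd.intro_left _ rfl
    have r2 : rowIndex n (b + (d' - (b + h))) = rowIndex n b := by
      refine rowIndex_eq_rowIndex_iff.2 ?_
      rw [add_sub_cancel_left, hδ]; exact Dvd.intro_left _ rfl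
    have w3 := ih B3 (h := n - h) (by omega) (by omega) (by rw [hδ]; ring)
    rw [r1, r2] at w3
    have w1 := lowPerm_box hc B1 (by omega) (e * c x y (Rect.ofBox hpq B1))
    have w4 := lowPerm_box hc B4 (by omega)
    rw [r1] at w1 w4
    rw [mul_assoc, Int.units_mul_self, mul_one] at w1
    rw [pow_succ, ← mul_assoc ((_ : Equiv.Perm _) ^ κ), mul_pow_mul, Equiv.Perm.mul_apply,
      Equiv.Perm.mul_apply]
    have w1' : lowPerm hpq hc (rowIndex n b) (rowIndex n d') (y, e) =
        (x, e * c x y (Rect.ofBox hpq B1)) := by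
      rw [← w1, ← Equiv.Perm.mul_apply, lowPerm_mul_self, Equiv.Perm.one_apply]
    rw [w1', w3, w4, mul_assoc, mul_assoc, ← hc.box B1 H B3 B4 hφ, ← mul_assoc (c x y _),
      Int.units_mul_self, one_mul]

/-- Going `p` times along both arcs is trivial: this is the holonomy of a vertical annulus of width
less than `n`. -/
theorem lowPerm_mul_pow (hc : IsFlat c) {l m : Fin n} (hlm : l ≠ m) :
    (lowPerm hpq hc m l * lowPerm hpq hc l m) ^ p = 1 := by
  refine Equiv.ext fun u => ?_
  obtain ⟨x, e⟩ := u
  rw [Equiv.Perm.one_apply]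
  have hn : (0 : ℤ) < n := by exact_mod_cast Nat.pos_of_ne_zero (NeZero.ne n)
  have hX := isGen_onLift hpq x
  have hrow : ¬ (n : ℤ) ∣ ((m : ℕ) : ℤ) - ((l : ℕ) : ℤ) := fun h => hlm (fin_eq_of_dvd h).symm
  have hcol : ¬ (n : ℤ) ∣ x.col m - x.col l := hX.ndvd_col (onLift_col x l) (onLift_col x m) hrow
  have m0 := Int.emod_nonneg (x.col m - x.col l) hn.ne'
  have m1 := Int.emod_lt_of_pos (x.col m - x.col l) hn
  have m2 : (x.col m - x.col l) % n ≠ 0 := fun h => hcol (Int.dvd_of_emod_eq_zero h)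
  obtain ⟨t, x2, t0, t1⟩ := hX.transpose.exists_mem_row ((l : ℕ) : ℤ)
    (x.col l + (x.col m - x.col l) % n)
  have hd : (n : ℤ) ∣ x.col l + (x.col m - x.col l) % n - x.col m := by
    have := Int.dvd_self_sub_emod (x := x.col m - x.col l) (m := (n : ℤ))
    rw [← dvd_neg] at this
    ring_nf at this ⊢
    exact this
  have ht : (n : ℤ) ∣ t - ((m : ℕ) : ℤ) := torus_dvd_snd hpq (hX.col (onLift_col x m) x2 hd)
  have rt := rowIndex_eq_iff.2 ht
  change t < ((l : ℕ) : ℤ) + ((n * p : ℕ) : ℤ) at t1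
  have htl : ¬ (n : ℤ) ∣ t - ((l : ℕ) : ℤ) := fun h =>
    hrow (GridLattice.dvd_trans_sub (GridLattice.dvd_symm_sub ht) h)
  have t2 : t ≠ ((l : ℕ) : ℤ) := by rintro rfl; exact htl (by simp)
  -- the two rectangles of a narrow vertical annulus, starting at `x`
  obtain ⟨Y, hY, B⟩ := hX.exists_narrow (onLift_col x l) x2 (by omega)
    (by change _ < _ + (n : ℤ); omega) (by omega) t1
  obtain ⟨y, rfl⟩ := exists_generator hpq hY
  have B' := B.complement_col t1 (by change _ < (n : ℤ); omega) hX (isGen_onLift hpq y)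
  change (torusLattice n p hpq).IsBox _ _ _ _ _ (((l : ℕ) : ℤ) + ((n * p : ℕ) : ℤ)) at B'
  have rl : rowIndex n (((l : ℕ) : ℤ) + ((n * p : ℕ) : ℤ)) = l :=
    rowIndex_eq_iff.2 ⟨p, by push_cast; ring⟩
  have h0 := Int.emod_nonneg (t - ((l : ℕ) : ℤ)) hn.ne'
  have h1 := Int.emod_lt_of_pos (t - ((l : ℕ) : ℤ)) hn
  have h2 : (t - ((l : ℕ) : ℤ)) % n ≠ 0 := fun h => htl (Int.dvd_of_emod_eq_zero h)
  have h3 := Int.mul_ediv_add_emod (t - ((l : ℕ) : ℤ)) n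
  obtain ⟨κ, hκ⟩ := Int.eq_ofNat_of_zero_le
    (Int.ediv_nonneg (by omega : 0 ≤ t - ((l : ℕ) : ℤ)) hn.le)
  rw [hκ] at h3
  have hκp : κ < p := by
    have : (n : ℤ) * κ < n * p := by push_cast at t1; omega
    exact_mod_cast lt_of_mul_lt_mul_left this hn.le
  obtain ⟨j, rfl⟩ : ∃ j, p = j + 1 + κ := ⟨p - 1 - κ, by omega⟩
  have w1 := lowPerm_word_box hc κ B (h := (t - ((l : ℕ) : ℤ)) % n) (by omega) h1
    (by rw [mul_comm]; omega) e
  have w2 := lowPerm_word_box hc j B' (h := n - (t - ((l : ℕ) : ℤ)) % n) (by omega) (by omega)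
    (by push_cast; linarith) (e * c x y (Rect.ofBox hpq B))
  rw [rowIndex_fin, rt] at w1
  rw [rl, rt, mul_assoc, hc.box_col B B', mul_one] at w2
  rw [pow_add, pow_succ, ← mul_assoc ((_ : Equiv.Perm _) ^ j), mul_pow_mul, mul_assoc,
    Equiv.Perm.mul_apply, w1, w2]

/-! ### The action on the coordinates of generators -/

/-- The effect of a rectangle on the `p`-coordinates; `k` counts how often its left edge crosses the
top of the planar grid. -/
theorem Rect.snd_eq (r : Rect q x y) {k : ℤ}
    (hk : ((r.bot : ℕ) : ℤ) + r.height = ((r.top : ℕ) : ℤ) + n * k) :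
    y.2 r.bot = x.2 r.top + q * k ∧ y.2 r.top = x.2 r.bot - q * k := by
  have hn : (n : ℤ) ≠ 0 := by exact_mod_cast NeZero.ne n
  obtain ⟨k₁, e1, f1⟩ := r.upper_right
  obtain ⟨k₂, e2, f2⟩ := r.lower_right
  obtain ⟨k₃, e3, f3⟩ := r.upper_left
  obtain rfl : k₁ = k := mul_left_cancel₀ hn (by omega)
  obtain rfl : k₃ = k₁ := mul_left_cancel₀ hn (by omega)
  obtain rfl : k₂ = 0 := mul_left_cancel₀ hn (by omega)
  constructor
  · refine (eq_of_col_modEq (j := x.1 r.top) (k := (x.2 r.top).val + q * k₃) (by simp) ?_).2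
    rw [mul_zero, add_zero] at f2
    refine (f2.symm.trans f1).trans (Int.modEq_of_dvd ⟨0, ?_⟩)
    unfold Generator.col
    ring
  · refine (eq_of_col_modEq (j := x.1 r.bot) (k := (x.2 r.bot).val - q * k₃) (by simp) ?_).2
    have := f3.symm.sub (Int.ModEq.refl (n * q * k₃))
    rw [add_sub_cancel_right] at this
    refine this.trans (Int.modEq_of_dvd ⟨0, ?_⟩)
    unfold Generator.col
    ring

theorem lowPerm_fst (hc : IsFlat c) (l m : Fin n) (u : Generator n p × ℤˣ) :
    (lowPerm hpq hc l m u).1.1 = u.1.1 * Equiv.swap l m := by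
  by_cases h : l = m
  · rw [h, lowPerm_refl, Equiv.swap_self]
    exact (mul_one _).symm
  obtain ⟨x, e⟩ := u
  obtain ⟨y, r, rfl, rfl, h3⟩ := exists_low_rect hpq x h
  have := lowStep_rect (hpq := hpq) (c := c) r h3 e
  change (lowStep hpq c _ _ _).1.1 = _
  rw [this]
  exact r.perm_eq

theorem lowPerm_snd (hc : IsFlat c) {l m : Fin n} (h : l ≠ m) (u : Generator n p × ℤˣ) :
    (lowPerm hpq hc l m u).1.2 l = u.1.2 m + (if m < l then (q : ZMod p) else 0) ∧
    (lowPerm hpq hc l m u).1.2 m = u.1.2 l - (if m < l then (q : ZMod p) else 0) ∧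
    ∀ i, i ≠ l → i ≠ m → (lowPerm hpq hc l m u).1.2 i = u.1.2 i := by
  obtain ⟨x, e⟩ := u
  obtain ⟨y, r, rfl, rfl, h3⟩ := exists_low_rect hpq x h
  have hr : lowPerm hpq hc r.bot r.top (x, e) = _ := lowStep_rect (hpq := hpq) (c := c) r h3 e
  rw [hr]
  obtain ⟨k, hk⟩ := r.dvd_top
  have hk' : k = if r.top < r.bot then 1 else 0 := by
    have h1 := r.height_pos
    have h2 := r.bot.2
    have h4 := r.top.2
    have hne : (r.bot : ℕ) ≠ r.top := fun h => r.bot_ne_top (Fin.ext h)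
    simp only [Fin.lt_def]
    split_ifs with hlt
    · have : 0 < k := by by_contra hc; nlinarith
      have : k < 2 := by by_contra hc; nlinarith
      omega
    · have : -1 < k := by by_contra hc; nlinarith
      have : k < 1 := by by_contra hc; nlinarith
      omega
  obtain ⟨e1, e2⟩ := r.snd_eq (k := k) (by omega)
  have e3 : (q : ZMod p) * k = if r.top < r.bot then (q : ZMod p) else 0 := by
    rw [hk']; split_ifs <;> simp
  rw [e3] at e1 e2
  exact ⟨e1, e2, fun i h1 h2 => ((r.agree i h1 h2).2).symm⟩

/-- The generators of the group of transports. -/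
abbrev transport (hpq : IsCoprime (p : ℤ) q) (hc : IsFlat c) (i j : Fin n) :
    Equiv.Perm (Generator n p × ℤˣ) × Equiv.Perm (Fin n) :=
  (lowPerm hpq hc i j, Equiv.swap i j)

/-- The group of transports along low rectangles. -/
def transportGroup (hpq : IsCoprime (p : ℤ) q) (hc : IsFlat c) :
    Subgroup (Equiv.Perm (Generator n p × ℤˣ) × Equiv.Perm (Fin n)) :=
  Subgroup.closure {g | ∃ i j, g = transport hpq hc i j}

theorem transport_mem (hc : IsFlat c) (i j : Fin n) :
    transport hpq hc i j ∈ transportGroup hpq hc := Subgroup.subset_closure ⟨i, j, rfl⟩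

theorem transport_inv (hc : IsFlat c) (i j : Fin n) :
    (transport hpq hc i j)⁻¹ = transport hpq hc i j :=
  inv_eq_of_mul_eq_one_left ((affineFamily_lowPerm hpq hc).mul_self i j)

theorem transportGroup_induction (hc : IsFlat c)
    {P : Equiv.Perm (Generator n p × ℤˣ) × Equiv.Perm (Fin n) → Prop} (one : P 1)
    (mul : ∀ i j g, P g → P (transport hpq hc i j * g)) {g}
    (hg : g ∈ transportGroup hpq hc) : P g := by
  refine Subgroup.closure_induction_left (p := fun g _ => P g) one ?_ ?_ hg
  · rintro _ ⟨i, j, rfl⟩ y _ hy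
    exact mul i j y hy
  · rintro _ ⟨i, j, rfl⟩ y _ hy
    rw [transport_inv]
    exact mul i j y hy

/-- The second component of a transport is determined by its effect on the permutations. -/
theorem transport_apply_fst (hc : IsFlat c) {g} (hg : g ∈ transportGroup hpq hc)
    (u : Generator n p × ℤˣ) : (g.1 u).1.1 = u.1.1 * g.2⁻¹ := by
  refine transportGroup_induction hc (P := fun g => (g.1 u).1.1 = u.1.1 * g.2⁻¹) ?_ ?_ hg
  · simp
  · intro i j g h
    change (lowPerm hpq hc i j (g.1 u)).1.1 = u.1.1 * (Equiv.swap i j * g.2)⁻¹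
    rw [lowPerm_fst, h, mul_inv_rev, Equiv.swap_inv, mul_assoc]

/-- Transports commute with a change of the initial sign. -/
theorem transport_apply_mul (hc : IsFlat c) {g} (hg : g ∈ transportGroup hpq hc)
    (x : Generator n p) (e : ℤˣ) : g.1 (x, e) = ((g.1 (x, 1)).1, e * (g.1 (x, 1)).2) := by
  refine transportGroup_induction hc
    (P := fun g => g.1 (x, e) = ((g.1 (x, 1)).1, e * (g.1 (x, 1)).2)) ?_ ?_ hg
  · simp
  · intro i j g h
    change lowStep hpq c i j (g.1 (x, e)) = ((lowStep hpq c i j (g.1 (x, 1))).1,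
      e * (lowStep hpq c i j (g.1 (x, 1))).2)
    rw [h]
    unfold lowStep
    split_ifs
    · rfl
    · rw [mul_assoc]

/-- The `j`-th translation lowers the `j`-th coordinate by `q`; only the coordinate on the bottom
circle compensates for it. -/
theorem translation_snd (hc : IsFlat c) (j : Fin n) (u : Generator n p × ℤˣ) {i : Fin n}
    (hi : i ≠ 0) : ((AffineFamily.translation (transport hpq hc) 0 j).1 u).1.2 i =
      u.1.2 i - if j = i then (q : ZMod p) else 0 := by
  change (lowPerm hpq hc 0 j (lowPerm hpq hc j 0 u)).1.2 i = _
  by_cases hj : j = 0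
  · rw [hj, lowPerm_refl, if_neg hi.symm, sub_zero]
    rfl
  have h0 : (0 : Fin n) < j := Fin.pos_iff_ne_zero.2 hj
  obtain ⟨e1, e2, e3⟩ := lowPerm_snd (hpq := hpq) hc (Ne.symm hj) (lowPerm hpq hc j 0 u)
  obtain ⟨f1, f2, f3⟩ := lowPerm_snd (hpq := hpq) hc hj u
  rw [if_neg h0.asymm] at e1 e2
  rw [if_pos h0] at f1 f2
  by_cases hij : j = i
  · subst hij
    rw [if_pos rfl, e2, f2, sub_zero]
  · rw [if_neg hij, e3 i hi (Ne.symm hij), f3 i (Ne.symm hij) hi, sub_zero]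

theorem translation_zpow_snd (hc : IsFlat c) (j : Fin n) (m : ℤ) (u : Generator n p × ℤˣ)
    {i : Fin n} (hi : i ≠ 0) :
    ((AffineFamily.translation (transport hpq hc) 0 j ^ m).1 u).1.2 i =
      u.1.2 i - if j = i then (q : ZMod p) * m else 0 := by
  induction m generalizing u with
  | zero => simp
  | succ m ih =>
    rw [zpow_add_one, Prod.fst_mul, Equiv.Perm.mul_apply, ih, translation_snd hc j u hi]
    split_ifs <;> push_cast <;> ring
  | pred m ih =>
    have h1 := ih ((AffineFamily.translation (transport hpq hc) 0 j)⁻¹.1 u)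
    have h2 := translation_snd (hpq := hpq) hc j ((AffineFamily.translation (transport hpq hc) 0 j)⁻¹.1 u) hi
    rw [← Equiv.Perm.mul_apply, ← Prod.fst_mul, mul_inv_cancel, Prod.fst_one,
      Equiv.Perm.one_apply] at h2
    rw [zpow_sub_one, Prod.fst_mul, Equiv.Perm.mul_apply, h1, h2]
    split_ifs <;> push_cast <;> ring

theorem translationHom_snd (hc : IsFlat c) (k : Fin n → Multiplicative ℤ)
    (u : Generator n p × ℤˣ) {i : Fin n} (hi : i ≠ 0) :
    (((affineFamily_lowPerm hpq hc).translationHom (o := 0) Fin.zero_le k).1 u).1.2 i =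
      u.1.2 i - q * (k i).toAdd := by
  refine Pi.mulSingle_induction (fun k => ∀ u : Generator n p × ℤˣ,
    (((affineFamily_lowPerm hpq hc).translationHom (o := 0) Fin.zero_le k).1 u).1.2 i =
      u.1.2 i - q * (k i).toAdd) k ?_ ?_ ?_ u
  · simp
  · intro f g hf hg u
    rw [map_mul, Prod.fst_mul, Equiv.Perm.mul_apply, hf, hg, Pi.mul_apply, toAdd_mul]
    push_cast
    ring
  · intro j m u
    rw [AffineFamily.translationHom_mulSingle]
    refine (translation_zpow_snd hc j m.toAdd u hi).trans ?_
    by_cases h : j = i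
    · subst h
      rw [if_pos rfl, Pi.mulSingle_eq_same]
    · rw [if_neg h, Pi.mulSingle_eq_of_ne (Ne.symm h), toAdd_one, Int.cast_zero, mul_zero]

theorem translation_pow (hc : IsFlat c) (j : Fin n) :
    AffineFamily.translation (transport hpq hc) 0 j ^ p = 1 := by
  by_cases hj : j = 0
  · have : AffineFamily.translation (transport hpq hc) 0 0 = 1 := by
      rw [AffineFamily.translation, (affineFamily_lowPerm hpq hc).mul_self]
    rw [hj, this, one_pow]
  refine Prod.ext ?_ ?_
  · exact lowPerm_mul_pow hc hj
  · change (Equiv.swap 0 j * Equiv.swap j 0) ^ p = 1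
    rw [Equiv.swap_comm j 0, Equiv.swap_mul_self, one_pow]

theorem translationHom_fst_snd (hc : IsFlat c) (k : Fin n → Multiplicative ℤ) :
    ((affineFamily_lowPerm hpq hc).translationHom (o := 0) Fin.zero_le k).2 = 1 := by
  refine Pi.mulSingle_induction (fun k =>
    ((affineFamily_lowPerm hpq hc).translationHom (o := 0) Fin.zero_le k).2 = 1) k ?_ ?_ ?_
  · rw [map_one]
    rfl
  · intro f g hf hg
    rw [map_mul, Prod.snd_mul, hf, hg, one_mul]
  · intro j m
    rw [AffineFamily.translationHom_mulSingle]
    change (Equiv.swap 0 j * Equiv.swap j 0) ^ m.toAdd = 1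
    rw [Equiv.swap_comm j 0, Equiv.swap_mul_self, one_zpow]

/-- The transports form a group acting freely on the generators: there is no holonomy. -/
theorem eq_one_of_apply_fst_eq (hc : IsFlat c) {g} (hg : g ∈ transportGroup hpq hc)
    {u : Generator n p × ℤˣ} (h : (g.1 u).1 = u.1) : g = 1 := by
  have hT := affineFamily_lowPerm hpq hc
  have h2 := transport_apply_fst hc hg u
  rw [h, eq_comm, mul_eq_left, inv_eq_one] at h2
  obtain ⟨κ, hκ, k, rfl⟩ := hT.exists_eq_mul_translationHom (o := 0) Fin.zero_le hg
  rw [Prod.snd_mul, translationHom_fst_snd, mul_one] at h2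
  -- the permutation part vanishes, by the presentation of the symmetric group
  have hκ1 : κ = 1 := hT.transpositionFamily_planar.eq_one (MonoidHom.snd _ _) (fun i j => by
    rcases AffineFamily.planar_eq (T := transport hpq hc) i j with e | e
    · exact congrArg Prod.snd e
    · exact (congrArg Prod.snd e).trans (Equiv.swap_comm j i)) _ hκ h2
  subst hκ1
  rw [one_mul] at h ⊢
  refine hT.translationHom_eq_one Fin.zero_le fun j => ?_
  by_cases hj : j = 0
  · have : AffineFamily.translation (transport hpq hc) 0 0 = 1 := by
      rw [AffineFamily.translation, hT.mul_self]
    rw [hj]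
    exact (congrArg (· ^ _) this).trans (one_zpow _)
  -- the exponents are multiples of `p`, since `q` is invertible modulo `p`
  have h3 := translationHom_snd (hpq := hpq) hc k u hj
  rw [h, eq_comm, sub_eq_self] at h3
  have h4 : (p : ℤ) ∣ q * (k j).toAdd :=
    (ZMod.intCast_zmod_eq_zero_iff_dvd _ p).1 (by push_cast; exact h3)
  obtain ⟨m, hm⟩ := hpq.dvd_of_dvd_mul_left h4
  rw [hm, zpow_mul, zpow_natCast]
  exact (congrArg (· ^ m) (translation_pow hc j)).trans (one_zpow _)

/-- The word in low rectangles that has the transport of a given rectangle. -/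
theorem exists_transport_rect (hc : IsFlat c) (r : Rect q x y) :
    ∃ g ∈ transportGroup hpq hc, g.1 (x, 1) = (y, c x y r) := by
  have hn : (0 : ℤ) < n := by exact_mod_cast Nat.pos_of_ne_zero (NeZero.ne n)
  have hr := r.isBox hpq
  have nd := hr.ndvd
  rw [add_sub_cancel_left] at nd
  have nd' : (r.height : ℤ) % n ≠ 0 := fun h => nd (Int.dvd_of_emod_eq_zero h)
  have h0 := Int.emod_nonneg (r.height : ℤ) hn.ne'
  have h1 := Int.emod_lt_of_pos (r.height : ℤ) hn
  have h2 := Int.mul_ediv_add_emod (r.height : ℤ) n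
  have w := lowPerm_word_box hc (r.height / n) hr (h := (r.height : ℤ) % n) (by omega) h1
    (by rw [add_sub_cancel_left]; push_cast; linarith) 1
  have e : Rect.ofBox hpq hr = r :=
    Rect.eq_of_eq r.rowIndex_bot (by simp [Rect.ofBox]) (by simp [Rect.ofBox])
  rw [e, one_mul] at w
  exact ⟨_, mul_mem (transport_mem hc _ _) (pow_mem (mul_mem (transport_mem hc _ _)
    (transport_mem hc _ _)) _), w⟩

/-- A flat sign function is a coboundary. -/
theorem IsFlat.exists_eq_mul (hpq : IsCoprime (p : ℤ) q) (hc : IsFlat c) :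
    ∃ v : Generator n p → ℤˣ, ∀ (x y : Generator n p) (r : Rect q x y), c x y r = v x * v y := by
  -- Choose a base point in each orbit of the group of transports; `v x` is the sign of the transport
  -- from the base point to `x`, which does not depend on choices.
  let s : Setoid (Generator n p) :=
    { r := fun x y => ∃ g ∈ transportGroup hpq hc, (g.1 (x, 1)).1 = y
      iseqv := by
        refine ⟨fun x => ⟨1, one_mem _, rfl⟩, ?_, ?_⟩
        · rintro x _ ⟨g, hg, rfl⟩
          refine ⟨g⁻¹, inv_mem hg, ?_⟩
          have h := transport_apply_mul hc (inv_mem hg) (g.1 (x, 1)).1 (g.1 (x, 1)).2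
          rw [Prod.mk.eta, ← Equiv.Perm.mul_apply, ← Prod.fst_mul, inv_mul_cancel] at h
          exact (congrArg Prod.fst h).symm
        · rintro x _ _ ⟨g, hg, rfl⟩ ⟨h, hh, rfl⟩
          refine ⟨h * g, mul_mem hh hg, ?_⟩
          rw [Prod.fst_mul, Equiv.Perm.mul_apply, ← Prod.mk.eta (p := g.1 (x, 1)),
            transport_apply_mul hc hh] }
  have hex : ∀ x, ∃ g ∈ transportGroup hpq hc, (g.1 ((Quotient.mk s x).out, 1)).1 = x :=
    fun x => Quotient.mk_out (s := s) x
  choose g hg hgx using hex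
  refine ⟨fun x => ((g x).1 ((Quotient.mk s x).out, 1)).2, fun x y r => ?_⟩
  obtain ⟨t, ht, hr⟩ := exists_transport_rect (hpq := hpq) hc r
  have hq : Quotient.mk s x = Quotient.mk s y := Quotient.sound (s := s) ⟨t, ht, by rw [hr]⟩
  obtain ⟨o, ho⟩ : ∃ o, o = (Quotient.mk s x).out := ⟨_, rfl⟩
  have ex : (g x).1 (o, 1) = (x, ((g x).1 (o, 1)).2) := by
    rw [ho]; exact Prod.ext (hgx x) rfl
  have ey : (g y).1 (o, 1) = (y, ((g y).1 (o, 1)).2) := by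
    rw [ho, hq]; exact Prod.ext (hgx y) rfl
  change c x y r = ((g x).1 ((Quotient.mk s x).out, 1)).2 * ((g y).1 ((Quotient.mk s y).out, 1)).2
  rw [← hq, ← ho]
  generalize ((g x).1 (o, 1)).2 = vx at *
  generalize ((g y).1 (o, 1)).2 = vy at *
  have ht' : t.1 (x, vx) = (y, vx * c x y r) := by rw [transport_apply_mul hc ht, hr]
  have hy' : (g y).1 (o, vy * (vx * c x y r)) = (y, vx * c x y r) := by
    rw [transport_apply_mul hc (hg y), ey, mul_right_comm, Int.units_mul_self, one_mul]
  -- the loop through the base point, the rectangle and back has no holonomy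
  have hloop : ((g y)⁻¹ * (t * g x)).1 (o, 1) = (o, vy * (vx * c x y r)) := by
    rw [Prod.fst_mul, Prod.fst_mul, Equiv.Perm.mul_apply, Equiv.Perm.mul_apply, ex, ht', ← hy',
      ← Equiv.Perm.mul_apply, ← Prod.fst_mul, inv_mul_cancel]
    rfl
  have h1 := eq_one_of_apply_fst_eq hc (mul_mem (inv_mem (hg y)) (mul_mem ht (hg x)))
    (u := (o, 1)) (by rw [hloop])
  rw [h1] at hloop
  have h2 : (1 : ℤˣ) = vy * (vx * c x y r) := congrArg Prod.snd hloop
  have h3 := congrArg (vx * vy * ·) h2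
  simp only [mul_one] at h3
  rw [h3, mul_assoc vx, ← mul_assoc vy vy, Int.units_mul_self, one_mul, ← mul_assoc,
    Int.units_mul_self, one_mul]

end Gauge

/-! ### Gauge equivalent sign functions give isomorphic complexes -/

section Isomorphism

variable {n p : ℕ} {q : ℤ}

/-- Sign assignments are unique up to gauge: their quotient is flat, hence a coboundary. -/
theorem IsSignAssignment.exists_gauge [NeZero n] [NeZero p] (hpq : IsCoprime (p : ℤ) q)
    {S S' : SignFunction n p q} (hS : IsSignAssignment S) (hS' : IsSignAssignment S') :
    ∃ v : Generator n p → ℤˣ, S' = S.gauge v := by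
  obtain ⟨v, hv⟩ := (hS.isFlat_mul hS').exists_eq_mul hpq
  refine ⟨v, funext fun x => funext fun y => funext fun r => ?_⟩
  rw [SignFunction.gauge, mul_right_comm, ← hv x y r, mul_right_comm, Int.units_mul_self, one_mul]

namespace Markings

variable (G : Markings n p) {A : Type} [CommRing A] (V : Fin n → A) {S S' : SignFunction n p q}
  [NeZero p] (v : Generator n p → ℤˣ)

theorem gaugeMap_apply (f : Generator n p → A) (y : Generator n p) :
    gaugeMap A v f y = f y * ((v y : ℤ) : A) := by
  simp [gaugeMap, Fintype.linearCombination_apply, Finset.sum_apply, Pi.single_apply]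

theorem gaugeMap_gaugeMap (f : Generator n p → A) : gaugeMap A v (gaugeMap A v f) = f := by
  funext y
  rw [gaugeMap_apply, gaugeMap_apply, mul_assoc, ← Int.cast_mul, ← Units.val_mul,
    Int.units_mul_self, Units.val_one, Int.cast_one, mul_one]

theorem coeff_gauge (x y : Generator n p) :
    G.coeff V (S.gauge v) x y = ((v x : ℤ) : A) * G.coeff V S x y * ((v y : ℤ) : A) := by
  simp only [coeff, SignFunction.gauge, Finset.mul_sum, Finset.sum_mul]
  refine Finset.sum_congr rfl fun r _ => ?_
  split_ifs
  · push_cast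
    ring
  · simp

theorem gaugeMap_comp_differential :
    gaugeMap A v ∘ₗ G.differential V S = G.differential V (S.gauge v) ∘ₗ gaugeMap A v := by
  refine LinearMap.ext fun f => funext fun y => ?_
  rw [LinearMap.comp_apply, LinearMap.comp_apply, gaugeMap_apply, differential_apply,
    differential_apply, Finset.sum_mul]
  refine Finset.sum_congr rfl fun x _ => ?_
  have h : ((v x : ℤ) : A) * ((v x : ℤ) : A) = 1 := by
    rw [← Int.cast_mul, ← Units.val_mul, Int.units_mul_self, Units.val_one, Int.cast_one]
  rw [gaugeMap_apply, coeff_gauge]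
  linear_combination -(f x * G.coeff V S x y * ((v y : ℤ) : A)) * h

theorem gaugeMap_mem_gradedPiece {m a : ℚ} {s : ZMod p} {f : Generator n p → A}
    (hf : f ∈ G.gradedPiece q V m a s) : gaugeMap A v f ∈ G.gradedPiece q V m a s := by
  have h : G.gradedPiece q V m a s ≤
      (G.gradedPiece q V m a s).comap (gaugeMap A v).toAddMonoidHom := by
    refine (AddSubgroup.closure_le _).2 ?_
    rintro c ⟨x, k, rfl, hx⟩
    have hc : Pi.single x (∏ i, V i ^ k i) ∈ G.gradedPiece q V m a s :=
      AddSubgroup.subset_closure ⟨x, k, rfl, hx⟩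
    change gaugeMap A v (Pi.single x (∏ i, V i ^ k i)) ∈ G.gradedPiece q V m a s
    have e : gaugeMap A v (Pi.single x (∏ i, V i ^ k i)) =
        (v x : ℤ) • Pi.single x (∏ i, V i ^ k i) := by
      funext y
      rw [gaugeMap_apply, Pi.smul_apply, zsmul_eq_mul, mul_comm]
      by_cases h : y = x
      · rw [h]
      · rw [Pi.single_eq_of_ne h, mul_zero, mul_zero]
    rw [e]
    exact zsmul_mem hc _
  exact h hf

theorem isTrigradedIso_gaugeMap : G.IsTrigradedIso V S (S.gauge v) (gaugeMap A v) := by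
  refine ⟨Function.Involutive.bijective (gaugeMap_gaugeMap v), G.gaugeMap_comp_differential V v,
    fun m a s => le_antisymm ?_ fun f hf => ?_⟩
  · rintro _ ⟨f, hf, rfl⟩
    exact G.gaugeMap_mem_gradedPiece V v hf
  · exact ⟨gaugeMap A v f, G.gaugeMap_mem_gradedPiece V v hf, gaugeMap_gaugeMap v f⟩

variable {G V}

/-- An isomorphism of trigraded complexes induces one of the trigraded homologies. -/
theorem IsTrigradedIso.homologyIso {f : (Generator n p → A) →ₗ[A] (Generator n p → A)}
    (hf : G.IsTrigradedIso V S S' f) : G.HomologyIso V S S' := by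
  obtain ⟨hb, hd, hgr⟩ := hf
  have hd' : ∀ x, f (G.differential V S x) = G.differential V S' (f x) := LinearMap.congr_fun hd
  let e := LinearEquiv.ofBijective f hb
  have hZ : (G.cycles V S).map (e : (Generator n p → A) →ₗ[A] (Generator n p → A)) =
      G.cycles V S' := by
    ext w
    constructor
    · rintro ⟨x, hx, rfl⟩
      have hx : G.differential V S x = 0 := hx
      change G.differential V S' (f x) = 0
      rw [← hd', hx, map_zero]
    · intro hw
      obtain ⟨x, rfl⟩ := hb.2 w
      refine ⟨x, hb.1 ?_, rfl⟩
      rw [hd', map_zero]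
      exact hw
  let E := e.ofSubmodules _ _ hZ
  have hE : ∀ x, (E x : Generator n p → A) = f x := fun _ => rfl
  have hB : (G.boundaries V S).map (E : G.cycles V S →ₗ[A] G.cycles V S') =
      G.boundaries V S' := by
    ext w
    constructor
    · rintro ⟨x, ⟨u, hu⟩, rfl⟩
      refine ⟨f u, ?_⟩
      rw [← hd', hu]
      rfl
    · rintro ⟨u, hu⟩
      obtain ⟨u, rfl⟩ := hb.2 u
      obtain ⟨x, rfl⟩ := E.surjective w
      refine ⟨x, ⟨u, hb.1 ?_⟩, rfl⟩
      rw [hd', hu]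
      rfl
  have hmem : ∀ (m a : ℚ) (s : ZMod p) (x : Generator n p → A),
      f x ∈ G.gradedPiece q V m a s ↔ x ∈ G.gradedPiece q V m a s := by
    intro m a s x
    constructor
    · intro h
      rw [← hgr] at h
      obtain ⟨y, hy, h⟩ := h
      rw [← hb.1 h]
      exact hy
    · intro h
      rw [← hgr]
      exact ⟨x, h, rfl⟩
  refine ⟨Submodule.Quotient.equiv _ _ E hB, fun m a s => ?_⟩
  ext w
  constructor
  · rintro ⟨_, ⟨x, hx, rfl⟩, rfl⟩
    exact ⟨E x, (hmem m a s x).2 hx, rfl⟩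
  · rintro ⟨y, hy, rfl⟩
    obtain ⟨x, rfl⟩ := E.surjective y
    exact ⟨_, ⟨x, (hmem m a s x).1 hy, rfl⟩, rfl⟩

end Markings

end Isomorphism

end

end TwistedGrid

open TwistedGrid in
theorem mainTheorem1 (n p : ℕ) [NeZero n] [NeZero p] (q : ℤ) (hpq : IsCoprime (p : ℤ) q) :
    -- sign assignments exist
    (∃ S : SignFunction n p q, IsSignAssignment S) ∧
    -- every section `ρ` induces a well defined function `S_ρ`, which is a sign assignment
    (∃ ρ : Equiv.Perm (Fin n) → SpinExt n, IsSection ρ) ∧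
    (∀ ρ : Equiv.Perm (Fin n) → SpinExt n, IsSection ρ →
      (∀ (x y : Generator n p) (r : Rect q x y),
        (signOfSection q ρ x y r = 1 ↔ r.phi * extendSection ρ x = extendSection ρ y) ∧
        (signOfSection q ρ x y r = -1 ↔
          r.phi * extendSection ρ x = prodZ n p * extendSection ρ y)) ∧
      IsSignAssignment (signOfSection q ρ : SignFunction n p q)) ∧
    -- the signed differential squares to zero
    (∀ S : SignFunction n p q, IsSignAssignment S → ∀ G : Markings n p,
      G.differential (minusV n) S ∘ₗ G.differential (minusV n) S = 0 ∧
      ∀ e : Fin n, G.differential (hatV e) S ∘ₗ G.differential (hatV e) S = 0) ∧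
    -- uniqueness up to gauge, and independence of the complexes and of their homologies
    (∀ S S' : SignFunction n p q, IsSignAssignment S → IsSignAssignment S' →
      ∃ v : Generator n p → ℤˣ, S' = S.gauge v ∧ ∀ G : Markings n p,
        (G.IsTrigradedIso (minusV n) S S' (Markings.gaugeMap (MinusRing n) v) ∧
          G.HomologyIso (minusV n) S S') ∧
        ∀ e : Fin n, G.IsTrigradedIso (hatV e) S S' (Markings.gaugeMap (HatRing e) v) ∧
          G.HomologyIso (hatV e) S S') := by
  obtain ⟨ρ₀, hρ₀⟩ := exists_section n
  refine ⟨⟨_, isSignAssignment_signOfSection hpq hρ₀⟩, ⟨ρ₀, hρ₀⟩, fun ρ hρ =>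
    ⟨fun x y r => ⟨signOfSection_eq_one_iff r, signOfSection_eq_neg_one_iff hρ r⟩,
      isSignAssignment_signOfSection hpq hρ⟩,
    fun S hS G => ⟨G.differential_comp_differential _ _ hpq hS,
      fun e => G.differential_comp_differential _ _ hpq hS⟩, fun S S' hS hS' => ?_⟩
  obtain ⟨v, rfl⟩ := hS.exists_gauge hpq hS'
  refine ⟨v, rfl, fun G => ?_⟩
  have h := G.isTrigradedIso_gaugeMap (minusV n) (S := S) v
  refine ⟨⟨h, h.homologyIso⟩, fun e => ?_⟩
  have h := G.isTrigradedIso_gaugeMap (hatV e) (S := S) v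
  exact ⟨h, h.homologyIso⟩
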